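/- Let $(M,\mathsf g)$ be a closed (compact, without boundary) smooth $n$-dimensional Riemannian manifold with volume measure $\mathrm{vol}$. Write $\mathfrak X(M)$ for the smooth vector fields, $\Omega^k(M)$ for the smooth $k$-forms, $\flat,\sharp$ for the musical isomorphisms, $\delta$ for the codifferential, and $\Delta=-d\delta-\delta d$, which is invertible on $\delta\Omega^1(M)$ and on $d\Omega^1(M)$. Let $\alpha,\beta>0$ and let $\gamma,\kappa\in[0,1]$ be related by $1-\gamma=(1-\kappa)^2$. Define $\mathcal A:\mathfrak X(M)\to\Omega^1(M)$ by $$\mathcal A u=\big(\mathrm{id}+d\,\Delta^{-1}\delta+\gamma\,\delta\,\Delta^{-1}d+\alpha\,\delta d+\beta\,d\delta\big)u^\flat ,$$ and define an inner product on $\mathfrak X(M)$ by $$\langle u,v\rangle_{\alpha\beta\kappa}=\langle \bar P_\kappa u^\flat,\bar P_\kappa v^\flat\rangle_{L^2}+\alpha\langle du^\flat,dv^\flat\rangle_{L^2}+\beta\langle\delta u^\flat,\delta v^\flat\rangle_{L^2},\qquad \bar P_\kappa=\kappa R+(1-\kappa)P,$$ where $R$ and $P$ are the $L^2$-orthogonal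 projections onto the harmonic and onto the co-closed one-forms. Let $\langle\!\langle U,V\rangle\!\rangle=\langle U\circ\varphi^{-1},V\circ\varphi^{-1}\rangle_{\alpha\beta\kappa}$ for $U,V\in T_\varphi\mathrm{Diff}(M)$ be the corresponding right-invariant metric on $\mathrm{Diff}(M)$. Then the equation $$\dot m+\mathcal L_u m+m\,\mathrm{div}(u)=0,\qquad m=\mathcal A u, \tag{1}$$ is the Euler–Arnold equation of this metric. Explicitly, with the pairing $\langle m,v\rangle=\int_M m(v)\,\mathrm{vol}$ and with $\mathrm{ad}_u v=-\mathcal L_u v=-[u,v]$: 1. $\langle u,v\rangle_{\alpha\beta\kappa}=\langle\mathcal A u,v\rangle$ for all $u,v\in\mathfrak X(M)$. 2. $\langle m,\mathrm{ad}_u v\rangle=\langle \mathcal L_u m+\mathrm{div}(u)\,m,\,v\rangle$ for all $m\in\Omega^1(M)$ and $u,v\in\mathfrak X(M)$; that is, $\mathrm{ad}^*_u m=\mathcal L_u m+\mathrm{div}(u)\,m$. 3. For an open set $J\subseteq\mathbb R$ of times, a smooth curve $t\mapsto u(t)\in\mathfrak X(M)$, $t\in J$, with $m=\mathcal A u$ solves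 (1) if and only if it solves the abstract Euler–Arnold equation of the metric: $\langle\dot u,v\rangle_{\alpha\beta\kappa}+\langle u,\mathrm{ad}_u v\rangle_{\alpha\beta\kappa}=0$ for all $v\in\mathfrak X(M)$ and all $t\in J$. 4. A smooth curve $t\mapsto\varphi_t\in\mathrm{Diff}(M)$, $t\in J$, is a geodesic of the metric (on every $[a,b]\subseteq J$ it is a critical point of the energy $\frac12\int_a^b\langle\!\langle\dot\varphi,\dot\varphi\rangle\!\rangle\,dt$ with respect to smooth variations with fixed endpoints) if and only if $u=\dot\varphi\circ\varphi^{-1}$ solves the abstract Euler–Arnold equation, and, equivalently, if and only if $u$ with $m=\mathcal A u$ solves (1). -/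

import Mathlib

open Set Filter Topology MeasureTheory Bundle Manifold
open scoped ContDiff ENNReal

noncomputable section

namespace EulerArnold

section Fields

variable (n : ℕ) (M : Type*) [TopologicalSpace M] [ChartedSpace (EuclideanSpace ℝ (Fin n)) M]
  [IsManifold (𝓡 n) ∞ M]

/-- The space `𝔛(M)` of smooth vector fields. -/
abbrev VectorFields : Type _ :=
  Cₛ^∞⟮𝓡 n; EuclideanSpace ℝ (Fin n), fun x : M => TangentSpace (𝓡 n) x⟯

/-- The space `Ω¹(M)` of smooth one-forms. -/
abbrev OneForms : Type _ :=
  Cₛ^∞⟮𝓡 n; EuclideanSpace ℝ (Fin n) →L[ℝ] ℝ,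
    fun x : M => TangentSpace (𝓡 n) x →L[ℝ] ℝ⟯

/-- Smooth Riemannian metrics on `M`. -/
abbrev Metric : Type _ :=
  ContMDiffRiemannianMetric (𝓡 n) ∞ (EuclideanSpace ℝ (Fin n))
    (fun x : M => TangentSpace (𝓡 n) x)

/-- The group `Diff(M)` of smooth diffeomorphisms. -/
abbrev Diff : Type _ := Diffeomorph (𝓡 n) (𝓡 n) M M ∞

end Fields

section Calculus

variable {n : ℕ} {M : Type*} [TopologicalSpace M] [ChartedSpace (EuclideanSpace ℝ (Fin n)) M]
  [IsManifold (𝓡 n) ∞ M]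

/-- The `i`-th standard basis vector, regarded as an element of `T_x M`: it is the `i`-th
coordinate vector at `x` of the preferred chart at `x`. -/
def basisVec (x : M) (i : Fin n) : TangentSpace (𝓡 n) x :=
  (EuclideanSpace.single i (1 : ℝ) : EuclideanSpace ℝ (Fin n))

/-- The `i`-th component of a tangent vector at `x` in the preferred chart at `x`. -/
def component (x : M) (v : TangentSpace (𝓡 n) x) (i : Fin n) : ℝ :=
  (EuclideanSpace.proj i : EuclideanSpace ℝ (Fin n) →L[ℝ] ℝ) v

/-- The coordinate vector field `∑ vⁱ ∂/∂xⁱ` of the preferred chart at `x₀` that has the constant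
components `vⁱ` of `v ∈ T_{x₀} M` (used only on the domain of that chart). -/
def coordField (x₀ : M) (v : TangentSpace (𝓡 n) x₀) (y : M) : TangentSpace (𝓡 n) y :=
  (trivializationAt (EuclideanSpace ℝ (Fin n)) (TangentSpace (𝓡 n)) x₀).symm y v

/-- The Gram matrix `g_{ij}(y)` of the coordinate frame of the preferred chart at `x₀`. -/
def gram (g : Metric n M) (x₀ y : M) : Matrix (Fin n) (Fin n) ℝ :=
  Matrix.of fun i j =>
    g.inner y (coordField x₀ (basisVec x₀ i) y) (coordField x₀ (basisVec x₀ j) y)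

/-- The density `√det(g_{ij})(y)` of the Riemannian volume in the preferred chart at `x₀`. -/
def volDensity (g : Metric n M) (x₀ y : M) : ℝ := √(gram g x₀ y).det

/-- Flat: `u♭ = g(u, ·)`. -/
def flat (g : Metric n M) (u : Π x : M, TangentSpace (𝓡 n) x) :
    Π x : M, TangentSpace (𝓡 n) x →L[ℝ] ℝ :=
  fun x => g.inner x (u x)

/-- Sharp: `(a♯)ⁱ = ∑ⱼ gⁱʲ aⱼ`. -/
def sharp (g : Metric n M) (a : Π x : M, TangentSpace (𝓡 n) x →L[ℝ] ℝ) :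
    Π x : M, TangentSpace (𝓡 n) x :=
  fun x => ∑ i, (∑ j, (gram g x x)⁻¹ i j * a x (basisVec x j)) • basisVec x i

/-- The differential of a function. -/
def dFun (f : M → ℝ) : Π x : M, TangentSpace (𝓡 n) x →L[ℝ] ℝ :=
  fun x => mfderiv (𝓡 n) 𝓘(ℝ, ℝ) f x

/-- The divergence, defined by `L_u vol = div(u) vol`; both sides are evaluated at `x` on the
coordinate frame `E₁, …, E_n` of the preferred chart at `x`, where
`(L_u vol)(E₁, …, E_n) = u(vol(E₁, …, E_n)) - ∑ᵢ vol(E₁, …, [u, Eᵢ], …, E_n)`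
and `vol(E₁, …, E_n) = √det(g_{ij})`. -/
def divergence (g : Metric n M) (u : Π x : M, TangentSpace (𝓡 n) x) (x : M) : ℝ :=
  dFun (n := n) (volDensity g x) x (u x) / volDensity g x x
    - ∑ i, component x (VectorField.mlieBracket (𝓡 n) u (coordField x (basisVec x i)) x) i

/-- The Lie derivative `L_u m` of a one-form, evaluated on a vector field `V`:
`(L_u m)(V) = u(m(V)) - m([u, V])`. -/
def lieForm (u : Π x : M, TangentSpace (𝓡 n) x) (m : Π x : M, TangentSpace (𝓡 n) x →L[ℝ] ℝ)
    (V : Π x : M, TangentSpace (𝓡 n) x) (x : M) : ℝ :=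
  dFun (n := n) (fun y => m y (V y)) x (u x) - m x (VectorField.mlieBracket (𝓡 n) u V x)

/-- The exterior derivative of a one-form, evaluated on two vector fields:
`(da)(V, W) = V(a(W)) - W(a(V)) - a([V, W])`. -/
def extDerivFields (a : Π x : M, TangentSpace (𝓡 n) x →L[ℝ] ℝ)
    (V W : Π x : M, TangentSpace (𝓡 n) x) (x : M) : ℝ :=
  dFun (n := n) (fun y => a y (W y)) x (V x) - dFun (n := n) (fun y => a y (V y)) x (W x)
    - a x (VectorField.mlieBracket (𝓡 n) V W x)

/-- The exterior derivative of a one-form as a field of bilinear forms: `(da)_x(v, w)` is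
computed with the coordinate extensions of `v` and `w`. -/
def dForm (a : Π x : M, TangentSpace (𝓡 n) x →L[ℝ] ℝ) :
    Π x : M, TangentSpace (𝓡 n) x → TangentSpace (𝓡 n) x → ℝ :=
  fun x v w => extDerivFields a (coordField x v) (coordField x w) x

/-- The codifferential of a one-form, `δa = -div(a♯)`. -/
def codiffOne (g : Metric n M) (a : Π x : M, TangentSpace (𝓡 n) x →L[ℝ] ℝ) (x : M) : ℝ :=
  -divergence g (sharp g a) x

/-- The pointwise inner product of two-forms, `½ ∑ gⁱᵏ gʲˡ wᵢⱼ w'ₖₗ`. -/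
def twoFormInner (g : Metric n M)
    (w w' : Π x : M, TangentSpace (𝓡 n) x → TangentSpace (𝓡 n) x → ℝ) (x : M) : ℝ :=
  (1 / 2) * ∑ i, ∑ j, ∑ k, ∑ l, (gram g x x)⁻¹ i k * (gram g x x)⁻¹ j l *
    w x (basisVec x i) (basisVec x j) * w' x (basisVec x k) (basisVec x l)

end Calculus

section Volume

variable {n : ℕ} {M : Type*} [TopologicalSpace M] [ChartedSpace (EuclideanSpace ℝ (Fin n)) M]
  [IsManifold (𝓡 n) ∞ M]

theorem contMDiffOn_inner (g : Metric n M) {s : Set M} {V W : Π x : M, TangentSpace (𝓡 n) x}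
    (hV : ContMDiffOn (𝓡 n) (𝓡 n).tangent ∞
      (fun x => (⟨x, V x⟩ : TangentBundle (𝓡 n) M)) s)
    (hW : ContMDiffOn (𝓡 n) (𝓡 n).tangent ∞
      (fun x => (⟨x, W x⟩ : TangentBundle (𝓡 n) M)) s) :
    ContMDiffOn (𝓡 n) 𝓘(ℝ, ℝ) ∞ (fun x => g.inner x (V x) (W x)) s := by
  let _ : RiemannianBundle (fun x : M => TangentSpace (𝓡 n) x) := ⟨g.toRiemannianMetric⟩
  exact ContMDiffOn.inner_bundle hV hW

theorem contMDiffOn_coordField (x₀ : M) (v : TangentSpace (𝓡 n) x₀) :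
    ContMDiffOn (𝓡 n) (𝓡 n).tangent ∞
      (fun y => (⟨y, coordField x₀ v y⟩ : TangentBundle (𝓡 n) M))
      (chartAt (EuclideanSpace ℝ (Fin n)) x₀).source := by
  have h := (Trivialization.contMDiffOn_section_baseSet_iff (IB := 𝓡 n) (n := ∞)
    (F := EuclideanSpace ℝ (Fin n)) (E := fun x : M => TangentSpace (𝓡 n) x)
    (trivializationAt (EuclideanSpace ℝ (Fin n)) (TangentSpace (𝓡 n)) x₀)
    (s := coordField x₀ v)).2
  refine h ?_
  let w : EuclideanSpace ℝ (Fin n) := v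
  refine (contMDiffOn_const (c := w)).congr ?_
  intro y hy
  exact congrArg Prod.snd (Trivialization.apply_mk_symm
    (trivializationAt (EuclideanSpace ℝ (Fin n)) (TangentSpace (𝓡 n)) x₀) hy w)

theorem continuousOn_volDensity (g : Metric n M) (x₀ : M) :
    ContinuousOn (volDensity g x₀) (chartAt (EuclideanSpace ℝ (Fin n)) x₀).source := by
  unfold volDensity
  refine Real.continuous_sqrt.comp_continuousOn ?_
  have h : ContinuousOn (gram g x₀) (chartAt (EuclideanSpace ℝ (Fin n)) x₀).source := by
    refine continuousOn_pi.2 fun i => continuousOn_pi.2 fun j => ?_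
    exact (contMDiffOn_inner g (contMDiffOn_coordField x₀ _)
      (contMDiffOn_coordField x₀ _)).continuousOn
  exact (Continuous.matrix_det continuous_id).comp_continuousOn h

variable [CompactSpace M] [T2Space M]

variable (n M) in
/-- A smooth partition of unity subordinate to the domains of the preferred charts. -/
def partition : SmoothPartitionOfUnity M (𝓡 n) M univ :=
  (SmoothPartitionOfUnity.exists_isSubordinate_chartAt_source (𝓡 n) M).choose

variable (n M) in
theorem partition_isSubordinate :
    (partition n M).IsSubordinate
      (fun x => (chartAt (EuclideanSpace ℝ (Fin n)) x).source) :=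
  (SmoothPartitionOfUnity.exists_isSubordinate_chartAt_source (𝓡 n) M).choose_spec

variable [MeasurableSpace M]

/-- The measure `√det(g_{ij}) dx¹⋯dxⁿ` on the domain of the preferred chart at `x₀`. -/
def chartMeasure (g : Metric n M) (x₀ : M) : Measure M :=
  Measure.map (chartAt (EuclideanSpace ℝ (Fin n)) x₀).symm
    ((volume.restrict (chartAt (EuclideanSpace ℝ (Fin n)) x₀).target).withDensity
      fun y => ENNReal.ofReal
        (volDensity g x₀ ((chartAt (EuclideanSpace ℝ (Fin n)) x₀).symm y)))

/-- The Riemannian volume measure: `∫ f dvol = ∑ᵢ ∫ ρᵢ f √det(g) dx`, where `ρᵢ` is a partition of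
unity subordinate to coordinate charts. -/
def vol (g : Metric n M) : Measure M :=
  Measure.sum fun i : M =>
    (chartMeasure g i).withDensity fun x => ENNReal.ofReal (partition n M i x)

variable [BorelSpace M]

theorem aemeasurable_chart_symm (x₀ : M) (ν : Measure (EuclideanSpace ℝ (Fin n)))
    (hν : ν ≪ volume.restrict (chartAt (EuclideanSpace ℝ (Fin n)) x₀).target) :
    AEMeasurable (chartAt (EuclideanSpace ℝ (Fin n)) x₀).symm ν :=
  ((chartAt (EuclideanSpace ℝ (Fin n)) x₀).continuousOn_symm.aemeasurable
    (chartAt (EuclideanSpace ℝ (Fin n)) x₀).open_target.measurableSet).mono_ac hν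

theorem lintegral_partition_lt_top (g : Metric n M) (i : M) :
    ∫⁻ x, ENNReal.ofReal (partition n M i x) ∂(chartMeasure g i) < ⊤ := by
  set e := chartAt (EuclideanSpace ℝ (Fin n)) i with he
  have hρ : Continuous (partition n M i) := (partition n M i).contMDiff.continuous
  have hsub : tsupport (partition n M i) ⊆ e.source := partition_isSubordinate n M i
  have hK : IsCompact (tsupport (partition n M i)) := (isClosed_tsupport _).isCompact
  have hdc : ContinuousOn (fun y => volDensity g i (e.symm y)) e.target :=
    (continuousOn_volDensity g i).comp e.continuousOn_symm e.symm.mapsTo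
  have hdm : AEMeasurable (fun y => ENNReal.ofReal (volDensity g i (e.symm y)))
      (volume.restrict e.target) :=
    (ENNReal.continuous_ofReal.comp_continuousOn hdc).aemeasurable e.open_target.measurableSet
  have hρm : AEMeasurable (fun y => ENNReal.ofReal (partition n M i (e.symm y)))
      (volume.restrict e.target) :=
    (hρ.measurable.ennreal_ofReal).comp_aemeasurable
      (aemeasurable_chart_symm i _ (Measure.AbsolutelyContinuous.refl _))
  unfold chartMeasure
  rw [lintegral_map' (by fun_prop)
    (aemeasurable_chart_symm i _ (withDensity_absolutelyContinuous _ _)),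
    lintegral_withDensity_eq_lintegral_mul₀ hdm hρm]
  set L : Set (EuclideanSpace ℝ (Fin n)) := e '' tsupport (partition n M i) with hL
  have hLc : IsCompact L := hK.image_of_continuousOn (e.continuousOn.mono hsub)
  have hLt : L ⊆ e.target := by
    rintro _ ⟨x, hx, rfl⟩
    exact e.map_source (hsub hx)
  obtain ⟨C, hC⟩ := hLc.bddAbove_image (hdc.mono hLt)
  refine lt_of_le_of_lt (b := ∫⁻ _ in L, ENNReal.ofReal C) ?_ ?_
  · rw [← lintegral_indicator hLc.measurableSet,
      ← lintegral_indicator e.open_target.measurableSet]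
    refine lintegral_mono fun y => ?_
    by_cases hy : y ∈ e.target
    · by_cases hyL : y ∈ L
      · rw [indicator_of_mem hy, indicator_of_mem hyL]
        have h1 : ENNReal.ofReal (partition n M i (e.symm y)) ≤ 1 := by
          rw [← ENNReal.ofReal_one]
          exact ENNReal.ofReal_le_ofReal ((partition n M).le_one i _)
        have h2 : ENNReal.ofReal (volDensity g i (e.symm y)) ≤ ENNReal.ofReal C :=
          ENNReal.ofReal_le_ofReal (hC ⟨y, hyL, rfl⟩)
        exact (mul_le_mul' h2 h1).trans (mul_one _).le
      · have h0 : partition n M i (e.symm y) = 0 := by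
          by_contra h
          exact hyL ⟨e.symm y, subset_tsupport _ h, e.right_inv hy⟩
        rw [indicator_of_mem hy]
        simp [h0]
    · rw [indicator_of_notMem hy]
      exact zero_le
  · rw [setLIntegral_const]
    exact ENNReal.mul_lt_top ENNReal.ofReal_lt_top hLc.measure_lt_top

instance isFiniteMeasure_vol (g : Metric n M) : IsFiniteMeasure (vol g) := by
  refine ⟨?_⟩
  unfold vol
  rw [Measure.sum_apply _ MeasurableSet.univ]
  have hfin := (partition n M).locallyFinite.finite_nonempty_of_compact
  rw [tsum_eq_sum (s := hfin.toFinset)]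
  · refine ENNReal.sum_lt_top.2 fun i _ => ?_
    rw [withDensity_apply _ MeasurableSet.univ, Measure.restrict_univ]
    exact lintegral_partition_lt_top g i
  · intro i hi
    have h0 : ∀ x, partition n M i x = 0 := by
      intro x
      by_contra h
      exact hi (hfin.mem_toFinset.2 ⟨x, h⟩)
    simp [h0]

theorem integrable_inner (g : Metric n M) (u v : VectorFields n M) :
    Integrable (fun x => g.inner x (u x) (v x)) (vol g) := by
  have h : Continuous (fun x => g.inner x (u x) (v x)) := by
    rw [← continuousOn_univ]
    exact (contMDiffOn_inner g u.contMDiff.contMDiffOn v.contMDiff.contMDiffOn).continuousOn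
  exact h.integrable_of_hasCompactSupport (HasCompactSupport.of_compactSpace _)

end Volume

section Hilbert

variable {n : ℕ} {M : Type*} [TopologicalSpace M] [ChartedSpace (EuclideanSpace ℝ (Fin n)) M]
  [IsManifold (𝓡 n) ∞ M] [CompactSpace M] [T2Space M] [MeasurableSpace M] [BorelSpace M]

/-- A copy of `𝔛(M)`, to carry the `L²` inner product of the metric `g`. -/
def PreL2 (_g : Metric n M) : Type _ := VectorFields n M

/-- The underlying vector field. -/
def PreL2.field {g : Metric n M} (u : PreL2 g) : VectorFields n M := u

instance (g : Metric n M) : AddCommGroup (PreL2 g) :=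
  inferInstanceAs (AddCommGroup (VectorFields n M))

instance (g : Metric n M) : Module ℝ (PreL2 g) :=
  inferInstanceAs (Module ℝ (VectorFields n M))

/-- The `L²` inner product `⟨u, v⟩ = ∫ g(u, v) dvol` on `𝔛(M)`. -/
@[reducible] def preL2Core (g : Metric n M) : PreInnerProductSpace.Core ℝ (PreL2 g) where
  inner u v := ∫ x, g.inner x (u.field x) (v.field x) ∂(vol g)
  conj_inner_symm u v := by
    simp only [conj_trivial]
    exact integral_congr_ae (ae_of_all _ fun x => g.symm x _ _)
  re_inner_nonneg u := by
    refine integral_nonneg fun x => ?_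
    by_cases h : u.field x = 0
    · simp [h]
    · exact (g.pos x _ h).le
  add_left u v w := by
    rw [← integral_add (integrable_inner g u.field w.field)
      (integrable_inner g v.field w.field)]
    refine integral_congr_ae (ae_of_all _ fun x => ?_)
    change g.inner x (u.field x + v.field x) _ = _
    simp
  smul_left u v r := by
    simp only [conj_trivial]
    rw [← integral_const_mul]
    refine integral_congr_ae (ae_of_all _ fun x => ?_)
    change g.inner x (r • u.field x) _ = _
    simp

instance (g : Metric n M) : SeminormedAddCommGroup (PreL2 g) :=
  InnerProductSpace.Core.toSeminormedAddCommGroup (c := preL2Core g)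

instance (g : Metric n M) : InnerProductSpace ℝ (PreL2 g) :=
  InnerProductSpace.ofCore (preL2Core g)

/-- The Hilbert space of `L²` vector fields, i.e. of `L²` one-forms via the isometry `♭`. -/
abbrev L2 (g : Metric n M) : Type _ := UniformSpace.Completion (PreL2 g)

/-- The inclusion `𝔛(M) → L²`. -/
def toL2 (g : Metric n M) (u : VectorFields n M) : L2 g :=
  ((show PreL2 g from u : PreL2 g) : UniformSpace.Completion (PreL2 g))

/-- `σ = δw` for a two-form `w`: the codifferential is the formal adjoint of `d`, that is
`⟨dc, w⟩ = ⟨c, σ⟩` in `L²` for all `c ∈ Ω¹(M)`, where `⟨c, σ⟩ = ∫ σ(c♯) dvol`. -/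
def IsCodiffTwo (g : Metric n M)
    (w : Π x : M, TangentSpace (𝓡 n) x → TangentSpace (𝓡 n) x → ℝ)
    (σ : Π x : M, TangentSpace (𝓡 n) x →L[ℝ] ℝ) : Prop :=
  ∀ c : OneForms n M,
    ∫ x, twoFormInner g (dForm c) w x ∂(vol g) = ∫ x, σ x (sharp g c x) ∂(vol g)

/-- `u♭` is harmonic: `Δ u♭ = -dδu♭ - δdu♭ = 0`, that is `δ(du♭) = -d(δu♭)`. -/
def IsHarmonicField (g : Metric n M) (u : VectorFields n M) : Prop :=
  IsCodiffTwo g (dForm (flat g u)) (fun x => -dFun (codiffOne g (flat g u)) x)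

/-- The closed subspace of `L²` generated by the fields `u` with `δu♭ = 0`. -/
def coclosedL2 (g : Metric n M) : Submodule ℝ (L2 g) :=
  (Submodule.span ℝ
    (toL2 g '' {u : VectorFields n M | ∀ x, codiffOne g (flat g u) x = 0})).topologicalClosure

/-- The closed subspace of `L²` generated by the fields `u` with `u♭` harmonic. -/
def harmonicL2 (g : Metric n M) : Submodule ℝ (L2 g) :=
  (Submodule.span ℝ (toL2 g '' {u : VectorFields n M | IsHarmonicField g u})).topologicalClosure

instance (g : Metric n M) : CompleteSpace (coclosedL2 g) :=
  inferInstanceAs (CompleteSpace (Submodule.topologicalClosure _))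

instance (g : Metric n M) : CompleteSpace (harmonicL2 g) :=
  inferInstanceAs (CompleteSpace (Submodule.topologicalClosure _))

/-- `P̄_κ = κ R + (1 - κ) P`, where `R` and `P` are the `L²` orthogonal projections onto the
harmonic and onto the co-closed part. -/
def Pbar (g : Metric n M) (κ : ℝ) : L2 g →L[ℝ] L2 g :=
  κ • (harmonicL2 g).starProjection + (1 - κ) • (coclosedL2 g).starProjection

/-- The inner product
`⟨u, v⟩_{αβκ} = ⟨P̄_κ u♭, P̄_κ v♭⟩ + α ⟨du♭, dv♭⟩ + β ⟨δu♭, δv♭⟩` on `𝔛(M)`. -/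
def innerABK (g : Metric n M) (α β κ : ℝ) (u v : VectorFields n M) : ℝ :=
  inner ℝ (Pbar g κ (toL2 g u)) (Pbar g κ (toL2 g v))
    + α * ∫ x, twoFormInner g (dForm (flat g u)) (dForm (flat g v)) x ∂(vol g)
    + β * ∫ x, codiffOne g (flat g u) x * codiffOne g (flat g v) x ∂(vol g)

/-- `f = Δ⁻¹ h` on functions: `f ∈ C^∞(M)` has zero mean and `Δf = -δdf = h`. -/
def IsInvLaplaceFun (g : Metric n M) (f h : M → ℝ) : Prop :=
  ContMDiff (𝓡 n) 𝓘(ℝ, ℝ) ∞ f ∧ ∫ x, f x ∂(vol g) = 0 ∧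
    ∀ x, -codiffOne g (dFun f) x = h x

/-- `w = Δ⁻¹ h` on exact two-forms, with `σ = δw`: `w ∈ dΩ¹(M)` and `Δw = h`, where
`Δw = -dδw - δdw = -dσ` because `dw = 0`. -/
def IsInvLaplaceTwo (g : Metric n M)
    (w h : Π x : M, TangentSpace (𝓡 n) x → TangentSpace (𝓡 n) x → ℝ) (σ : OneForms n M) : Prop :=
  (∃ η : OneForms n M, w = dForm η) ∧ IsCodiffTwo g w σ ∧ ∀ x v v', -dForm σ x v v' = h x v v'

/-- The graph of the operator `𝒜 : 𝔛(M) → Ω¹(M)`: `m = 𝒜 u` with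
`𝒜 u = (id + d Δ⁻¹ δ + γ δ Δ⁻¹ d + α δ d + β d δ) u♭`. Here `f = Δ⁻¹ δ u♭`, `w = Δ⁻¹ d u♭`,
`σ = δ w` and `τ = δ d u♭`. -/
def IsInertia (g : Metric n M) (α β γ : ℝ) (u : VectorFields n M) (m : OneForms n M) : Prop :=
  ∃ (f : M → ℝ) (w : Π x : M, TangentSpace (𝓡 n) x → TangentSpace (𝓡 n) x → ℝ)
    (σ τ : OneForms n M),
    IsInvLaplaceFun g f (codiffOne g (flat g u)) ∧
    IsInvLaplaceTwo g w (dForm (flat g u)) σ ∧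
    IsCodiffTwo g (dForm (flat g u)) τ ∧
    ∀ x, m x = flat g u x + dFun f x + γ • σ x + α • τ x
      + β • dFun (codiffOne g (flat g u)) x

/-- The pairing `⟨m, u⟩ = ∫ m(u) dvol` of `Ω¹(M)` and `𝔛(M)`. -/
def pairing (g : Metric n M) (m : OneForms n M) (u : VectorFields n M) : ℝ :=
  ∫ x, m x (u x) ∂(vol g)

open Classical in
/-- A vector field as an element of `𝔛(M)` (zero if it is not smooth). -/
def toField (u : Π x : M, TangentSpace (𝓡 n) x) : VectorFields n M :=
  if h : ContMDiff (𝓡 n) (𝓡 n).tangent ∞ (fun x => (⟨x, u x⟩ : TangentBundle (𝓡 n) M))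
  then ⟨u, h⟩ else 0

/-- `ad_u v = -L_u v = -[u, v]`, the adjoint action of the Lie algebra `𝔛(M)` of `Diff(M)`. -/
def adField (u v : VectorFields n M) : VectorFields n M :=
  toField fun x => -VectorField.mlieBracket (𝓡 n) u v x

/-- The dual operator of `ad_u` on functionals on `𝔛(M)`. -/
def adStar (u : VectorFields n M) (ℓ : VectorFields n M → ℝ) : VectorFields n M → ℝ :=
  fun v => ℓ (adField u v)

/-- The time derivative of a curve in `𝔛(M)`. -/
def timeDeriv (u : ℝ → VectorFields n M) (t : ℝ) : VectorFields n M :=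
  toField fun x => deriv (fun s => (u s x : EuclideanSpace ℝ (Fin n))) t

/-- A curve `t ↦ u(t)` in `𝔛(M)`, smooth for `t ∈ J`. -/
def IsSmoothFieldCurve (J : Set ℝ) (u : ℝ → VectorFields n M) : Prop :=
  ContMDiffOn (𝓘(ℝ, ℝ).prod (𝓡 n)) (𝓡 n).tangent ∞
    (fun p : ℝ × M => (⟨p.2, u p.1 p.2⟩ : TangentBundle (𝓡 n) M)) (J ×ˢ univ)

/-- A curve `t ↦ m(t)` in `Ω¹(M)`, smooth for `t ∈ J`. -/
def IsSmoothFormCurve (J : Set ℝ) (m : ℝ → OneForms n M) : Prop :=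
  ContMDiffOn (𝓘(ℝ, ℝ).prod (𝓡 n)) ((𝓡 n).prod 𝓘(ℝ, EuclideanSpace ℝ (Fin n) →L[ℝ] ℝ)) ∞
    (fun p : ℝ × M => TotalSpace.mk' (EuclideanSpace ℝ (Fin n) →L[ℝ] ℝ)
      (E := fun x : M => TangentSpace (𝓡 n) x →L[ℝ] ℝ) p.2 (m p.1 p.2)) (J ×ˢ univ)

/-- The equation `ṁ + L_u m + m div(u) = 0` on the time set `J`, tested on all vector fields. -/
def SolvesEquation (g : Metric n M) (J : Set ℝ) (u : ℝ → VectorFields n M)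
    (m : ℝ → OneForms n M) : Prop :=
  ∀ t ∈ J, ∀ (V : VectorFields n M) (x : M),
    deriv (fun s => m s x (V x)) t + lieForm (u t) (m t) V x
      + m t x (V x) * divergence g (u t) x = 0

/-- The abstract Euler–Arnold equation `𝒜 u̇ + ad*_u (𝒜 u) = 0` in the dual of `𝔛(M)`, where
`𝒜 u = ⟨u, ·⟩_{αβκ}`. -/
def SolvesEulerArnold (g : Metric n M) (α β κ : ℝ) (J : Set ℝ)
    (u : ℝ → VectorFields n M) : Prop :=
  ∀ t ∈ J, innerABK g α β κ (timeDeriv u t) + adStar (u t) (innerABK g α β κ (u t)) = 0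

/-- The velocity `∂_t φ_t ∈ T_{φ_t} Diff(M)` of a curve of diffeomorphisms, a vector field
along `φ_t`. -/
def velocity (φ : ℝ → Diff n M) (t : ℝ) (x : M) : TangentSpace (𝓡 n) (φ t x) :=
  mfderiv 𝓘(ℝ, ℝ) (𝓡 n) (fun s => φ s x) t (1 : ℝ)

/-- The right translation `U ∘ φ⁻¹ ∈ 𝔛(M)` of `U ∈ T_φ Diff(M)` to the identity. -/
def rightTranslate (φ : Diff n M) (U : Π x : M, TangentSpace (𝓡 n) (φ x)) : VectorFields n M :=
  toField fun y => (U (φ.symm y) : EuclideanSpace ℝ (Fin n))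

/-- The right-invariant metric `⟪U, V⟫ = ⟨U ∘ φ⁻¹, V ∘ φ⁻¹⟩_{αβκ}` on `T_φ Diff(M)`. -/
def metricDiff (g : Metric n M) (α β κ : ℝ) (φ : Diff n M)
    (U V : Π x : M, TangentSpace (𝓡 n) (φ x)) : ℝ :=
  innerABK g α β κ (rightTranslate φ U) (rightTranslate φ V)

/-- The energy `½ ∫ₐᵇ ⟪φ̇, φ̇⟫ dt` of a curve in `Diff(M)`. -/
def energy (g : Metric n M) (α β κ : ℝ) (a b : ℝ) (φ : ℝ → Diff n M) : ℝ :=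
  (1 / 2) * ∫ t in a..b, metricDiff g α β κ (φ t) (velocity φ t) (velocity φ t)

/-- A curve `t ↦ φ_t` in `Diff(M)`, smooth for `t ∈ J`. -/
def IsSmoothCurve (J : Set ℝ) (φ : ℝ → Diff n M) : Prop :=
  ContMDiffOn (𝓘(ℝ, ℝ).prod (𝓡 n)) (𝓡 n) ∞ (fun p : ℝ × M => φ p.1 p.2) (J ×ˢ univ)

/-- A family of curves `t ↦ Φ_{s,t}` in `Diff(M)`, smooth for `s ∈ S` and `t ∈ J`. -/
def IsSmoothFamily (S J : Set ℝ) (Φ : ℝ → ℝ → Diff n M) : Prop :=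
  ContMDiffOn (𝓘(ℝ, ℝ).prod (𝓘(ℝ, ℝ).prod (𝓡 n))) (𝓡 n) ∞
    (fun p : ℝ × ℝ × M => Φ p.1 p.2.1 p.2.2) (S ×ˢ J ×ˢ univ)

/-- A smooth curve in `Diff(M)` is a geodesic for `t ∈ J` if, on each compact interval
`[a, b] ⊆ J`, it is a critical point of the energy among smooth curves with the same endpoints. -/
def IsGeodesic (g : Metric n M) (α β κ : ℝ) (J : Set ℝ) (φ : ℝ → Diff n M) : Prop :=
  ∀ a b : ℝ, a < b → Icc a b ⊆ J → ∀ ε > 0, ∀ Φ : ℝ → ℝ → Diff n M,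
    IsSmoothFamily (Ioo (-ε) ε) J Φ →
    (∀ t ∈ J, Φ 0 t = φ t) →
    (∀ s ∈ Ioo (-ε) ε, Φ s a = φ a ∧ Φ s b = φ b) →
    HasDerivAt (fun s => energy g α β κ a b (Φ s)) 0 0

/-- The right reduced velocity `u(t) = φ̇_t ∘ φ_t⁻¹ ∈ 𝔛(M)`. -/
def reducedVelocity (φ : ℝ → Diff n M) (t : ℝ) : VectorFields n M :=
  rightTranslate (φ t) (velocity φ t)

end Hilbert

end EulerArnold

end

open EulerArnold

/-!
# The Euler–Arnold equation of the metric `⟨·,·⟩_{αβκ}` on `Diff(M)`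

**The inertia operator** (`innerABK_eq_pairing`). Let `f = Δ⁻¹δu♭`, `σ = δΔ⁻¹du♭` and let `s = σ♯`.
The field `h = u + grad f + s` is closed and co-closed, hence harmonic, so that
`u = h - grad f - s` is the Hodge decomposition of `u`; no elliptic theory is needed, because `𝒜`
is given through the solutions of the Poisson equations. The operator `P̄_κ` fixes `h`, kills
`grad f` and multiplies `s` by `1 - κ` (`Pbar_harmonic`, `Pbar_grad`, `Pbar_coexact`). As it is
self-adjoint, the first term of the inner product is `⟨P̄_κ² u, v⟩` with
`P̄_κ² u = h - (1 - κ)² s = u + grad f + γ s`. The terms with `α` and `β` are integrations by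
parts.

**The coadjoint action** (`adStar_pairing`). The Leibniz rule gives
`(L_u m)(v) + div(u) m(v) = div(m(v) u) - m([u, v])`, and the divergence integrates to zero
(`integral_divergence`). For this, the divergence is identified with half the trace of `L_u g`
(`divergence_eq_trace`), which makes it independent of charts; the measure is shown to be
`√det(g_{ij}) dx` in each chart (`vol_restrict_source`); and a partition of unity reduces the claim
to `div(h ∂ᵢ) √det g = ∂ᵢ(h √det g)`.

**The equation on one-forms** (`solvesEquation_iff`). Differentiating `⟨u, v⟩_{αβκ} = ∫ m(v) dvol`
in time (`hasLineDerivAt_innerABK`) shows that the abstract Euler–Arnold equation is the integral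
over `M` of the equation evaluated on `v` (`eulerArnold_eq_integral`), and the fundamental lemma of
the calculus of variations removes the integral.

**Geodesics** (`isGeodesic_iff_solvesEulerArnold`). The velocities `U`, `V` of a two-parameter
family `Φ_{s,t}`, in the directions of `t` and `s`, satisfy the structure equation
`∂_s U = ∂_t V + [U, V]` (`fieldDeriv_familyVelocity`). With an integration by parts in `t` it
yields the first variation formula (`hasDerivAt_energy`): the derivative of the energy is minus the
integral of the Euler–Arnold functional evaluated on `V`. Hence solutions are geodesics.
Conversely, one needs enough variations. A field `h ∂ᵢ` with `h` supported in a chart is the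
initial velocity of the diffeomorphisms `ψ_s` that are `y ↦ y + s h(y) ∂ᵢ` in the chart
(`exists_diffFamily_velocity`); varying a geodesic by `ψ_{sχ(t)} ∘ φ_t`, with bump functions `χ`,
shows that the functional vanishes on these fields (`IsGeodesic.eulerArnoldTerm_eq_zero`), and they
span `𝔛(M)`.

Families of vector fields depending smoothly on parameters (`FieldFamily`) are handled through
their inner products with fixed fields. A finite global frame with a dual frame (`frame`) makes
such tests sufficient and expresses the tensors in question through derivatives of functions.
-/

open Set Filter Topology MeasureTheory Bundle Manifold
open scoped ContDiff ENNReal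

noncomputable section

namespace EulerArnold

open VectorField

set_option linter.unusedSectionVars false

/-! ### Derivatives of functions and Lie brackets -/

section PointwiseCalculus

variable {n : ℕ} {M : Type*} [TopologicalSpace M] [ChartedSpace (EuclideanSpace ℝ (Fin n)) M]
  [IsManifold (𝓡 n) ∞ M]

/-- The vector field `V` is smooth at `x`. -/
abbrev FieldSmoothAt (V : Π x : M, TangentSpace (𝓡 n) x) (x : M) : Prop :=
  ContMDiffAt (𝓡 n) (𝓡 n).tangent ∞ (fun y => (⟨y, V y⟩ : TangentBundle (𝓡 n) M)) x

/-- The vector field `V` is differentiable at `x`. -/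
abbrev FieldDiffAt (V : Π x : M, TangentSpace (𝓡 n) x) (x : M) : Prop :=
  MDifferentiableAt (𝓡 n) (𝓡 n).tangent (fun y => (⟨y, V y⟩ : TangentBundle (𝓡 n) M)) x

/-- The real function `f` is differentiable at `x`. -/
abbrev FunDiffAt (f : M → ℝ) (x : M) : Prop := MDifferentiableAt (𝓡 n) 𝓘(ℝ, ℝ) f x

/-- The real function `f` is smooth at `x`. -/
abbrev FunSmoothAt (f : M → ℝ) (x : M) : Prop := ContMDiffAt (𝓡 n) 𝓘(ℝ, ℝ) ∞ f x

theorem FieldSmoothAt.diffAt {V : Π x : M, TangentSpace (𝓡 n) x} {x : M}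
    (h : FieldSmoothAt V x) : FieldDiffAt V x := h.mdifferentiableAt (by simp)

theorem FunSmoothAt.diffAt {f : M → ℝ} {x : M}
    (h : FunSmoothAt (n := n) f x) : FunDiffAt (n := n) f x := h.mdifferentiableAt (by simp)

theorem two_le_infty : (2 : ℕ∞ω) ≤ (∞ : ℕ∞ω) :=
  WithTop.coe_le_coe.2 (le_top : (2 : ℕ∞) ≤ ⊤)

theorem dFun_add {f h : M → ℝ} {x : M} (hf : FunDiffAt (n := n) f x)
    (hh : FunDiffAt (n := n) h x) :
    dFun (n := n) (fun y => f y + h y) x = dFun f x + dFun h x :=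
  (hf.hasMFDerivAt.add hh.hasMFDerivAt).mfderiv

theorem dFun_mul {f h : M → ℝ} {x : M} (hf : FunDiffAt (n := n) f x)
    (hh : FunDiffAt (n := n) h x) :
    dFun (n := n) (fun y => f y * h y) x = f x • dFun h x + h x • dFun f x :=
  (hf.hasMFDerivAt.mul hh.hasMFDerivAt).mfderiv

theorem dFun_const (c : ℝ) (x : M) : dFun (n := n) (fun _ => c) x = 0 :=
  mfderiv_const

theorem dFun_neg {f : M → ℝ} {x : M} :
    dFun (n := n) (fun y => - f y) x = - dFun f x :=
  mfderiv_neg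

theorem dFun_congr {f h : M → ℝ} {x : M} (hfh : f =ᶠ[𝓝 x] h) :
    dFun (n := n) f x = dFun h x :=
  hfh.mfderiv_eq

/-- The derivative of a function at `x`, computed in the preferred chart at `x`. -/
theorem dFun_eq_fderiv {f : M → ℝ} {x : M} (hf : FunDiffAt (n := n) f x)
    (v : EuclideanSpace ℝ (Fin n)) :
    dFun (n := n) f x v =
      fderiv ℝ (f ∘ (extChartAt (𝓡 n) x).symm) (extChartAt (𝓡 n) x x) v := by
  unfold dFun
  rw [hf.mfderiv]
  simp only [ModelWithCorners.Boundaryless.range_eq_univ, fderivWithin_univ]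
  rfl

/-- A function is differentiable at `x` if it is so in the preferred chart at `x`. -/
theorem funDiffAt_of_chart {f : M → ℝ} {x : M}
    (hf : DifferentiableAt ℝ (f ∘ (extChartAt (𝓡 n) x).symm) (extChartAt (𝓡 n) x x)) :
    FunDiffAt (n := n) f x := by
  have h1 : MDifferentiableAt (𝓡 n) 𝓘(ℝ, ℝ)
      ((f ∘ (extChartAt (𝓡 n) x).symm) ∘ extChartAt (𝓡 n) x) x :=
    hf.mdifferentiableAt.comp x (mdifferentiableAt_extChartAt (mem_chart_source _ x))
  refine h1.congr_of_eventuallyEq ?_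
  filter_upwards [extChartAt_source_mem_nhds (I := 𝓡 n) x] with y hy
  simp only [Function.comp_apply, (extChartAt (𝓡 n) x).left_inv hy]

/-- The representation of the field `V` in the preferred chart at `x`. -/
def chartRep (x : M) (V : Π x : M, TangentSpace (𝓡 n) x) (y : EuclideanSpace ℝ (Fin n)) :
    EuclideanSpace ℝ (Fin n) :=
  mpullbackWithin 𝓘(ℝ, EuclideanSpace ℝ (Fin n)) (𝓡 n) (extChartAt (𝓡 n) x).symm V
    (range (𝓡 n)) y

/-- The Lie bracket at `x` in the preferred chart at `x`. No change of frame appears, since the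
derivative of this chart at `x` is the identity. -/
theorem mlieBracket_eq_chart (V W : Π x : M, TangentSpace (𝓡 n) x) (x : M) :
    (mlieBracket (𝓡 n) V W x : EuclideanSpace ℝ (Fin n)) =
      fderiv ℝ (chartRep x W) (extChartAt (𝓡 n) x x) (chartRep x V (extChartAt (𝓡 n) x x)) -
      fderiv ℝ (chartRep x V) (extChartAt (𝓡 n) x x) (chartRep x W (extChartAt (𝓡 n) x x)) := by
  rw [← mlieBracketWithin_univ, mlieBracketWithin_apply, mfderiv_extChartAt_self]
  have := ContinuousLinearMap.inverse_id (R := ℝ) (M := EuclideanSpace ℝ (Fin n))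
  erw [this]
  simp only [preimage_univ, univ_inter, ModelWithCorners.Boundaryless.range_eq_univ]
  unfold chartRep
  simp only [ModelWithCorners.Boundaryless.range_eq_univ]
  erw [lieBracketWithin_univ]
  rfl

theorem differentiableAt_chartRep {V : Π x : M, TangentSpace (𝓡 n) x} {x : M}
    (hV : FieldDiffAt V x) :
    DifferentiableAt ℝ (chartRep x V) (extChartAt (𝓡 n) x x) := by
  have := MDifferentiableWithinAt.differentiableWithinAt_mpullbackWithin_vectorField
    (V := V) (mdifferentiableWithinAt_univ.2 hV)
  rw [preimage_univ, univ_inter] at this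
  unfold chartRep
  rw [ModelWithCorners.Boundaryless.range_eq_univ] at this ⊢
  exact differentiableWithinAt_univ.1 this

/-- The derivative `V f` at any point of the domain of the preferred chart at `x`. -/
theorem dFun_chart_symm {f : M → ℝ} {x : M} (V : Π x : M, TangentSpace (𝓡 n) x)
    {y : EuclideanSpace ℝ (Fin n)} (hy : y ∈ (extChartAt (𝓡 n) x).target)
    (hf : FunDiffAt (n := n) f ((extChartAt (𝓡 n) x).symm y)) :
    dFun (n := n) f ((extChartAt (𝓡 n) x).symm y) (V ((extChartAt (𝓡 n) x).symm y)) =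
      fderiv ℝ (f ∘ (extChartAt (𝓡 n) x).symm) y (chartRep x V y) := by
  have hφ : MDifferentiableAt 𝓘(ℝ, EuclideanSpace ℝ (Fin n)) (𝓡 n) (extChartAt (𝓡 n) x).symm y := by
    have := mdifferentiableWithinAt_extChartAt_symm (I := 𝓡 n) hy
    simpa only [ModelWithCorners.Boundaryless.range_eq_univ,
      mdifferentiableWithinAt_univ] using this
  have hinv := isInvertible_mfderivWithin_extChartAt_symm (I := 𝓡 n) hy
  rw [← mfderiv_eq_fderiv, mfderiv_comp y hf hφ]
  have h : mfderiv 𝓘(ℝ, EuclideanSpace ℝ (Fin n)) (𝓡 n) (extChartAt (𝓡 n) x).symm y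
      (chartRep x V y) = V ((extChartAt (𝓡 n) x).symm y) := by
    unfold chartRep
    rw [mpullbackWithin_apply]
    simp only [ModelWithCorners.Boundaryless.range_eq_univ, mfderivWithin_univ] at hinv ⊢
    exact hinv.self_apply_inverse _
  exact (congrArg (dFun (n := n) f ((extChartAt (𝓡 n) x).symm y)) h).symm

/-- The function `V f`, read in the preferred chart at `x`. -/
theorem dFun_comp_chart {f : M → ℝ} {x : M} (V : Π x : M, TangentSpace (𝓡 n) x)
    (hf : FunSmoothAt (n := n) f x) :
    (fun y => dFun (n := n) f y (V y)) ∘ (extChartAt (𝓡 n) x).symm =ᶠ[𝓝 (extChartAt (𝓡 n) x x)]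
      fun y => fderiv ℝ (f ∘ (extChartAt (𝓡 n) x).symm) y (chartRep x V y) := by
  have h1 : ∀ᶠ z in 𝓝 x, FunDiffAt (n := n) f z := by
    have h1 : ContMDiffAt (𝓡 n) 𝓘(ℝ, ℝ) 1 f x := hf.of_le (by simp)
    filter_upwards [(contMDiffAt_iff_contMDiffAt_nhds (by simp)).1 h1] with z hz
    exact hz.mdifferentiableAt (by simp)
  have hc : ContinuousAt (extChartAt (𝓡 n) x).symm (extChartAt (𝓡 n) x x) :=
    continuousAt_extChartAt_symm x
  rw [← extChartAt_to_inv (I := 𝓡 n) x] at h1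
  filter_upwards [hc.eventually h1, extChartAt_target_mem_nhds (I := 𝓡 n) x] with y hy hyt
  exact dFun_chart_symm V hyt hy

theorem contDiffAt_chart {f : M → ℝ} {x : M} (hf : FunSmoothAt (n := n) f x) :
    ContDiffAt ℝ ∞ (f ∘ (extChartAt (𝓡 n) x).symm) (extChartAt (𝓡 n) x x) := by
  have h := (contMDiffAt_iff.1 hf).2
  rw [ModelWithCorners.Boundaryless.range_eq_univ, contDiffWithinAt_univ] at h
  exact h

theorem funDiffAt_dFun {f : M → ℝ} {x : M} {V : Π x : M, TangentSpace (𝓡 n) x}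
    (hf : FunSmoothAt (n := n) f x) (hV : FieldDiffAt V x) :
    FunDiffAt (n := n) (fun y => dFun (n := n) f y (V y)) x := by
  refine funDiffAt_of_chart ?_
  refine DifferentiableAt.congr_of_eventuallyEq ?_ (dFun_comp_chart V hf)
  exact (((contDiffAt_chart hf).fderiv_right (m := ∞)
    (by simp)).differentiableAt (by simp)).clm_apply (differentiableAt_chartRep hV)

/-- The Lie bracket of vector fields is the commutator of derivations. -/
theorem dFun_mlieBracket {f : M → ℝ} {x : M} {V W : Π x : M, TangentSpace (𝓡 n) x}
    (hf : FunSmoothAt (n := n) f x) (hV : FieldDiffAt V x) (hW : FieldDiffAt W x) :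
    dFun (n := n) f x (mlieBracket (𝓡 n) V W x) =
      dFun (n := n) (fun y => dFun (n := n) f y (W y)) x (V x)
        - dFun (n := n) (fun y => dFun (n := n) f y (V y)) x (W x) := by
  have hc : (extChartAt (𝓡 n) x).symm (extChartAt (𝓡 n) x x) = x := extChartAt_to_inv x
  have key : ∀ V : Π x : M, TangentSpace (𝓡 n) x, ∀ h : M → ℝ, FunDiffAt (n := n) h x →
      dFun (n := n) h x (V x) = fderiv ℝ (h ∘ (extChartAt (𝓡 n) x).symm) (extChartAt (𝓡 n) x x)
        (chartRep x V (extChartAt (𝓡 n) x x)) := by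
    intro V h hh
    have := dFun_chart_symm (f := h) (x := x) V (y := extChartAt (𝓡 n) x x)
      (mem_extChartAt_target x) (by rwa [hc])
    rwa [hc] at this
  rw [key V _ (funDiffAt_dFun hf hW), key W _ (funDiffAt_dFun hf hV)]
  rw [(dFun_comp_chart W hf).fderiv_eq, (dFun_comp_chart V hf).fderiv_eq]
  have h2 : DifferentiableAt ℝ (fderiv ℝ (f ∘ (extChartAt (𝓡 n) x).symm)) (extChartAt (𝓡 n) x x) :=
    ((contDiffAt_chart hf).fderiv_right (m := ∞) (by simp)).differentiableAt (by simp)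
  rw [fderiv_clm_apply h2 (differentiableAt_chartRep hW),
    fderiv_clm_apply h2 (differentiableAt_chartRep hV)]
  have hsymm := (contDiffAt_chart hf).isSymmSndFDerivAt (by simpa using! two_le_infty)
  have h3 := dFun_eq_fderiv hf.diffAt (mlieBracket (𝓡 n) V W x)
  erw [h3, mlieBracket_eq_chart]
  simp only [add_apply, ContinuousLinearMap.flip_apply,
    ContinuousLinearMap.coe_comp, Function.comp_apply, map_sub]
  have := hsymm.eq (chartRep x V (extChartAt (𝓡 n) x x)) (chartRep x W (extChartAt (𝓡 n) x x))
  linarith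

end PointwiseCalculus

/-! ### Coordinate frames -/

section Algebra

variable {n : ℕ} {M : Type*} [TopologicalSpace M] [ChartedSpace (EuclideanSpace ℝ (Fin n)) M]
  [IsManifold (𝓡 n) ∞ M]

theorem sum_component_smul (x : M) (v : TangentSpace (𝓡 n) x) :
    ∑ i, component x v i • basisVec x i = v := by
  have h := (EuclideanSpace.basisFun (Fin n) ℝ).sum_repr (v : EuclideanSpace ℝ (Fin n))
  simpa using! h

theorem component_basisVec (x : M) (i j : Fin n) :
    component x (basisVec x i) j = if j = i then 1 else 0 := by
  show (EuclideanSpace.single i (1 : ℝ) : EuclideanSpace ℝ (Fin n)) j = _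
  simp

theorem component_add (x : M) (v w : TangentSpace (𝓡 n) x) (i : Fin n) :
    component x (v + w) i = component x v i + component x w i := rfl

theorem component_smul (x : M) (c : ℝ) (v : TangentSpace (𝓡 n) x) (i : Fin n) :
    component x (c • v) i = c * component x v i := rfl

theorem component_sum (x : M) {ι : Type*} (s : Finset ι) (v : ι → TangentSpace (𝓡 n) x)
    (i : Fin n) : component x (∑ a ∈ s, v a) i = ∑ a ∈ s, component x (v a) i :=
  map_sum (EuclideanSpace.proj i : EuclideanSpace ℝ (Fin n) →L[ℝ] ℝ) v s

theorem coordField_eq_symmL {x₀ y : M}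
    (hy : y ∈ (chartAt (EuclideanSpace ℝ (Fin n)) x₀).source) (v : TangentSpace (𝓡 n) x₀) :
    coordField x₀ v y =
      (trivializationAt (EuclideanSpace ℝ (Fin n)) (TangentSpace (𝓡 n)) x₀).symmL ℝ y v :=
  (Trivialization.symmL_apply _ hy _).symm

theorem coordField_smul {x₀ y : M} (hy : y ∈ (chartAt (EuclideanSpace ℝ (Fin n)) x₀).source)
    (c : ℝ) (v : TangentSpace (𝓡 n) x₀) :
    coordField x₀ (c • v) y = c • coordField x₀ v y := by
  simp only [coordField_eq_symmL hy]
  exact map_smul ((trivializationAt (EuclideanSpace ℝ (Fin n)) (TangentSpace (𝓡 n)) x₀).symmL ℝ y) c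
    (v : EuclideanSpace ℝ (Fin n))

theorem coordField_sum {x₀ y : M} (hy : y ∈ (chartAt (EuclideanSpace ℝ (Fin n)) x₀).source)
    {ι : Type*} (s : Finset ι) (v : ι → TangentSpace (𝓡 n) x₀) :
    coordField x₀ (∑ a ∈ s, v a) y = ∑ a ∈ s, coordField x₀ (v a) y := by
  simp only [coordField_eq_symmL hy]
  exact map_sum ((trivializationAt (EuclideanSpace ℝ (Fin n)) (TangentSpace (𝓡 n)) x₀).symmL ℝ y)
    (v : ι → EuclideanSpace ℝ (Fin n)) s

/-- The components of `w ∈ T_y M` in the preferred chart at `x₀`, as an element of `T_{x₀} M`; the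
inverse of `v ↦ coordField x₀ v y` for `y` in the domain of the chart. -/
def coordRepr (x₀ y : M) (w : TangentSpace (𝓡 n) y) : TangentSpace (𝓡 n) x₀ :=
  (trivializationAt (EuclideanSpace ℝ (Fin n)) (TangentSpace (𝓡 n)) x₀).continuousLinearMapAt ℝ y w

theorem coordField_coordRepr {x₀ y : M} (hy : y ∈ (chartAt (EuclideanSpace ℝ (Fin n)) x₀).source)
    (w : TangentSpace (𝓡 n) y) : coordField x₀ (coordRepr x₀ y w) y = w := by
  rw [coordField_eq_symmL hy]
  exact (trivializationAt (EuclideanSpace ℝ (Fin n))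
    (TangentSpace (𝓡 n)) x₀).symmL_continuousLinearMapAt
    (R := ℝ) hy w

theorem coordRepr_coordField {x₀ y : M} (hy : y ∈ (chartAt (EuclideanSpace ℝ (Fin n)) x₀).source)
    (v : TangentSpace (𝓡 n) x₀) : coordRepr x₀ y (coordField x₀ v y) = v := by
  rw [coordField_eq_symmL hy]
  exact (trivializationAt (EuclideanSpace ℝ (Fin n))
    (TangentSpace (𝓡 n)) x₀).continuousLinearMapAt_symmL
    (R := ℝ) hy (v : EuclideanSpace ℝ (Fin n))

/-- At the centre of its chart a coordinate field has the prescribed value. -/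
theorem coordField_self (x : M) (v : TangentSpace (𝓡 n) x) : coordField x v x = v := by
  have h := TangentBundle.continuousLinearMapAt_trivializationAt (I := 𝓡 n)
    (mem_chart_source (EuclideanSpace ℝ (Fin n)) x)
  rw [mfderiv_extChartAt_self] at h
  have h1 : coordRepr x x v = v := by
    unfold coordRepr
    rw [h]
    rfl
  conv_rhs => rw [← coordField_coordRepr (mem_chart_source _ x) v, h1]

theorem fieldSmoothAt_coordField {x₀ y : M}
    (hy : y ∈ (chartAt (EuclideanSpace ℝ (Fin n)) x₀).source) (v : TangentSpace (𝓡 n) x₀) :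
    FieldSmoothAt (coordField x₀ v) y :=
  (contMDiffOn_coordField x₀ v).contMDiffAt
    ((chartAt (EuclideanSpace ℝ (Fin n)) x₀).open_source.mem_nhds hy)

theorem sum_coordField {x₀ y : M} (hy : y ∈ (chartAt (EuclideanSpace ℝ (Fin n)) x₀).source)
    (w : TangentSpace (𝓡 n) y) :
    ∑ i, component x₀ (coordRepr x₀ y w) i • coordField x₀ (basisVec x₀ i) y = w := by
  conv_rhs => rw [← coordField_coordRepr hy w, ← sum_component_smul x₀ (coordRepr x₀ y w),
    coordField_sum hy]
  simp only [coordField_smul hy]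

/-! ### Dual systems and contractions -/

/-- The finite systems `X`, `Y` of tangent vectors at `x` are dual with respect to the metric:
`∑ₐ g(Yₐ, v) Xₐ = v` for all `v`. -/
def IsDual (g : Metric n M) {x : M} {ι : Type*} [Fintype ι] (X Y : ι → TangentSpace (𝓡 n) x) :
    Prop :=
  ∀ v, ∑ a, g.inner x (Y a) v • X a = v

/-- Non-degeneracy of the metric. -/
theorem inner_ext (g : Metric n M) {x : M} {v w : TangentSpace (𝓡 n) x}
    (h : ∀ z, g.inner x v z = g.inner x w z) : v = w := by
  by_contra hne
  have h1 := g.pos x (v - w) (sub_ne_zero.2 hne)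
  have h2 : g.inner x (v - w) (v - w) = g.inner x v (v - w) - g.inner x w (v - w) := by
    rw [(g.inner x).map_sub, sub_apply]
  rw [h2, h (v - w), sub_self] at h1
  exact lt_irrefl _ h1

theorem IsDual.symm {g : Metric n M} {x : M} {ι : Type*} [Fintype ι]
    {X Y : ι → TangentSpace (𝓡 n) x} (h : IsDual g X Y) : IsDual g Y X := by
  intro v
  refine inner_ext g fun z => ?_
  conv_rhs => rw [← h z]
  simp only [map_sum, sum_apply, map_smul, smul_apply, smul_eq_mul]
  refine Finset.sum_congr rfl fun a _ => ?_
  rw [g.symm x v, mul_comm]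

/-- The contraction of a bilinear form with the metric does not depend on the dual system. -/
theorem IsDual.contraction {g : Metric n M} {x : M} {ι ι' : Type*} [Fintype ι] [Fintype ι']
    {X Y : ι → TangentSpace (𝓡 n) x} {X' Y' : ι' → TangentSpace (𝓡 n) x}
    (h : IsDual g X Y) (h' : IsDual g X' Y')
    (β : TangentSpace (𝓡 n) x →ₗ[ℝ] TangentSpace (𝓡 n) x →ₗ[ℝ] ℝ) :
    ∑ a, β (X a) (Y a) = ∑ b, β (X' b) (Y' b) := by
  have h1 : ∀ a, β (X a) (Y a) = ∑ b, g.inner x (Y' b) (X a) * β (X' b) (Y a) := by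
    intro a
    conv_lhs => rw [← h' (X a)]
    simp
  have h2 : ∀ b, β (X' b) (Y' b) = ∑ a, g.inner x (X a) (Y' b) * β (X' b) (Y a) := by
    intro b
    conv_lhs => rw [← h.symm (Y' b)]
    simp
  simp only [h1, h2]
  rw [Finset.sum_comm]
  refine Finset.sum_congr rfl fun b _ => Finset.sum_congr rfl fun a _ => ?_
  rw [g.symm]

theorem gram_apply (g : Metric n M) (x₀ y : M) (i j : Fin n) : gram g x₀ y i j =
    g.inner y (coordField x₀ (basisVec x₀ i) y) (coordField x₀ (basisVec x₀ j) y) := rfl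

/-- The Gram matrix of the coordinate frame is positive definite, so that its inverse and the square
root of its determinant are not junk values. -/
theorem gram_posDef (g : Metric n M) {x₀ y : M}
    (hy : y ∈ (chartAt (EuclideanSpace ℝ (Fin n)) x₀).source) : (gram g x₀ y).PosDef := by
  refine Matrix.PosDef.of_dotProduct_mulVec_pos ?_ ?_
  · ext i j
    simp only [Matrix.conjTranspose_apply, star_trivial, gram_apply]
    exact g.symm _ _ _
  · intro c hc
    set v : TangentSpace (𝓡 n) x₀ := ∑ i, c i • basisVec x₀ i with hv
    have hcomp : ∀ i, component x₀ v i = c i := by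
      intro i
      simp [hv, component_sum, component_smul, component_basisVec]
    have hw : coordField x₀ v y ≠ 0 := by
      intro h0
      apply hc
      ext i
      have h1 : v = 0 := by
        rw [← coordRepr_coordField hy v, h0]
        exact map_zero ((trivializationAt (EuclideanSpace ℝ (Fin n)) (TangentSpace (𝓡 n))
          x₀).continuousLinearMapAt ℝ y)
      rw [← hcomp i, h1]
      rfl
    have hpos := g.pos y _ hw
    rw [hv, coordField_sum hy] at hpos
    simp only [coordField_smul hy, map_sum, sum_apply, map_smul, smul_apply, smul_eq_mul] at hpos
    simp only [star_trivial, dotProduct, Matrix.mulVec, gram_apply]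
    refine hpos.trans_le (le_of_eq ?_)
    refine Finset.sum_congr rfl fun i _ => ?_
    simp only [Finset.mul_sum]
    refine Finset.sum_congr rfl fun j _ => ?_
    rw [g.symm]
    ring

theorem gram_det_pos (g : Metric n M) {x₀ y : M}
    (hy : y ∈ (chartAt (EuclideanSpace ℝ (Fin n)) x₀).source) : 0 < (gram g x₀ y).det :=
  (gram_posDef g hy).det_pos

theorem gram_symm (g : Metric n M) (x₀ y : M) (i j : Fin n) :
    gram g x₀ y i j = gram g x₀ y j i := g.symm _ _ _

theorem gram_inv_symm (g : Metric n M) (x₀ y : M) (i j : Fin n) :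
    (gram g x₀ y)⁻¹ i j = (gram g x₀ y)⁻¹ j i := by
  have h : (gram g x₀ y).transpose = gram g x₀ y := by
    ext i j
    exact gram_symm g x₀ y j i
  conv_lhs => rw [← h, ← Matrix.transpose_nonsing_inv]
  rfl

/-- The coordinate frame and its dual frame. -/
theorem isDual_coordField (g : Metric n M) {x₀ y : M}
    (hy : y ∈ (chartAt (EuclideanSpace ℝ (Fin n)) x₀).source) :
    IsDual g (fun i => coordField x₀ (basisVec x₀ i) y)
      (fun i => ∑ j, (gram g x₀ y)⁻¹ i j • coordField x₀ (basisVec x₀ j) y) := by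
  intro v
  have hdet : IsUnit (gram g x₀ y).det := (gram_det_pos g hy).ne'.isUnit
  conv_rhs => rw [← sum_coordField hy v]
  refine Finset.sum_congr rfl fun i _ => ?_
  congr 1
  conv_lhs => rw [← sum_coordField hy v]
  simp only [map_sum, sum_apply, map_smul, smul_apply, smul_eq_mul, ← gram_apply]
  set c := component x₀ (coordRepr x₀ y v)
  have h1 : ∀ k, ∑ j, (gram g x₀ y)⁻¹ i j * gram g x₀ y j k = if i = k then 1 else 0 := by
    intro k
    have := congrFun (congrFun (Matrix.nonsing_inv_mul (gram g x₀ y) hdet) i) k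
    rw [Matrix.mul_apply, Matrix.one_apply] at this
    exact this
  simp only [h1]
  simp

theorem isDual_basisVec (g : Metric n M) (x : M) :
    IsDual g (fun i => basisVec x i) (fun i => ∑ j, (gram g x x)⁻¹ i j • basisVec x j) := by
  have h := isDual_coordField g (mem_chart_source (EuclideanSpace ℝ (Fin n)) x)
  simpa only [coordField_self] using h

theorem inner_sharp (g : Metric n M) (a : Π x : M, TangentSpace (𝓡 n) x →L[ℝ] ℝ) (x : M)
    (v : TangentSpace (𝓡 n) x) : g.inner x (sharp g a x) v = a x v := by
  have h := (isDual_basisVec g x).symm v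
  conv_rhs => rw [← h]
  simp only [sharp, map_sum, sum_apply, map_smul, smul_apply, smul_eq_mul]
  refine Finset.sum_congr rfl fun i _ => ?_
  ring

theorem sharp_flat (g : Metric n M) (u : Π x : M, TangentSpace (𝓡 n) x) :
    sharp g (flat g u) = u := by
  funext x
  exact inner_ext g fun z => inner_sharp g _ x z

theorem flat_sharp (g : Metric n M) (a : Π x : M, TangentSpace (𝓡 n) x →L[ℝ] ℝ) :
    flat g (sharp g a) = a := by
  funext x
  ext z
  exact inner_sharp g _ x z

/-- The inner product of two-forms may be computed in any dual system instead of the coordinate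
frame. Bilinearity of the two-forms at the point is needed, which is why `W` and `W'` are given. -/
theorem twoFormInner_eq {g : Metric n M} {x : M} {ι : Type*} [Fintype ι]
    {X Y : ι → TangentSpace (𝓡 n) x} (h : IsDual g X Y)
    (w w' : Π x : M, TangentSpace (𝓡 n) x → TangentSpace (𝓡 n) x → ℝ)
    (W W' : TangentSpace (𝓡 n) x →ₗ[ℝ] TangentSpace (𝓡 n) x →ₗ[ℝ] ℝ)
    (hW : ∀ p q, w x p q = W p q) (hW' : ∀ p q, w' x p q = W' p q) :
    twoFormInner g w w' x = (1 / 2) * ∑ a, ∑ b, w x (X a) (X b) * w' x (Y a) (Y b) := by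
  have hb := isDual_basisVec g x
  set D : Fin n → TangentSpace (𝓡 n) x := fun i => ∑ j, (gram g x x)⁻¹ i j • basisVec x j with hD
  have h1 : twoFormInner g w w' x =
      (1 / 2) * ∑ i, ∑ j, W (basisVec x i) (basisVec x j) * W' (D i) (D j) := by
    unfold twoFormInner
    congr 1
    refine Finset.sum_congr rfl fun i _ => Finset.sum_congr rfl fun j _ => ?_
    simp only [hD, map_sum, LinearMap.sum_apply, map_smul, LinearMap.smul_apply, smul_eq_mul,
      hW, hW', Finset.mul_sum]
    rw [Finset.sum_comm]
    refine Finset.sum_congr rfl fun k _ => Finset.sum_congr rfl fun l _ => ?_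
    ring_nf
  rw [h1]
  congr 1
  have h2 : ∀ j, ∑ i, W (basisVec x i) (basisVec x j) * W' (D i) (D j) =
      ∑ a, W (X a) (basisVec x j) * W' (Y a) (D j) := by
    intro j
    exact hb.contraction h ((W.flip (basisVec x j)).smulRight (W'.flip (D j)))
  have h3 : ∀ a, ∑ j, W (X a) (basisVec x j) * W' (Y a) (D j) =
      ∑ b, W (X a) (X b) * W' (Y a) (Y b) := by
    intro a
    exact hb.contraction h ((W (X a)).smulRight (W' (Y a)))
  rw [Finset.sum_comm]
  simp only [h2]
  rw [Finset.sum_comm]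
  simp only [h3, hW, hW']

end Algebra

/-! ### One-forms and the exterior derivative -/

section Tensors

variable {n : ℕ} {M : Type*} [TopologicalSpace M] [ChartedSpace (EuclideanSpace ℝ (Fin n)) M]
  [IsManifold (𝓡 n) ∞ M]

/-- The one-form `a` is differentiable at `x`, tested on vector fields. -/
def FormDiffAt (a : Π x : M, TangentSpace (𝓡 n) x →L[ℝ] ℝ) (x : M) : Prop :=
  ∀ W : Π x : M, TangentSpace (𝓡 n) x, FieldDiffAt W x → FunDiffAt (n := n) (fun y => a y (W y)) x

theorem funDiffAt_inner (g : Metric n M) {V W : Π x : M, TangentSpace (𝓡 n) x} {x : M}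
    (hV : FieldDiffAt V x) (hW : FieldDiffAt W x) :
    FunDiffAt (n := n) (fun y => g.inner y (V y) (W y)) x := by
  let _ : RiemannianBundle (fun x : M => TangentSpace (𝓡 n) x) := ⟨g.toRiemannianMetric⟩
  exact MDifferentiableAt.inner_bundle hV hW

theorem funSmoothAt_inner (g : Metric n M) {V W : Π x : M, TangentSpace (𝓡 n) x} {x : M}
    (hV : FieldSmoothAt V x) (hW : FieldSmoothAt W x) :
    FunSmoothAt (n := n) (fun y => g.inner y (V y) (W y)) x := by
  let _ : RiemannianBundle (fun x : M => TangentSpace (𝓡 n) x) := ⟨g.toRiemannianMetric⟩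
  exact ContMDiffAt.inner_bundle hV hW

theorem formDiffAt_dFun {f : M → ℝ} {x : M} (hf : FunSmoothAt (n := n) f x) :
    FormDiffAt (fun y => dFun (n := n) f y) x := fun _ hW => funDiffAt_dFun hf hW

theorem OneForms.diffAt (m : OneForms n M) (x : M) : FormDiffAt m x := by
  intro W hW
  have h1 := (m.contMDiff x).mdifferentiableAt (by simp)
  have h2 := MDifferentiableAt.clm_bundle_apply (F₁ := EuclideanSpace ℝ (Fin n)) (F₂ := ℝ)
    (E₁ := fun x : M => TangentSpace (𝓡 n) x) (E₂ := fun _ : M => ℝ) (b := fun x : M => x)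
    (ϕ := fun x => m x) (v := W) h1 hW
  exact ((mdifferentiableAt_totalSpace _ _).1 h2).2

theorem mlieBracket_congr {V V' W W' : Π x : M, TangentSpace (𝓡 n) x} {x : M}
    (hV : V =ᶠ[𝓝 x] V') (hW : W =ᶠ[𝓝 x] W') :
    mlieBracket (𝓡 n) V W x = mlieBracket (𝓡 n) V' W' x :=
  hV.mlieBracket_vectorField_eq hW

theorem mlieBracket_fun_smul_right {f : M → ℝ} {V W : Π x : M, TangentSpace (𝓡 n) x} {x : M}
    (hf : FunDiffAt (n := n) f x) (hW : FieldDiffAt W x) :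
    mlieBracket (𝓡 n) V (f • W) x =
      dFun (n := n) f x (V x) • W x + f x • mlieBracket (𝓡 n) V W x :=
  mlieBracket_smul_right hf hW

theorem mlieBracket_fun_smul_left {f : M → ℝ} {V W : Π x : M, TangentSpace (𝓡 n) x} {x : M}
    (hf : FunDiffAt (n := n) f x) (hV : FieldDiffAt V x) :
    mlieBracket (𝓡 n) (f • V) W x =
      - dFun (n := n) f x (W x) • V x + f x • mlieBracket (𝓡 n) V W x :=
  mlieBracket_smul_left hf hV

theorem extDerivFields_swap (a : Π x : M, TangentSpace (𝓡 n) x →L[ℝ] ℝ)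
    (V W : Π x : M, TangentSpace (𝓡 n) x) (x : M) :
    extDerivFields a V W x = - extDerivFields a W V x := by
  unfold extDerivFields
  rw [mlieBracket_swap_apply (V := W)]
  simp only [map_neg]
  ring

theorem tensorialAt_extDerivFields_right {a : Π x : M, TangentSpace (𝓡 n) x →L[ℝ] ℝ} {x : M}
    (ha : FormDiffAt a x) (V : Π x : M, TangentSpace (𝓡 n) x) :
    TensorialAt (𝓡 n) (EuclideanSpace ℝ (Fin n)) (fun W => extDerivFields a V W x) x where
  smul {f W} hf hW := by
    simp only [extDerivFields]
    rw [mlieBracket_fun_smul_right hf hW]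
    have h1 : (fun y => a y ((f • W) y)) = fun y => f y * a y (W y) := by
      ext y
      simp
    rw [h1, dFun_mul hf (ha W hW)]
    simp only [add_apply, smul_apply, smul_eq_mul, map_add, map_smul, Pi.smul_apply']
    ring
  add {W W'} hW hW' := by
    simp only [extDerivFields]
    rw [mlieBracket_add_right hW hW']
    have h1 : (fun y => a y ((W + W') y)) = fun y => a y (W y) + a y (W' y) := by
      ext y
      simp
    rw [h1, dFun_add (ha W hW) (ha W' hW')]
    simp only [add_apply, map_add, Pi.add_apply]
    ring

theorem tensorialAt_extDerivFields_left {a : Π x : M, TangentSpace (𝓡 n) x →L[ℝ] ℝ} {x : M}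
    (ha : FormDiffAt a x) (W : Π x : M, TangentSpace (𝓡 n) x) :
    TensorialAt (𝓡 n) (EuclideanSpace ℝ (Fin n)) (fun V => extDerivFields a V W x) x where
  smul {f V} hf hV := by
    simp only [extDerivFields_swap a _ W]
    rw [(tensorialAt_extDerivFields_right ha W).smul hf hV]
    simp
  add {V V'} hV hV' := by
    simp only [extDerivFields_swap a _ W]
    rw [(tensorialAt_extDerivFields_right ha W).add hV hV']
    ring

theorem fieldDiffAt_coordField (x : M) (v : TangentSpace (𝓡 n) x) :
    FieldDiffAt (coordField x v) x :=
  (fieldSmoothAt_coordField (mem_chart_source _ x) v).diffAt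

/-- `(da)(V, W)` at `x` depends only on the values of `V` and `W` at `x`. -/
theorem dForm_eq {a : Π x : M, TangentSpace (𝓡 n) x →L[ℝ] ℝ} {x : M}
    (ha : FormDiffAt a x) {V W : Π x : M, TangentSpace (𝓡 n) x}
    (hV : FieldDiffAt V x) (hW : FieldDiffAt W x) :
    dForm a x (V x) (W x) = extDerivFields a V W x :=
  TensorialAt.pointwise₂ (I := 𝓡 n) (F := EuclideanSpace ℝ (Fin n))
    (F' := EuclideanSpace ℝ (Fin n)) (Φ := fun V W => extDerivFields a V W x)
    (fun τ _ => tensorialAt_extDerivFields_left ha τ)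
    (fun σ _ => tensorialAt_extDerivFields_right ha σ)
    (fieldDiffAt_coordField x _) hV (fieldDiffAt_coordField x _) hW
    (coordField_self x _) (coordField_self x _)

theorem fieldDiffAt_add {V W : Π x : M, TangentSpace (𝓡 n) x} {x : M}
    (hV : FieldDiffAt V x) (hW : FieldDiffAt W x) : FieldDiffAt (V + W) x :=
  mdifferentiableAt_add_section hV hW

theorem fieldDiffAt_smul {f : M → ℝ} {W : Π x : M, TangentSpace (𝓡 n) x} {x : M}
    (hf : FunDiffAt (n := n) f x) (hW : FieldDiffAt W x) : FieldDiffAt (f • W) x :=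
  hf.smul_section hW

/-- The exterior derivative of a one-form at a point, as a bilinear form. Bilinearity depends on the
differentiability of the form, since otherwise the derivatives involved are junk values. -/
def dBilin (a : Π x : M, TangentSpace (𝓡 n) x →L[ℝ] ℝ) (x : M) (ha : FormDiffAt a x) :
    TangentSpace (𝓡 n) x →ₗ[ℝ] TangentSpace (𝓡 n) x →ₗ[ℝ] ℝ :=
  have hadd : ∀ v v' w, dForm a x (v + v') w = dForm a x v w + dForm a x v' w := by
    intro v v' w
    have h := dForm_eq ha (fieldDiffAt_add (fieldDiffAt_coordField x v)
      (fieldDiffAt_coordField x v')) (fieldDiffAt_coordField x w)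
    rw [(tensorialAt_extDerivFields_left ha (coordField x w)).add
      (fieldDiffAt_coordField x v) (fieldDiffAt_coordField x v')] at h
    simpa only [Pi.add_apply, coordField_self] using! h
  have hsmul : ∀ (c : ℝ) v w, dForm a x (c • v) w = c • dForm a x v w := by
    intro c v w
    have hc : FunDiffAt (n := n) (fun _ : M => c) x := mdifferentiableAt_const
    have h := dForm_eq ha (fieldDiffAt_smul hc (fieldDiffAt_coordField x v))
      (fieldDiffAt_coordField x w)
    rw [(tensorialAt_extDerivFields_left ha (coordField x w)).smul
      hc (fieldDiffAt_coordField x v)] at h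
    simpa only [Pi.smul_apply', coordField_self] using! h
  have hswap : ∀ v w, dForm a x v w = - dForm a x w v := fun v w =>
    extDerivFields_swap a _ _ x
  LinearMap.mk₂ ℝ (dForm a x) hadd hsmul
    (fun v w w' => by rw [hswap, hadd, hswap w, hswap w', neg_add, neg_neg, neg_neg])
    (fun c v w => by rw [hswap, hsmul, hswap w, smul_neg, neg_neg])

theorem dBilin_apply {a : Π x : M, TangentSpace (𝓡 n) x →L[ℝ] ℝ} {x : M} (ha : FormDiffAt a x)
    (v w : TangentSpace (𝓡 n) x) : dForm a x v w = dBilin a x ha v w := rfl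

theorem dForm_add {a b : Π x : M, TangentSpace (𝓡 n) x →L[ℝ] ℝ} {x : M}
    (ha : FormDiffAt a x) (hb : FormDiffAt b x) (v w : TangentSpace (𝓡 n) x) :
    dForm (fun y => a y + b y) x v w = dForm a x v w + dForm b x v w := by
  simp only [dForm, extDerivFields, add_apply]
  rw [dFun_add (ha _ (fieldDiffAt_coordField x w)) (hb _ (fieldDiffAt_coordField x w)),
    dFun_add (ha _ (fieldDiffAt_coordField x v)) (hb _ (fieldDiffAt_coordField x v))]
  simp only [add_apply]
  ring

/-- `d² = 0` on functions. -/
theorem dForm_dFun {f : M → ℝ} {x : M} (hf : FunSmoothAt (n := n) f x)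
    (v w : TangentSpace (𝓡 n) x) : dForm (fun y => dFun (n := n) f y) x v w = 0 := by
  simp only [dForm, extDerivFields]
  rw [dFun_mlieBracket hf (fieldDiffAt_coordField x v) (fieldDiffAt_coordField x w)]
  ring

/-! ### The Lie derivative of the metric -/

/-- The Lie derivative of the metric, `(L_u g)(V, W) = u(g(V, W)) - g([u, V], W) - g(V, [u, W])`. -/
def metricLie (g : Metric n M) (u V W : Π x : M, TangentSpace (𝓡 n) x) (x : M) : ℝ :=
  dFun (n := n) (fun y => g.inner y (V y) (W y)) x (u x)
    - g.inner x (mlieBracket (𝓡 n) u V x) (W x) - g.inner x (V x) (mlieBracket (𝓡 n) u W x)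

theorem metricLie_swap (g : Metric n M) (u V W : Π x : M, TangentSpace (𝓡 n) x) (x : M) :
    metricLie g u V W x = metricLie g u W V x := by
  unfold metricLie
  have h1 : (fun y => g.inner y (V y) (W y)) = fun y => g.inner y (W y) (V y) := by
    ext y
    exact g.symm y _ _
  rw [h1, g.symm x (mlieBracket (𝓡 n) u V x), g.symm x (V x)]
  ring

theorem tensorialAt_metricLie_right (g : Metric n M) (u : Π x : M, TangentSpace (𝓡 n) x) {x : M}
    {V : Π x : M, TangentSpace (𝓡 n) x} (hV : FieldDiffAt V x) :
    TensorialAt (𝓡 n) (EuclideanSpace ℝ (Fin n)) (fun W => metricLie g u V W x) x where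
  smul {f W} hf hW := by
    simp only [metricLie]
    rw [mlieBracket_fun_smul_right hf hW]
    have h1 : (fun y => g.inner y (V y) ((f • W) y)) = fun y => f y * g.inner y (V y) (W y) := by
      ext y
      simp
    rw [h1, dFun_mul hf (funDiffAt_inner g hV hW)]
    simp only [add_apply, smul_apply, smul_eq_mul, map_add, map_smul, Pi.smul_apply']
    ring
  add {W W'} hW hW' := by
    simp only [metricLie]
    rw [mlieBracket_add_right hW hW']
    have h1 : (fun y => g.inner y (V y) ((W + W') y)) =
        fun y => g.inner y (V y) (W y) + g.inner y (V y) (W' y) := by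
      ext y
      simp
    rw [h1, dFun_add (funDiffAt_inner g hV hW) (funDiffAt_inner g hV hW')]
    simp only [add_apply, map_add, Pi.add_apply]
    ring

theorem tensorialAt_metricLie_left (g : Metric n M) (u : Π x : M, TangentSpace (𝓡 n) x) {x : M}
    {W : Π x : M, TangentSpace (𝓡 n) x} (hW : FieldDiffAt W x) :
    TensorialAt (𝓡 n) (EuclideanSpace ℝ (Fin n)) (fun V => metricLie g u V W x) x := by
  simp only [metricLie_swap g u _ W]
  exact tensorialAt_metricLie_right g u hW

theorem metricLie_eq (g : Metric n M) (u : Π x : M, TangentSpace (𝓡 n) x) {x : M}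
    {V W V' W' : Π x : M, TangentSpace (𝓡 n) x}
    (hV : FieldDiffAt V x) (hW : FieldDiffAt W x) (hV' : FieldDiffAt V' x) (hW' : FieldDiffAt W' x)
    (h : V x = V' x) (h' : W x = W' x) : metricLie g u V W x = metricLie g u V' W' x :=
  TensorialAt.pointwise₂ (I := 𝓡 n) (F := EuclideanSpace ℝ (Fin n))
    (F' := EuclideanSpace ℝ (Fin n)) (Φ := fun V W => metricLie g u V W x)
    (fun _ hτ => tensorialAt_metricLie_left g u hτ)
    (fun _ hσ => tensorialAt_metricLie_right g u hσ)
    hV hV' hW hW' h h'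

/-- The Lie derivative of the metric at a point, as a bilinear form. -/
def metricLieBilin (g : Metric n M) (u : Π x : M, TangentSpace (𝓡 n) x) (x : M) :
    TangentSpace (𝓡 n) x →ₗ[ℝ] TangentSpace (𝓡 n) x →ₗ[ℝ] ℝ :=
  let F : TangentSpace (𝓡 n) x → TangentSpace (𝓡 n) x → ℝ := fun v w =>
    metricLie g u (coordField x v) (coordField x w) x
  have hadd : ∀ v v' w, F (v + v') w = F v w + F v' w := by
    intro v v' w
    have hw := fieldDiffAt_coordField x w
    have h2 := fieldDiffAt_add (fieldDiffAt_coordField x v) (fieldDiffAt_coordField x v')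
    simp only [F]
    rw [← (tensorialAt_metricLie_left g u hw).add
      (fieldDiffAt_coordField x v) (fieldDiffAt_coordField x v')]
    exact metricLie_eq g u (fieldDiffAt_coordField x _) hw h2 hw (by simp [coordField_self]) rfl
  have hsmul : ∀ (c : ℝ) v w, F (c • v) w = c • F v w := by
    intro c v w
    have hc : FunDiffAt (n := n) (fun _ : M => c) x := mdifferentiableAt_const
    have hw := fieldDiffAt_coordField x w
    have h2 := fieldDiffAt_smul hc (fieldDiffAt_coordField x v)
    simp only [F]
    have h3 := (tensorialAt_metricLie_left g u hw).smul hc (fieldDiffAt_coordField x v)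
    rw [← h3]
    exact metricLie_eq g u (fieldDiffAt_coordField x _) hw h2 hw (by simp [coordField_self]) rfl
  have hswap : ∀ v w, F v w = F w v := fun v w => metricLie_swap g u _ _ x
  LinearMap.mk₂ ℝ F hadd hsmul
    (fun v w w' => by rw [hswap, hadd, hswap w, hswap w'])
    (fun c v w => by rw [hswap, hsmul, hswap w])

theorem metricLieBilin_apply (g : Metric n M) (u : Π x : M, TangentSpace (𝓡 n) x) {x : M}
    {V W : Π x : M, TangentSpace (𝓡 n) x} (hV : FieldDiffAt V x) (hW : FieldDiffAt W x) :
    metricLieBilin g u x (V x) (W x) = metricLie g u V W x :=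
  metricLie_eq g u (fieldDiffAt_coordField x _) (fieldDiffAt_coordField x _) hV hW
    (coordField_self x _) (coordField_self x _)

end Tensors

/-! ### The divergence as a trace -/

section Jacobi

/-- Jacobi's formula for the derivative of a determinant. -/
theorem hasFDerivAt_det {ι E : Type*} [Fintype ι] [DecidableEq ι] [NormedAddCommGroup E]
    [NormedSpace ℝ E] {A : E → Matrix ι ι ℝ} {A' : ι → ι → E →L[ℝ] ℝ} {z : E}
    (hA : ∀ i j, HasFDerivAt (fun y => A y i j) (A' i j) z) :
    HasFDerivAt (fun y => (A y).det) (∑ i, ∑ k, (A z).adjugate i k • A' k i) z := by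
  have h1 : HasFDerivAt (fun y => (A y).det)
      (∑ σ : Equiv.Perm ι, ((Equiv.Perm.sign σ : ℤ) : ℝ) •
        ∑ i, (∏ j ∈ Finset.univ.erase i, A z (σ j) j) • A' (σ i) i) z := by
    simp only [Matrix.det_apply']
    refine HasFDerivAt.fun_sum fun σ _ => ?_
    exact (HasFDerivAt.finsetProd fun i _ => hA (σ i) i).const_mul _
  convert h1 using 1
  ext v
  simp only [sum_apply, smul_apply, smul_eq_mul, Finset.mul_sum]
  rw [Finset.sum_comm (s := (Finset.univ : Finset (Equiv.Perm ι)))]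
  refine Finset.sum_congr rfl fun i _ => ?_
  have h2 : ∑ k, (A z).adjugate i k * A' k i v = (A z).cramer (fun k => A' k i v) i := by
    rw [Matrix.cramer_eq_adjugate_mulVec]
    rfl
  rw [h2, Matrix.cramer_apply, Matrix.det_apply']
  refine Finset.sum_congr rfl fun σ _ => ?_
  congr 1
  rw [← Finset.mul_prod_erase _ _ (Finset.mem_univ i), mul_comm]
  congr 1
  · refine Finset.prod_congr rfl fun j hj => ?_
    rw [Matrix.updateCol_ne (Finset.ne_of_mem_erase hj)]
  · simp

end Jacobi

section Divergence

variable {n : ℕ} {M : Type*} [TopologicalSpace M] [ChartedSpace (EuclideanSpace ℝ (Fin n)) M]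
  [IsManifold (𝓡 n) ∞ M]

theorem funSmoothAt_gram (g : Metric n M) {x₀ x : M}
    (hx : x ∈ (chartAt (EuclideanSpace ℝ (Fin n)) x₀).source) (i j : Fin n) :
    FunSmoothAt (n := n) (fun y => gram g x₀ y i j) x :=
  funSmoothAt_inner g (fieldSmoothAt_coordField hx _) (fieldSmoothAt_coordField hx _)

/-- The differential of `f` at `x`, read in the preferred chart at `x`. -/
def dFunChart (f : M → ℝ) (x : M) : EuclideanSpace ℝ (Fin n) →L[ℝ] ℝ := dFun (n := n) f x

theorem hasFDerivAt_chart {f : M → ℝ} {x : M} (hf : FunDiffAt (n := n) f x) :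
    HasFDerivAt (f ∘ (extChartAt (𝓡 n) x).symm) (dFunChart f x) (extChartAt (𝓡 n) x x) := by
  have h := hf.differentiableWithinAt_writtenInExtChartAt
  rw [ModelWithCorners.Boundaryless.range_eq_univ, differentiableWithinAt_univ] at h
  have h2 : DifferentiableAt ℝ (f ∘ (extChartAt (𝓡 n) x).symm) (extChartAt (𝓡 n) x x) := h
  have h3 := h2.hasFDerivAt
  have h4 : dFunChart f x =
      fderiv ℝ (f ∘ (extChartAt (𝓡 n) x).symm) (extChartAt (𝓡 n) x x) := by
    ext v
    exact dFun_eq_fderiv hf v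
  rw [h4]
  exact h3

theorem hasFDerivAt_chart_volDensity (g : Metric n M) {x₀ x : M}
    (hx : x ∈ (chartAt (EuclideanSpace ℝ (Fin n)) x₀).source) :
    HasFDerivAt (volDensity g x₀ ∘ (extChartAt (𝓡 n) x).symm)
      ((volDensity g x₀ x * (1 / 2)) • ∑ i, ∑ j, (gram g x₀ x)⁻¹ i j •
        dFunChart (fun y => gram g x₀ y i j) x) (extChartAt (𝓡 n) x x) := by
  have hdet := gram_det_pos g hx
  have hx' : (extChartAt (𝓡 n) x).symm (extChartAt (𝓡 n) x x) = x := extChartAt_to_inv x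
  have h1 := hasFDerivAt_det (A := fun y => gram g x₀ ((extChartAt (𝓡 n) x).symm y))
    (fun i j => hasFDerivAt_chart (funSmoothAt_gram g hx i j).diffAt)
  have h2 := h1.sqrt (by rw [hx']; exact hdet.ne')
  refine h2.congr_fderiv ?_
  rw [hx']
  have hs : √(gram g x₀ x).det ≠ 0 := (Real.sqrt_pos.2 hdet).ne'
  have hss : √(gram g x₀ x).det * √(gram g x₀ x).det = (gram g x₀ x).det :=
    Real.mul_self_sqrt hdet.le
  have hsym : ∀ k i : Fin n, (fun y => gram g x₀ y k i) = fun y => gram g x₀ y i k := by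
    intro k i
    ext y
    exact gram_symm g x₀ y k i
  have hfin : ∀ S : ℝ, 1 / (2 * √(gram g x₀ x).det) * S =
      √(gram g x₀ x).det * (1 / 2) * ((gram g x₀ x).det⁻¹ * S) := by
    intro S
    have h3 : (gram g x₀ x).det⁻¹ = (√(gram g x₀ x).det)⁻¹ * (√(gram g x₀ x).det)⁻¹ := by
      rw [← mul_inv, hss]
    rw [h3]
    field_simp
  simp only [Finset.smul_sum, smul_smul, Matrix.inv_def, Matrix.smul_apply, volDensity,
    Ring.inverse_eq_inv', smul_eq_mul]
  refine Finset.sum_congr rfl fun i _ => Finset.sum_congr rfl fun k _ => ?_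
  rw [hsym k i, hfin]

theorem funDiffAt_volDensity (g : Metric n M) {x₀ x : M}
    (hx : x ∈ (chartAt (EuclideanSpace ℝ (Fin n)) x₀).source) :
    FunDiffAt (n := n) (volDensity g x₀) x :=
  funDiffAt_of_chart (hasFDerivAt_chart_volDensity g hx).differentiableAt

/-- The derivative of `√det(g_{ij})` is `½ √det(g_{ij}) g^{ij} dg_{ij}`. -/
theorem dFun_volDensity (g : Metric n M) {x₀ x : M}
    (hx : x ∈ (chartAt (EuclideanSpace ℝ (Fin n)) x₀).source) (v : TangentSpace (𝓡 n) x) :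
    dFun (n := n) (volDensity g x₀) x v = volDensity g x₀ x * ((1 / 2) *
        ∑ i, ∑ j, (gram g x₀ x)⁻¹ i j * dFun (n := n) (fun y => gram g x₀ y i j) x v) := by
  have h := dFun_eq_fderiv (funDiffAt_volDensity g hx) v
  rw [(hasFDerivAt_chart_volDensity g hx).fderiv] at h
  refine h.trans ?_
  have h2 : ∀ (A : Fin n → Fin n → ℝ) (L : Fin n → Fin n → EuclideanSpace ℝ (Fin n) →L[ℝ] ℝ)
      (c : ℝ) (w : EuclideanSpace ℝ (Fin n)), (c • ∑ i, ∑ j, A i j • L i j) w =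
        c * ∑ i, ∑ j, A i j * L i j w := by
    intro A L c w
    simp only [smul_apply, sum_apply, smul_eq_mul]
  rw [← mul_assoc]
  exact h2 _ _ _ _

theorem volDensity_pos (g : Metric n M) {x₀ x : M}
    (hx : x ∈ (chartAt (EuclideanSpace ℝ (Fin n)) x₀).source) : 0 < volDensity g x₀ x :=
  Real.sqrt_pos.2 (gram_det_pos g hx)

/-- Components in the coordinate frame are inner products with the dual frame. -/
theorem component_eq_inner (g : Metric n M) {x₀ x : M}
    (hx : x ∈ (chartAt (EuclideanSpace ℝ (Fin n)) x₀).source) (v : TangentSpace (𝓡 n) x)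
    (i : Fin n) : component x₀ (coordRepr x₀ x v) i =
      g.inner x (∑ j, (gram g x₀ x)⁻¹ i j • coordField x₀ (basisVec x₀ j) x) v := by
  have h := isDual_coordField g hx v
  have h2 : v = coordField x₀ (∑ i, g.inner x (∑ j, (gram g x₀ x)⁻¹ i j •
      coordField x₀ (basisVec x₀ j) x) v • basisVec x₀ i) x := by
    conv_lhs => rw [← h]
    rw [coordField_sum hx]
    simp only [coordField_smul hx]
  conv_lhs => rw [h2, coordRepr_coordField hx]
  simp [component_sum, component_smul, component_basisVec]

/-- Half the trace of `L_u g`, in the coordinate frame of the preferred chart at `x₀`. -/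
theorem half_trace_metricLie (g : Metric n M) (u : Π x : M, TangentSpace (𝓡 n) x) {x₀ x : M}
    (hx : x ∈ (chartAt (EuclideanSpace ℝ (Fin n)) x₀).source) :
    (1 / 2) * ∑ i, metricLieBilin g u x (coordField x₀ (basisVec x₀ i) x)
        (∑ j, (gram g x₀ x)⁻¹ i j • coordField x₀ (basisVec x₀ j) x) =
      dFun (n := n) (volDensity g x₀) x (u x) / volDensity g x₀ x
        - ∑ i, component x₀ (coordRepr x₀ x
            (mlieBracket (𝓡 n) u (coordField x₀ (basisVec x₀ i)) x)) i := by
  have hE : ∀ i, FieldDiffAt (coordField x₀ (basisVec x₀ i)) x := fun i =>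
    (fieldSmoothAt_coordField hx _).diffAt
  rw [dFun_volDensity g hx, mul_div_cancel_left₀ _ (volDensity_pos g hx).ne']
  simp only [component_eq_inner g hx, map_sum, map_smul, sum_apply, smul_apply, smul_eq_mul,
    metricLieBilin_apply g u (hE _) (hE _), metricLie]
  simp only [mul_sub, Finset.sum_sub_distrib]
  have h1 : ∑ i, ∑ j, (gram g x₀ x)⁻¹ i j * g.inner x (coordField x₀ (basisVec x₀ i) x)
      (mlieBracket (𝓡 n) u (coordField x₀ (basisVec x₀ j)) x) =
      ∑ i, ∑ j, (gram g x₀ x)⁻¹ i j * g.inner x (coordField x₀ (basisVec x₀ j) x)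
      (mlieBracket (𝓡 n) u (coordField x₀ (basisVec x₀ i)) x) := by
    rw [Finset.sum_comm]
    refine Finset.sum_congr rfl fun i _ => Finset.sum_congr rfl fun j _ => ?_
    rw [gram_inv_symm]
  have h2 : ∑ i, ∑ j, (gram g x₀ x)⁻¹ i j * g.inner x
      (mlieBracket (𝓡 n) u (coordField x₀ (basisVec x₀ i)) x) (coordField x₀ (basisVec x₀ j) x) =
      ∑ i, ∑ j, (gram g x₀ x)⁻¹ i j * g.inner x (coordField x₀ (basisVec x₀ j) x)
      (mlieBracket (𝓡 n) u (coordField x₀ (basisVec x₀ i)) x) := by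
    refine Finset.sum_congr rfl fun i _ => Finset.sum_congr rfl fun j _ => ?_
    rw [g.symm]
  rw [h1, h2]
  simp only [gram_apply]
  ring

theorem coordRepr_self (x : M) (v : TangentSpace (𝓡 n) x) : coordRepr x x v = v := by
  have h := coordRepr_coordField (mem_chart_source (EuclideanSpace ℝ (Fin n)) x) v
  rwa [coordField_self] at h

/-- The divergence is half the trace of the Lie derivative of the metric. The right side is computed
in an arbitrary dual system, so that the divergence does not depend on the chart. -/
theorem divergence_eq_trace (g : Metric n M) (u : Π x : M, TangentSpace (𝓡 n) x) {x : M}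
    {ι : Type*} [Fintype ι] {X Y : ι → TangentSpace (𝓡 n) x} (h : IsDual g X Y) :
    divergence g u x = (1 / 2) * ∑ a, metricLieBilin g u x (X a) (Y a) := by
  have h1 := half_trace_metricLie g u (mem_chart_source (EuclideanSpace ℝ (Fin n)) x)
  simp only [coordRepr_self] at h1
  unfold divergence
  rw [← h1, (isDual_coordField g (mem_chart_source _ x)).contraction h]

/-- The divergence, computed in any of the preferred charts. -/
theorem divergence_eq_chart (g : Metric n M) (u : Π x : M, TangentSpace (𝓡 n) x) {x₀ x : M}
    (hx : x ∈ (chartAt (EuclideanSpace ℝ (Fin n)) x₀).source) :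
    divergence g u x = dFun (n := n) (volDensity g x₀) x (u x) / volDensity g x₀ x
        - ∑ i, component x₀ (coordRepr x₀ x
            (mlieBracket (𝓡 n) u (coordField x₀ (basisVec x₀ i)) x)) i := by
  rw [← half_trace_metricLie g u hx, divergence_eq_trace g u (isDual_coordField g hx)]

theorem divergence_smul (g : Metric n M) {f : M → ℝ} {u : Π x : M, TangentSpace (𝓡 n) x} {x : M}
    (hf : FunDiffAt (n := n) f x) (hu : FieldDiffAt u x) :
    divergence g (f • u) x = dFun (n := n) f x (u x) + f x * divergence g u x := by
  unfold divergence
  have h1 : ∀ i, component x (mlieBracket (𝓡 n) (f • u) (coordField x (basisVec x i)) x) i =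
      - (dFun (n := n) f x (basisVec x i) * component x (u x) i) +
        f x * component x (mlieBracket (𝓡 n) u (coordField x (basisVec x i)) x) i := by
    intro i
    rw [mlieBracket_fun_smul_left hf hu, component_add, component_smul, component_smul,
      coordField_self, neg_mul]
  have h2 : dFun (n := n) f x (u x) =
      ∑ i, dFun (n := n) f x (basisVec x i) * component x (u x) i := by
    conv_lhs => rw [← sum_component_smul x (u x)]
    simp only [map_sum, map_smul, smul_eq_mul]
    exact Finset.sum_congr rfl fun i _ => mul_comm _ _
  simp only [h1, Finset.sum_add_distrib, Finset.sum_neg_distrib, ← h2, ← Finset.mul_sum,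
    Pi.smul_apply', map_smul, smul_eq_mul]
  ring

theorem divergence_add (g : Metric n M) {u v : Π x : M, TangentSpace (𝓡 n) x} {x : M}
    (hu : FieldDiffAt u x) (hv : FieldDiffAt v x) :
    divergence g (u + v) x = divergence g u x + divergence g v x := by
  unfold divergence
  simp only [mlieBracket_add_left hu hv, component_add, Finset.sum_add_distrib, Pi.add_apply,
    map_add]
  ring

theorem divergence_congr (g : Metric n M) {u v : Π x : M, TangentSpace (𝓡 n) x} {x : M}
    (huv : u =ᶠ[𝓝 x] v) : divergence g u x = divergence g v x := by
  unfold divergence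
  have h : ∀ i, mlieBracket (𝓡 n) u (coordField x (basisVec x i)) x =
      mlieBracket (𝓡 n) v (coordField x (basisVec x i)) x := fun i =>
    mlieBracket_congr huv EventuallyEq.rfl
  simp only [h, huv.self_of_nhds]

theorem fieldDiffAt_sum {ι : Type*} {s : Finset ι} {u : ι → Π x : M, TangentSpace (𝓡 n) x} {x : M}
    (hu : ∀ i ∈ s, FieldDiffAt (u i) x) : FieldDiffAt (∑ i ∈ s, u i) x := by
  have h := MDifferentiableAt.sum_section hu
  have h2 : (∑ i ∈ s, u i) = fun x => ∑ i ∈ s, u i x := by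
    ext1 x
    simp
  rw [h2]
  exact h

theorem divergence_zero (g : Metric n M) (x : M) :
    divergence g (0 : Π x : M, TangentSpace (𝓡 n) x) x = 0 := by
  have h0 : FieldDiffAt (0 : Π x : M, TangentSpace (𝓡 n) x) x := by
    simpa using fieldDiffAt_sum (s := (∅ : Finset ℕ))
      (u := fun _ => (0 : Π x : M, TangentSpace (𝓡 n) x)) (x := x) (by simp)
  have h := divergence_add g h0 h0
  rw [add_zero] at h
  linarith

theorem divergence_sum (g : Metric n M) {ι : Type*} {s : Finset ι}
    {u : ι → Π x : M, TangentSpace (𝓡 n) x} {x : M} (hu : ∀ i ∈ s, FieldDiffAt (u i) x) :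
    divergence g (∑ i ∈ s, u i) x = ∑ i ∈ s, divergence g (u i) x := by
  classical
  induction s using Finset.induction_on with
  | empty => simpa using divergence_zero g x
  | insert a s ha ih =>
    simp only [Finset.sum_insert ha]
    rw [divergence_add g (hu a (Finset.mem_insert_self a s)) (fieldDiffAt_sum fun i hi => hu i
      (Finset.mem_insert_of_mem hi)), ih fun i hi => hu i (Finset.mem_insert_of_mem hi)]

/-- `(L_u a)(V)` at a point is linear over functions in `V`. -/
theorem tensorialAt_lieForm (u : Π x : M, TangentSpace (𝓡 n) x)
    {m : Π x : M, TangentSpace (𝓡 n) x →L[ℝ] ℝ} {x : M} (hm : FormDiffAt m x) :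
    TensorialAt (𝓡 n) (EuclideanSpace ℝ (Fin n)) (fun V => lieForm u m V x) x where
  smul {f W} hf hW := by
    simp only [lieForm]
    rw [mlieBracket_fun_smul_right hf hW]
    have h1 : (fun y => m y ((f • W) y)) = fun y => f y * m y (W y) := by
      ext y
      simp
    rw [h1, dFun_mul hf (hm W hW)]
    simp only [add_apply, smul_apply, smul_eq_mul, map_add, map_smul]
    ring
  add {W W'} hW hW' := by
    simp only [lieForm]
    rw [mlieBracket_add_right hW hW']
    have h1 : (fun y => m y ((W + W') y)) = fun y => m y (W y) + m y (W' y) := by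
      ext y
      simp
    rw [h1, dFun_add (hm W hW) (hm W' hW')]
    simp only [add_apply, map_add]
    ring

end Divergence

/-! ### Global frames and smoothness -/

section Frame

variable {n : ℕ} {M : Type*} [TopologicalSpace M] [ChartedSpace (EuclideanSpace ℝ (Fin n)) M]
  [IsManifold (𝓡 n) ∞ M]

theorem funSmoothAt_det {ι : Type*} [Fintype ι] [DecidableEq ι] {A : M → Matrix ι ι ℝ} {x : M}
    (hA : ∀ i j, FunSmoothAt (n := n) (fun y => A y i j) x) :
    FunSmoothAt (n := n) (fun y => (A y).det) x := by
  simp only [Matrix.det_apply']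
  refine ContMDiffAt.sum fun σ _ => ?_
  exact contMDiffAt_const.mul (contMDiffAt_finsetProd fun i _ => hA _ _)

theorem funSmoothAt_inv {ι : Type*} [Fintype ι] [DecidableEq ι] {A : M → Matrix ι ι ℝ} {x : M}
    (hA : ∀ i j, FunSmoothAt (n := n) (fun y => A y i j) x) (hx : (A x).det ≠ 0) (i j : ι) :
    FunSmoothAt (n := n) (fun y => (A y)⁻¹ i j) x := by
  simp only [Matrix.inv_def, Matrix.smul_apply, Ring.inverse_eq_inv', smul_eq_mul,
    Matrix.adjugate_apply]
  refine ((funSmoothAt_det hA).inv₀ hx).mul (funSmoothAt_det fun k l => ?_)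
  by_cases hk : k = j
  · subst hk
    simpa using contMDiffAt_const
  · simpa [Matrix.updateRow_ne hk] using hA k l

/-- The `i`-th field of the frame dual to the coordinate frame of the preferred chart at `x₀`. -/
def dualCoordField (g : Metric n M) (x₀ : M) (i : Fin n) (y : M) : TangentSpace (𝓡 n) y :=
  ∑ j, (gram g x₀ y)⁻¹ i j • coordField x₀ (basisVec x₀ j) y

theorem fieldSmoothAt_dualCoordField (g : Metric n M) {x₀ x : M}
    (hx : x ∈ (chartAt (EuclideanSpace ℝ (Fin n)) x₀).source) (i : Fin n) :
    FieldSmoothAt (dualCoordField g x₀ i) x := by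
  refine ContMDiffAt.sum_section fun j _ => ?_
  exact (funSmoothAt_inv (fun i j => funSmoothAt_gram g hx i j) (gram_det_pos g hx).ne' i
    j).smul_section (fieldSmoothAt_coordField hx _)

variable [CompactSpace M] [T2Space M]

variable (n M) in
/-- The finitely many indices whose partition function is not zero. -/
def partitionIndex : Finset M :=
  (partition n M).locallyFinite.finite_nonempty_of_compact.toFinset

theorem partition_eq_zero {c : M} (hc : c ∉ partitionIndex n M) (x : M) :
    partition n M c x = 0 := by
  by_contra h
  exact hc ((partition n M).locallyFinite.finite_nonempty_of_compact.mem_toFinset.2 ⟨x, h⟩)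

theorem sum_partition (x : M) : ∑ c ∈ partitionIndex n M, partition n M c x = 1 := by
  rw [← (partition n M).sum_eq_one (mem_univ x)]
  refine (finsum_eq_sum_of_support_subset _ ?_).symm
  intro c hc
  by_contra h
  exact hc (partition_eq_zero h x)

theorem mem_source_of_partition_ne_zero {c x : M} (h : partition n M c x ≠ 0) :
    x ∈ (chartAt (EuclideanSpace ℝ (Fin n)) c).source :=
  partition_isSubordinate n M c (subset_tsupport _ h)

variable (n) in
/-- The sum of the squares of the partition functions. Dividing by it compensates for the cut-off of
both the coordinate frame and its dual frame. -/
def partitionSq (x : M) : ℝ := ∑ c ∈ partitionIndex n M, partition n M c x ^ 2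

theorem partitionSq_pos (x : M) : 0 < partitionSq n x := by
  have h : ∃ c ∈ partitionIndex n M, partition n M c x ≠ 0 := by
    by_contra! h
    have h1 := sum_partition (n := n) x
    rw [Finset.sum_eq_zero h] at h1
    exact zero_ne_one h1
  obtain ⟨c, hc, hcx⟩ := h
  exact Finset.sum_pos' (fun c _ => sq_nonneg _) ⟨c, hc, by positivity⟩

theorem contMDiff_partitionSq : ContMDiff (𝓡 n) 𝓘(ℝ, ℝ) ∞ (partitionSq n (M := M)) := by
  refine ContMDiff.sum fun c _ => ?_
  exact (partition n M c).contMDiff.pow 2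

/-- A finite family of global smooth fields with a dual family: `∑ₐ g(Yₐ, v) Xₐ = v`. -/
structure GlobalFrame.{u} {n : ℕ} {M : Type u} [TopologicalSpace M]
    [ChartedSpace (EuclideanSpace ℝ (Fin n)) M] [IsManifold (𝓡 n) ∞ M] (g : Metric n M) where
  /-- The index set. -/
  ι : Type u
  /-- The index set is finite. -/
  fin : Fintype ι
  /-- The spanning fields. -/
  X : ι → VectorFields n M
  /-- The dual fields. -/
  Y : ι → VectorFields n M
  dual : ∀ x, IsDual g (fun a => X a x) (fun a => Y a x)

attribute [instance] GlobalFrame.fin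

/-- The coordinate field `∂ᵢ` of the chart at `c`, cut off by the partition of unity. -/
def cutoffField (c : M) (i : Fin n) : VectorFields n M :=
  ⟨(partition n M c : M → ℝ) • coordField c (basisVec c i),
    ContMDiffOn.smul_section_of_tsupport (partition n M c).contMDiff.contMDiffOn
      (chartAt (EuclideanSpace ℝ (Fin n)) c).open_source (partition_isSubordinate n M c)
      (contMDiffOn_coordField c _)⟩

theorem cutoffField_apply (c : M) (i : Fin n) (x : M) :
    cutoffField c i x = partition n M c x • coordField c (basisVec c i) x := rfl

theorem contMDiff_partition_div (c : M) :
    ContMDiff (𝓡 n) 𝓘(ℝ, ℝ) ∞ (fun x => partition n M c x / partitionSq n x) :=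
  (partition n M c).contMDiff.div₀ contMDiff_partitionSq fun x => (partitionSq_pos x).ne'

/-- The cut-off functions of the dual frame are supported in the domains of the charts. -/
theorem tsupport_partition_div (c : M) :
    tsupport (fun x => partition n M c x / partitionSq n x) ⊆
      (chartAt (EuclideanSpace ℝ (Fin n)) c).source := by
  refine (closure_mono fun x hx => ?_).trans (partition_isSubordinate n M c)
  intro h0
  exact hx (by simp [h0])

/-- The dual coordinate field of the chart at `c`, cut off by the normalized partition of unity. -/
def cutoffDualField (g : Metric n M) (c : M) (i : Fin n) : VectorFields n M :=
  ⟨(fun x => partition n M c x / partitionSq n x) • dualCoordField g c i,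
    ContMDiffOn.smul_section_of_tsupport (contMDiff_partition_div c).contMDiffOn
      (chartAt (EuclideanSpace ℝ (Fin n)) c).open_source (tsupport_partition_div c)
      (fun _ hx => (fieldSmoothAt_dualCoordField g hx i).contMDiffWithinAt)⟩

theorem cutoffDualField_apply (g : Metric n M) (c : M) (i : Fin n) (x : M) :
    cutoffDualField g c i x = (partition n M c x / partitionSq n x) • dualCoordField g c i x := rfl

theorem sum_cutoffField (g : Metric n M) (c x : M) (v : TangentSpace (𝓡 n) x) :
    ∑ i, g.inner x (cutoffDualField g c i x) v • cutoffField c i x =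
      (partition n M c x ^ 2 / partitionSq n x) • v := by
  simp only [cutoffField_apply, cutoffDualField_apply]
  by_cases hc : partition n M c x = 0
  · simp [hc]
  · have h2 := isDual_coordField g (mem_source_of_partition_ne_zero hc) v
    conv_rhs => rw [← h2]
    rw [Finset.smul_sum]
    refine Finset.sum_congr rfl fun i _ => ?_
    rw [map_smul, smul_apply, smul_smul, smul_smul, smul_eq_mul]
    congr 1
    unfold dualCoordField
    ring

theorem sum_partition_sq (x : M) {V : Type*} [AddCommGroup V] [Module ℝ V] (v : V) :
    ∑ c ∈ partitionIndex n M, (partition n M c x ^ 2 / partitionSq n x) • v = v := by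
  rw [← Finset.sum_smul, ← Finset.sum_div]
  have : (∑ c ∈ partitionIndex n M, partition n M c x ^ 2) = partitionSq n x := rfl
  rw [this, div_self (partitionSq_pos x).ne', one_smul]

theorem isDual_cutoffField (g : Metric n M) (x : M) :
    IsDual g (fun a : partitionIndex n M × Fin n => cutoffField a.1.1 a.2 x)
      (fun a => cutoffDualField g a.1.1 a.2 x) := by
  intro v
  rw [Fintype.sum_prod_type]
  have h1 : ∀ c : partitionIndex n M, ∑ i, g.inner x (cutoffDualField g c.1 i x) v •
      cutoffField c.1 i x = (partition n M c.1 x ^ 2 / partitionSq n x) • v :=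
    fun c => sum_cutoffField g c.1 x v
  refine (Finset.sum_congr rfl fun c _ => h1 c).trans ?_
  rw [Finset.univ_eq_attach]
  exact (Finset.sum_attach (partitionIndex n M)
    (fun c => (partition n M c x ^ 2 / partitionSq n x) • v)).trans (sum_partition_sq x v)

/-- A global dual frame of `M`: the cut-off coordinate frames of finitely many charts. -/
def frame (g : Metric n M) : GlobalFrame g where
  ι := partitionIndex n M × Fin n
  fin := inferInstance
  X a := cutoffField a.1.1 a.2
  Y a := cutoffDualField g a.1.1 a.2
  dual := isDual_cutoffField g

end Frame

section Smoothness

variable {n : ℕ} {M : Type*} [TopologicalSpace M] [ChartedSpace (EuclideanSpace ℝ (Fin n)) M]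
  [IsManifold (𝓡 n) ∞ M]

theorem VectorFields.smoothAt (u : VectorFields n M) (x : M) : FieldSmoothAt u x := u.contMDiff x

theorem VectorFields.diffAt (u : VectorFields n M) (x : M) : FieldDiffAt u x :=
  (u.smoothAt x).diffAt

/-- Real functions that are smooth on `M`. -/
abbrev SmoothFun (f : M → ℝ) : Prop := ContMDiff (𝓡 n) 𝓘(ℝ, ℝ) ∞ f

/-- A smooth function times a smooth field. -/
def funSmul (f : M → ℝ) (hf : SmoothFun (n := n) f) (u : VectorFields n M) : VectorFields n M :=
  ⟨f • (u : Π x : M, TangentSpace (𝓡 n) x), fun x => (hf x).smul_section (u.smoothAt x)⟩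

theorem funSmul_apply (f : M → ℝ) (hf : SmoothFun (n := n) f) (u : VectorFields n M) (x : M) :
    funSmul f hf u x = f x • u x := rfl

/-- The Lie bracket of smooth fields. -/
def bracket (u v : VectorFields n M) : VectorFields n M :=
  ⟨mlieBracket (𝓡 n) u v, fun x => by
    have : IsManifold (𝓡 n) (minSmoothness ℝ 2) M := by
      rw [minSmoothness_of_isRCLikeNormedField]
      infer_instance
    have : IsManifold (𝓡 n) ((∞ : ℕ∞ω) + 1) M := inferInstanceAs (IsManifold (𝓡 n) ∞ M)
    exact ContMDiffAt.mlieBracket_vectorField (m := ⊤) (n := ⊤) (u.contMDiff x) (v.contMDiff x)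
      (by rw [minSmoothness_of_isRCLikeNormedField]; exact le_rfl)⟩

theorem bracket_apply (u v : VectorFields n M) (x : M) :
    bracket u v x = mlieBracket (𝓡 n) u v x := rfl

theorem smoothFun_inner (g : Metric n M) (u v : VectorFields n M) :
    SmoothFun (n := n) (fun x => g.inner x (u x) (v x)) := fun x =>
  funSmoothAt_inner g (u.smoothAt x) (v.smoothAt x)

theorem smoothFun_form (m : OneForms n M) (u : VectorFields n M) :
    SmoothFun (n := n) (fun x => m x (u x)) := by
  intro x
  have h2 := ContMDiffAt.clm_bundle_apply (F₁ := EuclideanSpace ℝ (Fin n)) (F₂ := ℝ)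
    (E₁ := fun x : M => TangentSpace (𝓡 n) x) (E₂ := fun _ : M => ℝ) (b := fun x : M => x)
    (ϕ := fun x => m x) (v := u) (m.contMDiff x) (u.contMDiff x)
  exact (contMDiffAt_totalSpace.1 h2).2

theorem smoothFun_dFun {f : M → ℝ} (hf : SmoothFun (n := n) f) (u : VectorFields n M) :
    SmoothFun (n := n) (fun x => dFun (n := n) f x (u x)) := by
  have h1 : ContMDiff (𝓡 n).tangent 𝓘(ℝ, ℝ).tangent ∞ (tangentMap (𝓡 n) 𝓘(ℝ, ℝ) f) :=
    hf.contMDiff_tangentMap (by simp)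
  exact (contMDiff_snd_tangentBundle_modelSpace ℝ 𝓘(ℝ, ℝ)).comp (h1.comp u.contMDiff)

/-- The one-form `u♭`. -/
def flatForm (g : Metric n M) (u : VectorFields n M) : OneForms n M :=
  ⟨flat g u, by
    intro x
    exact ContMDiffAt.clm_bundle_apply (F₁ := EuclideanSpace ℝ (Fin n))
      (F₂ := EuclideanSpace ℝ (Fin n) →L[ℝ] ℝ)
      (E₁ := fun x : M => TangentSpace (𝓡 n) x)
      (E₂ := fun x : M => TangentSpace (𝓡 n) x →L[ℝ] ℝ) (b := fun x : M => x)
      (ϕ := fun x => g.inner x) (v := u) (g.contMDiff x) (u.contMDiff x)⟩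

variable [CompactSpace M] [T2Space M]

theorem frame_sum_inner {g : Metric n M} (F : GlobalFrame g) {x : M} (v : TangentSpace (𝓡 n) x) :
    ∑ a, g.inner x (F.Y a x) v • F.X a x = v := F.dual x v

/-- A field is smooth if its inner products with smooth fields are smooth. -/
theorem contMDiff_of_inner (g : Metric n M) {u : Π x : M, TangentSpace (𝓡 n) x}
    (h : ∀ v : VectorFields n M, SmoothFun (n := n) (fun x => g.inner x (v x) (u x))) :
    ContMDiff (𝓡 n) (𝓡 n).tangent ∞ (fun x => (⟨x, u x⟩ : TangentBundle (𝓡 n) M)) := by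
  let F := frame g
  have h1 : u = fun x => ∑ a, g.inner x (F.Y a x) (u x) • F.X a x := by
    ext1 x
    exact (F.dual x (u x)).symm
  rw [h1]
  exact ContMDiff.sum_section fun a _ => (h (F.Y a)).smul_section (F.X a).contMDiff

/-- The vector field `a♯`. -/
def sharpField (g : Metric n M) (a : OneForms n M) : VectorFields n M :=
  ⟨sharp g a, contMDiff_of_inner g fun v => by
    have h : (fun x => g.inner x (v x) (sharp g a x)) = fun x => a x (v x) := by
      ext x
      rw [g.symm, inner_sharp]
    rw [h]
    exact smoothFun_form a v⟩

theorem sharpField_apply (g : Metric n M) (a : OneForms n M) (x : M) :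
    sharpField g a x = sharp g a x := rfl

/-- The gradient of a smooth function. -/
def gradField (g : Metric n M) (f : M → ℝ) (hf : SmoothFun (n := n) f) : VectorFields n M :=
  ⟨sharp g (dFun f), contMDiff_of_inner g fun v => by
    have h : (fun x => g.inner x (v x) (sharp g (dFun f) x)) =
        fun x => dFun (n := n) f x (v x) := by
      ext x
      rw [g.symm, inner_sharp]
    rw [h]
    exact smoothFun_dFun hf v⟩

theorem gradField_apply (g : Metric n M) (f : M → ℝ) (hf : SmoothFun (n := n) f) (x : M) :
    gradField g f hf x = sharp g (dFun f) x := rfl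

/-- The differential of a smooth function as a smooth one-form. -/
def dForms (g : Metric n M) (f : M → ℝ) (hf : SmoothFun (n := n) f) : OneForms n M :=
  flatForm g (gradField g f hf)

theorem dForms_apply (g : Metric n M) (f : M → ℝ) (hf : SmoothFun (n := n) f) (x : M) :
    dForms g f hf x = dFun f x := congrFun (flat_sharp g (dFun f)) x

/-- The divergence of a smooth field is smooth: the trace of `L_u g` may be computed in a
global frame, whereas the definition uses a different chart at each point. -/
theorem smoothFun_divergence (g : Metric n M) (u : VectorFields n M) :
    SmoothFun (n := n) (divergence g u) := by
  let F := frame g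
  have h1 : divergence g u = fun x => (1 / 2) * ∑ a,
      (dFun (n := n) (fun y => g.inner y (F.X a y) (F.Y a y)) x (u x)
        - g.inner x (bracket u (F.X a) x) (F.Y a x)
        - g.inner x (F.X a x) (bracket u (F.Y a) x)) := by
    ext x
    rw [divergence_eq_trace g u (F.dual x)]
    congr 1
    refine Finset.sum_congr rfl fun a _ => ?_
    exact metricLieBilin_apply g u ((F.X a).diffAt x) ((F.Y a).diffAt x)
  rw [h1]
  refine contMDiff_const.mul (ContMDiff.sum fun a _ => ?_)
  exact ((smoothFun_dFun (smoothFun_inner g _ _) u).sub (smoothFun_inner g _ _)).sub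
    (smoothFun_inner g _ _)

theorem codiffOne_flat (g : Metric n M) (u : Π x : M, TangentSpace (𝓡 n) x) (x : M) :
    codiffOne g (flat g u) x = - divergence g u x := by
  unfold codiffOne
  rw [sharp_flat]

theorem smoothFun_codiff (g : Metric n M) (u : VectorFields n M) :
    SmoothFun (n := n) (codiffOne g (flat g u)) := by
  have h : codiffOne g (flat g u) = fun x => - divergence g u x := funext (codiffOne_flat g u)
  rw [h]
  exact (smoothFun_divergence g u).neg

theorem smoothFun_dForm (a : OneForms n M) (u v : VectorFields n M) :
    SmoothFun (n := n) (fun x => dForm a x (u x) (v x)) := by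
  have h : (fun x => dForm a x (u x) (v x)) = fun x =>
      dFun (n := n) (fun y => a y (v y)) x (u x) - dFun (n := n) (fun y => a y (u y)) x (v x)
        - a x (bracket u v x) := by
    ext x
    exact dForm_eq (a.diffAt x) (u.diffAt x) (v.diffAt x)
  rw [h]
  exact ((smoothFun_dFun (smoothFun_form a v) u).sub (smoothFun_dFun (smoothFun_form a u) v)).sub
    (smoothFun_form a _)

theorem twoFormInner_frame {g : Metric n M} (F : GlobalFrame g)
    (a b : Π x : M, TangentSpace (𝓡 n) x →L[ℝ] ℝ) {x : M} (ha : FormDiffAt a x)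
    (hb : FormDiffAt b x) : twoFormInner g (dForm a) (dForm b) x =
      (1 / 2) * ∑ i, ∑ j, dForm a x (F.X i x) (F.X j x) * dForm b x (F.Y i x) (F.Y j x) :=
  twoFormInner_eq (F.dual x) _ _ (dBilin a x ha) (dBilin b x hb) (fun _ _ => rfl) fun _ _ => rfl

theorem smoothFun_twoFormInner (g : Metric n M) (a b : OneForms n M) :
    SmoothFun (n := n) (twoFormInner g (dForm a) (dForm b)) := by
  let F := frame g
  have h : twoFormInner g (dForm a) (dForm b) = fun x => (1 / 2) * ∑ i, ∑ j,
      dForm a x (F.X i x) (F.X j x) * dForm b x (F.Y i x) (F.Y j x) :=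
    funext fun x => twoFormInner_frame F a b (a.diffAt x) (b.diffAt x)
  rw [h]
  refine contMDiff_const.mul (ContMDiff.sum fun i _ => ContMDiff.sum fun j _ => ?_)
  exact (smoothFun_dForm a _ _).mul (smoothFun_dForm b _ _)

end Smoothness

/-! ### The Riemannian volume in charts -/

section ChartChange

variable {n : ℕ} {M : Type*} [TopologicalSpace M] [ChartedSpace (EuclideanSpace ℝ (Fin n)) M]
  [IsManifold (𝓡 n) ∞ M]

/-- The coordinate change between the preferred charts at `i` and at `c`. -/
def chartChange (i c : M) : EuclideanSpace ℝ (Fin n) → EuclideanSpace ℝ (Fin n) :=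
  chartAt (EuclideanSpace ℝ (Fin n)) c ∘ (chartAt (EuclideanSpace ℝ (Fin n)) i).symm

/-- The derivative of the coordinate change at the point `x`. -/
def chartChangeDeriv (i c x : M) : EuclideanSpace ℝ (Fin n) →L[ℝ] EuclideanSpace ℝ (Fin n) :=
  tangentCoordChange (𝓡 n) i c x

theorem hasFDerivAt_chartChange {i c x : M}
    (hi : x ∈ (chartAt (EuclideanSpace ℝ (Fin n)) i).source)
    (hc : x ∈ (chartAt (EuclideanSpace ℝ (Fin n)) c).source) :
    HasFDerivAt (chartChange i c) (chartChangeDeriv (n := n) i c x)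
      (chartAt (EuclideanSpace ℝ (Fin n)) i x) := by
  have h := hasFDerivWithinAt_tangentCoordChange (I := 𝓡 n) (x := i) (y := c) (z := x)
    (by simpa using ⟨hi, hc⟩)
  rw [ModelWithCorners.Boundaryless.range_eq_univ, hasFDerivWithinAt_univ] at h
  exact h

theorem coordRepr_coordField_eq {i c x : M}
    (hi : x ∈ (chartAt (EuclideanSpace ℝ (Fin n)) i).source)
    (hc : x ∈ (chartAt (EuclideanSpace ℝ (Fin n)) c).source) (v : TangentSpace (𝓡 n) i) :
    coordRepr c x (coordField i v x) = chartChangeDeriv (n := n) i c x v := by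
  rw [coordField_eq_symmL hi]
  unfold coordRepr
  rw [TangentBundle.continuousLinearMapAt_trivializationAt_eq_core hc,
    TangentBundle.symmL_trivializationAt_eq_core hi]
  exact tangentCoordChange_comp (I := 𝓡 n) (w := i) (x := x) (y := c) (by
    simp only [extChartAt_source]
    exact ⟨⟨hi, mem_chart_source _ x⟩, hc⟩)

/-- The Jacobian matrix of the coordinate change. -/
def chartChangeMatrix (i c x : M) : Matrix (Fin n) (Fin n) ℝ :=
  Matrix.of fun k l => component c (coordRepr c x (coordField i (basisVec i l) x)) k

theorem det_chartChangeMatrix {i c x : M}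
    (hi : x ∈ (chartAt (EuclideanSpace ℝ (Fin n)) i).source)
    (hc : x ∈ (chartAt (EuclideanSpace ℝ (Fin n)) c).source) :
    (chartChangeMatrix (n := n) i c x).det = (chartChangeDeriv (n := n) i c x).det := by
  unfold ContinuousLinearMap.det
  rw [← LinearMap.det_toMatrix (EuclideanSpace.basisFun (Fin n) ℝ).toBasis]
  congr 1
  ext k l
  rw [LinearMap.toMatrix_apply]
  unfold chartChangeMatrix
  simp only [Matrix.of_apply]
  rw [coordRepr_coordField_eq hi hc]
  simp [component, basisVec]

/-- The transformation law of the Gram matrix. -/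
theorem gram_chartChange (g : Metric n M) {i c x : M}
    (hc : x ∈ (chartAt (EuclideanSpace ℝ (Fin n)) c).source) :
    gram g i x = (chartChangeMatrix i c x).transpose * gram g c x * chartChangeMatrix i c x := by
  ext k l
  rw [Matrix.mul_assoc, Matrix.mul_apply]
  simp only [Matrix.mul_apply, gram_apply]
  have h : ∀ k, coordField i (basisVec i k) x = ∑ p, chartChangeMatrix i c x p k •
      coordField c (basisVec c p) x := fun k => (sum_coordField hc _).symm
  rw [h k, h l]
  simp only [map_sum, map_smul, sum_apply, smul_apply, smul_eq_mul, Matrix.transpose_apply,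
    Finset.mul_sum]
  rw [Finset.sum_comm]
  refine Finset.sum_congr rfl fun p _ => Finset.sum_congr rfl fun q _ => ?_
  ring

/-- `√det(g_{ij})` transforms with the absolute value of the Jacobian determinant. -/
theorem volDensity_chartChange (g : Metric n M) {i c x : M}
    (hi : x ∈ (chartAt (EuclideanSpace ℝ (Fin n)) i).source)
    (hc : x ∈ (chartAt (EuclideanSpace ℝ (Fin n)) c).source) :
    volDensity g i x = |(chartChangeDeriv (n := n) i c x).det| * volDensity g c x := by
  unfold volDensity
  rw [gram_chartChange g hc, Matrix.det_mul, Matrix.det_mul, Matrix.det_transpose,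
    ← det_chartChangeMatrix hi hc]
  rw [show ∀ a b : ℝ, a * b * a = a ^ 2 * b by intros; ring, Real.sqrt_mul (sq_nonneg _),
    Real.sqrt_sq_eq_abs]

theorem measurableSet_chart_image [MeasurableSpace M] [BorelSpace M] (c : M) {A : Set M}
    (hA : MeasurableSet A) (hAc : A ⊆ (chartAt (EuclideanSpace ℝ (Fin n)) c).source) :
    MeasurableSet (chartAt (EuclideanSpace ℝ (Fin n)) c '' A) := by
  set e := chartAt (EuclideanSpace ℝ (Fin n)) c with he
  have h1 : Continuous (e.target.domRestrict e.symm) := e.continuousOn_symm.domRestrict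
  have h2 := e.open_target.measurableSet.subtype_image (h1.measurable hA)
  convert h2 using 1
  rw [e.image_eq_target_inter_inv_preimage hAc]
  ext y
  constructor
  · rintro ⟨hy, hyA⟩
    exact ⟨⟨y, hy⟩, hyA, rfl⟩
  · rintro ⟨⟨y, hy⟩, hyA, rfl⟩
    exact ⟨hy, hyA⟩

variable [CompactSpace M] [T2Space M] [MeasurableSpace M] [BorelSpace M]

theorem chartMeasure_apply (g : Metric n M) (c : M) {A : Set M} (hA : MeasurableSet A)
    (hAc : A ⊆ (chartAt (EuclideanSpace ℝ (Fin n)) c).source) :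
    chartMeasure g c A = ∫⁻ y in chartAt (EuclideanSpace ℝ (Fin n)) c '' A,
      ENNReal.ofReal (volDensity g c ((chartAt (EuclideanSpace ℝ (Fin n)) c).symm y)) := by
  set e := chartAt (EuclideanSpace ℝ (Fin n)) c with he
  have hm := aemeasurable_chart_symm c _ (withDensity_absolutelyContinuous
    (volume.restrict e.target) (fun y => ENNReal.ofReal (volDensity g c (e.symm y))))
  unfold chartMeasure
  rw [Measure.map_apply_of_aemeasurable hm hA, withDensity_apply',
    Measure.restrict_restrict' e.open_target.measurableSet,
    e.image_eq_target_inter_inv_preimage hAc, inter_comm]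

/-- The measures `√det(g_{ij}) dx` of two charts agree where both charts are defined, by the change
of variables formula. -/
theorem chartMeasure_restrict_eq (g : Metric n M) (i c : M) {A : Set M} (hA : MeasurableSet A)
    (hAi : A ⊆ (chartAt (EuclideanSpace ℝ (Fin n)) i).source)
    (hAc : A ⊆ (chartAt (EuclideanSpace ℝ (Fin n)) c).source) :
    chartMeasure g i A = chartMeasure g c A := by
  rw [chartMeasure_apply g i hA hAi, chartMeasure_apply g c hA hAc]
  set ei := chartAt (EuclideanSpace ℝ (Fin n)) i with hei
  set ec := chartAt (EuclideanSpace ℝ (Fin n)) c with hec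
  have him : ec '' A = chartChange i c '' (ei '' A) := by
    rw [image_image]
    refine image_congr fun x hx => ?_
    change _ = ec (ei.symm (ei x))
    rw [ei.left_inv (hAi hx)]
  have hB := measurableSet_chart_image (n := n) i hA hAi
  rw [him, lintegral_image_eq_lintegral_abs_det_fderiv_mul volume hB
    (f' := fun y => chartChangeDeriv i c (ei.symm y))]
  · refine setLIntegral_congr_fun hB ?_
    rintro _ ⟨x, hx, rfl⟩
    change _ = _ * ENNReal.ofReal (volDensity g c (ec.symm (ec (ei.symm (ei x)))))
    simp only [ei.left_inv (hAi hx), ec.left_inv (hAc hx)]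
    rw [volDensity_chartChange g (hAi hx) (hAc hx), ENNReal.ofReal_mul (abs_nonneg _)]
  · rintro _ ⟨x, hx, rfl⟩
    change HasFDerivWithinAt _ (chartChangeDeriv i c (ei.symm (ei x))) _ _
    rw [ei.left_inv (hAi hx)]
    exact (hasFDerivAt_chartChange (hAi hx) (hAc hx)).hasFDerivWithinAt
  · rintro _ ⟨x, hx, rfl⟩ _ ⟨y, hy, rfl⟩ hxy
    change ec (ei.symm (ei x)) = ec (ei.symm (ei y)) at hxy
    rw [ei.left_inv (hAi hx), ei.left_inv (hAi hy)] at hxy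
    rw [ec.injOn (hAc hx) (hAc hy) hxy]

/-- On the domain of a chart the Riemannian volume is `√det(g_{ij}) dx`; the partition of unity in
its definition sums to one. -/
theorem vol_restrict_source (g : Metric n M) (c : M) :
    (vol g).restrict (chartAt (EuclideanSpace ℝ (Fin n)) c).source =
      (chartMeasure g c).restrict (chartAt (EuclideanSpace ℝ (Fin n)) c).source := by
  set S := (chartAt (EuclideanSpace ℝ (Fin n)) c).source with hS
  have hSm : MeasurableSet S := (chartAt (EuclideanSpace ℝ (Fin n)) c).open_source.measurableSet
  ext A hA
  rw [Measure.restrict_apply hA, Measure.restrict_apply hA]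
  have hB : MeasurableSet (A ∩ S) := hA.inter hSm
  have hBS : A ∩ S ⊆ S := inter_subset_right
  set B := A ∩ S with hBdef
  have hρm : ∀ i : M, Measurable fun x => ENNReal.ofReal (partition n M i x) := fun i =>
    (partition n M i).contMDiff.continuous.measurable.ennreal_ofReal
  have hterm : ∀ i : M, ((chartMeasure g i).withDensity
      fun x => ENNReal.ofReal (partition n M i x)) B =
      ∫⁻ x in B, ENNReal.ofReal (partition n M i x) ∂(chartMeasure g c) := by
    intro i
    set Si := (chartAt (EuclideanSpace ℝ (Fin n)) i).source with hSi
    have hSim : MeasurableSet Si :=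
      (chartAt (EuclideanSpace ℝ (Fin n)) i).open_source.measurableSet
    have h0 : ∀ x, x ∉ Si → ENNReal.ofReal (partition n M i x) = 0 := by
      intro x hx
      by_contra h
      exact hx (mem_source_of_partition_ne_zero fun h1 => h (by rw [h1, ENNReal.ofReal_zero]))
    have hres : ∀ ν : Measure M, ∫⁻ x in B, ENNReal.ofReal (partition n M i x) ∂ν =
        ∫⁻ x in B ∩ Si, ENNReal.ofReal (partition n M i x) ∂ν := by
      intro ν
      rw [← lintegral_indicator hB, ← lintegral_indicator (hB.inter hSim)]
      congr 1
      ext x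
      by_cases hx : x ∈ B <;> by_cases hx2 : x ∈ Si <;> simp [indicator, hx, hx2, h0 x]
    rw [withDensity_apply _ hB, hres, hres]
    congr 1
    ext D hD
    rw [Measure.restrict_apply hD, Measure.restrict_apply hD]
    exact chartMeasure_restrict_eq g i c (hD.inter (hB.inter hSim)) (fun x hx => hx.2.2)
      fun x hx => hBS hx.2.1
  unfold vol
  rw [Measure.sum_apply _ hB]
  simp only [hterm]
  rw [tsum_eq_sum (s := partitionIndex n M)]
  · rw [← lintegral_finsetSum _ fun i _ => hρm i]
    have h1 : ∀ x : M, ∑ i ∈ partitionIndex n M, ENNReal.ofReal (partition n M i x) = 1 := by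
      intro x
      rw [← ENNReal.ofReal_sum_of_nonneg fun i _ => (partition n M).nonneg i x, sum_partition,
        ENNReal.ofReal_one]
    simp [h1]
  · intro i hi
    simp [partition_eq_zero hi]

/-- The integral of a function that vanishes off the domain of a chart, in coordinates. -/
theorem integral_vol_eq_chart (g : Metric n M) (c : M) {f : M → ℝ} (hf : Continuous f)
    (h0 : ∀ x ∉ (chartAt (EuclideanSpace ℝ (Fin n)) c).source, f x = 0) :
    ∫ x, f x ∂(vol g) = ∫ y in (chartAt (EuclideanSpace ℝ (Fin n)) c).target,
      volDensity g c ((chartAt (EuclideanSpace ℝ (Fin n)) c).symm y) *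
        f ((chartAt (EuclideanSpace ℝ (Fin n)) c).symm y) := by
  set e := chartAt (EuclideanSpace ℝ (Fin n)) c with he
  have hdm : AEMeasurable (fun y => ENNReal.ofReal (volDensity g c (e.symm y)))
      (volume.restrict e.target) :=
    (ENNReal.continuous_ofReal.comp_continuousOn ((continuousOn_volDensity g c).comp
      e.continuousOn_symm e.symm.mapsTo)).aemeasurable e.open_target.measurableSet
  have hm := aemeasurable_chart_symm c _ (withDensity_absolutelyContinuous
    (volume.restrict e.target) (fun y => ENNReal.ofReal (volDensity g c (e.symm y))))
  rw [← setIntegral_eq_integral_of_forall_compl_eq_zero h0, vol_restrict_source,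
    setIntegral_eq_integral_of_forall_compl_eq_zero h0]
  unfold chartMeasure
  rw [integral_map hm hf.aestronglyMeasurable,
    integral_withDensity_eq_integral_toReal_smul₀ hdm
      (ae_of_all _ fun y => ENNReal.ofReal_lt_top)]
  refine setIntegral_congr_fun e.open_target.measurableSet fun y hy => ?_
  simp only [smul_eq_mul]
  rw [ENNReal.toReal_ofReal (volDensity_pos g (e.map_target hy)).le]

end ChartChange

/-! ### The divergence theorem -/

section CoordinateDerivative

variable {n : ℕ} {M : Type*} [TopologicalSpace M] [ChartedSpace (EuclideanSpace ℝ (Fin n)) M]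
  [IsManifold (𝓡 n) ∞ M]

/-- Coordinate fields act on functions as partial derivatives. -/
theorem dFun_coordField {f : M → ℝ} {c x : M}
    (hx : x ∈ (chartAt (EuclideanSpace ℝ (Fin n)) c).source) (hf : FunDiffAt (n := n) f x)
    (v : TangentSpace (𝓡 n) c) :
    dFun (n := n) f x (coordField c v x) =
      fderiv ℝ (f ∘ (chartAt (EuclideanSpace ℝ (Fin n)) c).symm)
        (chartAt (EuclideanSpace ℝ (Fin n)) c x) v := by
  set e := chartAt (EuclideanSpace ℝ (Fin n)) c with he
  have hy : e x ∈ (extChartAt (𝓡 n) c).target := by simpa using e.map_source hx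
  have hinv : e.symm (e x) = x := e.left_inv hx
  have hφ : MDifferentiableAt 𝓘(ℝ, EuclideanSpace ℝ (Fin n)) (𝓡 n) e.symm (e x) := by
    have := mdifferentiableWithinAt_extChartAt_symm (I := 𝓡 n) hy
    rw [ModelWithCorners.Boundaryless.range_eq_univ, mdifferentiableWithinAt_univ] at this
    exact this
  rw [coordField_eq_symmL hx]
  rw [TangentBundle.symmL_trivializationAt hx, ModelWithCorners.Boundaryless.range_eq_univ,
    mfderivWithin_univ, ← mfderiv_eq_fderiv, mfderiv_comp (I' := 𝓡 n) (e x) (by rwa [hinv]) hφ]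
  have h2 : ∀ z, z = x → ∀ w : EuclideanSpace ℝ (Fin n),
      dFun (n := n) f x w = dFun (n := n) f z w := by
    rintro z rfl w
    rfl
  exact h2 _ hinv _

/-- The `i`-th coordinate function of the preferred chart at `c`. -/
def coordFun (c : M) (i : Fin n) (x : M) : ℝ := chartAt (EuclideanSpace ℝ (Fin n)) c x i

theorem funSmoothAt_coordFun {c x : M} (hx : x ∈ (chartAt (EuclideanSpace ℝ (Fin n)) c).source)
    (i : Fin n) : FunSmoothAt (n := n) (coordFun c i) x := by
  have h1 : ContMDiffAt (𝓡 n) 𝓘(ℝ, EuclideanSpace ℝ (Fin n)) ∞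
      (chartAt (EuclideanSpace ℝ (Fin n)) c) x := contMDiffAt_extChartAt' (I := 𝓡 n) hx
  exact (EuclideanSpace.proj (𝕜 := ℝ) i).contDiff.contMDiff.contMDiffAt.comp x h1

theorem dFun_coordFun {c x : M} (hx : x ∈ (chartAt (EuclideanSpace ℝ (Fin n)) c).source)
    (i : Fin n) (w : TangentSpace (𝓡 n) x) :
    dFun (n := n) (coordFun c i) x w = component c (coordRepr c x w) i := by
  conv_lhs => rw [← coordField_coordRepr hx w]
  rw [dFun_coordField hx (funSmoothAt_coordFun hx i).diffAt]
  set e := chartAt (EuclideanSpace ℝ (Fin n)) c with he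
  have h : coordFun c i ∘ e.symm =ᶠ[𝓝 (e x)]
      (EuclideanSpace.proj i : EuclideanSpace ℝ (Fin n) →L[ℝ] ℝ) := by
    filter_upwards [e.open_target.mem_nhds (e.map_source hx)] with y hy
    change e (e.symm y) i = _
    rw [e.right_inv hy]
    rfl
  rw [h.fderiv_eq, ContinuousLinearMap.fderiv]
  rfl

/-- Coordinate fields of one chart commute. -/
theorem mlieBracket_coordField {c x : M}
    (hx : x ∈ (chartAt (EuclideanSpace ℝ (Fin n)) c).source) (v w : TangentSpace (𝓡 n) c) :
    mlieBracket (𝓡 n) (coordField c v) (coordField c w) x = 0 := by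
  have hS := (chartAt (EuclideanSpace ℝ (Fin n)) c).open_source.mem_nhds hx
  have hconst : ∀ (i : Fin n) (v : TangentSpace (𝓡 n) c),
      (fun y => dFun (n := n) (coordFun c i) y (coordField c v y)) =ᶠ[𝓝 x]
        fun _ => component c v i := by
    intro i v
    filter_upwards [hS] with y hy
    rw [dFun_coordFun hy, coordRepr_coordField hy]
  have hcomp : ∀ i, component c (coordRepr c x
      (mlieBracket (𝓡 n) (coordField c v) (coordField c w) x)) i = 0 := by
    intro i
    rw [← dFun_coordFun hx, dFun_mlieBracket (funSmoothAt_coordFun hx i)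
      (fieldSmoothAt_coordField hx v).diffAt (fieldSmoothAt_coordField hx w).diffAt,
      dFun_congr (hconst i w), dFun_congr (hconst i v), dFun_const, dFun_const]
    simp
  rw [← sum_coordField hx (mlieBracket (𝓡 n) (coordField c v) (coordField c w) x)]
  simp only [hcomp, zero_smul, Finset.sum_const_zero]

theorem funSmoothAt_volDensity (g : Metric n M) {c x : M}
    (hx : x ∈ (chartAt (EuclideanSpace ℝ (Fin n)) c).source) :
    FunSmoothAt (n := n) (volDensity g c) x := by
  have h1 := funSmoothAt_det (n := n) (x := x) (A := gram g c) fun i j => funSmoothAt_gram g hx i j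
  exact ((Real.contDiffAt_sqrt (gram_det_pos g hx).ne').contMDiffAt).comp x h1

/-- The coordinate formula `div(h ∂ᵢ) √det g = ∂ᵢ(h √det g)`. -/
theorem volDensity_mul_divergence (g : Metric n M) {h : M → ℝ} {c x : M}
    (hx : x ∈ (chartAt (EuclideanSpace ℝ (Fin n)) c).source) (hh : FunDiffAt (n := n) h x)
    (i : Fin n) :
    volDensity g c x * divergence g (h • coordField c (basisVec c i)) x =
      dFun (n := n) (fun y => h y * volDensity g c y) x (coordField c (basisVec c i) x) := by
  have hE : FieldDiffAt (coordField c (basisVec c i)) x := (fieldSmoothAt_coordField hx _).diffAt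
  rw [divergence_smul g hh hE, divergence_eq_chart (x₀ := c) g (coordField c (basisVec c i)) hx]
  simp only [mlieBracket_coordField hx]
  have h0 : ∀ j, component c (coordRepr (n := n) c x 0) j = 0 := by
    intro j
    unfold coordRepr
    rw [map_zero]
    exact map_zero (EuclideanSpace.proj j : EuclideanSpace ℝ (Fin n) →L[ℝ] ℝ)
  simp only [h0, Finset.sum_const_zero, sub_zero]
  rw [dFun_mul hh (funDiffAt_volDensity g hx)]
  simp only [add_apply, smul_apply, smul_eq_mul]
  have := (volDensity_pos g hx).ne'
  field_simp
  ring

theorem integral_fderiv_eq_zero {E : Type*} [NormedAddCommGroup E] [NormedSpace ℝ E]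
    [FiniteDimensional ℝ E] [MeasurableSpace E] [BorelSpace E] {μ : Measure E}
    [μ.IsAddHaarMeasure] {F : E → ℝ} (hF : ContDiff ℝ 1 F) (hc : HasCompactSupport F) (v : E) :
    ∫ y, fderiv ℝ F y v ∂μ = 0 := by
  have hF' : Continuous fun y => fderiv ℝ F y v :=
    (hF.continuous_fderiv one_ne_zero).clm_apply continuous_const
  have hc' : HasCompactSupport fun y => fderiv ℝ F y v :=
    (hc.fderiv ℝ).comp_left (g := fun L : E →L[ℝ] ℝ => L v) rfl
  have h := integral_mul_fderiv_eq_neg_fderiv_mul_of_integrable (μ := μ) (f := fun _ : E => (1 : ℝ))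
    (g := F) (v := v) (by simp) (by simpa using hF'.integrable_of_hasCompactSupport hc')
    (by simpa using hF.continuous.integrable_of_hasCompactSupport hc)
    (fun _ _ => differentiableAt_const _) (fun y _ => hF.differentiable one_ne_zero y)
  simpa using h

end CoordinateDerivative

section DivergenceTheorem

variable {n : ℕ} {M : Type*} [TopologicalSpace M] [ChartedSpace (EuclideanSpace ℝ (Fin n)) M]
  [IsManifold (𝓡 n) ∞ M] [CompactSpace M] [T2Space M]

theorem fieldSmooth_smul_coordField {h : M → ℝ} {c : M} (hh : SmoothFun (n := n) h)
    (hs : tsupport h ⊆ (chartAt (EuclideanSpace ℝ (Fin n)) c).source) (v : TangentSpace (𝓡 n) c)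
    (x : M) : FieldSmoothAt (h • coordField c v) x :=
  ContMDiffOn.smul_section_of_tsupport hh.contMDiffOn
      (chartAt (EuclideanSpace ℝ (Fin n)) c).open_source hs (contMDiffOn_coordField c v) x

/-- A function with support in a chart domain, transported to the model space. -/
def chartExtend (c : M) (p : M → ℝ) : EuclideanSpace ℝ (Fin n) → ℝ :=
  (chartAt (EuclideanSpace ℝ (Fin n)) c).target.indicator
    (p ∘ (chartAt (EuclideanSpace ℝ (Fin n)) c).symm)

theorem isCompact_chart_tsupport {c : M} {p : M → ℝ}
    (hs : tsupport p ⊆ (chartAt (EuclideanSpace ℝ (Fin n)) c).source) :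
    IsCompact (chartAt (EuclideanSpace ℝ (Fin n)) c '' tsupport p) :=
  (isClosed_tsupport p).isCompact.image_of_continuousOn
    ((chartAt (EuclideanSpace ℝ (Fin n)) c).continuousOn.mono hs)

theorem chartExtend_eq_zero {c : M} {p : M → ℝ} {y : EuclideanSpace ℝ (Fin n)}
    (hy : y ∉ chartAt (EuclideanSpace ℝ (Fin n)) c '' tsupport p) : chartExtend c p y = 0 := by
  unfold chartExtend
  by_cases hyt : y ∈ (chartAt (EuclideanSpace ℝ (Fin n)) c).target
  · rw [indicator_of_mem hyt]
    by_contra h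
    exact hy ⟨_, subset_tsupport p h, (chartAt (EuclideanSpace ℝ (Fin n)) c).right_inv hyt⟩
  · rw [indicator_of_notMem hyt]

theorem hasCompactSupport_chartExtend {c : M} {p : M → ℝ}
    (hs : tsupport p ⊆ (chartAt (EuclideanSpace ℝ (Fin n)) c).source) :
    HasCompactSupport (chartExtend (n := n) c p) :=
  HasCompactSupport.intro (isCompact_chart_tsupport hs) fun _ hy => chartExtend_eq_zero hy

theorem chartExtend_eventuallyEq {c : M} (p : M → ℝ) {y : EuclideanSpace ℝ (Fin n)}
    (hy : y ∈ (chartAt (EuclideanSpace ℝ (Fin n)) c).target) :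
    chartExtend c p =ᶠ[𝓝 y] p ∘ (chartAt (EuclideanSpace ℝ (Fin n)) c).symm := by
  filter_upwards [(chartAt (EuclideanSpace ℝ (Fin n)) c).open_target.mem_nhds hy] with z hz
  exact indicator_of_mem hz _

theorem contDiff_chartExtend {c : M} {p : M → ℝ}
    (hs : tsupport p ⊆ (chartAt (EuclideanSpace ℝ (Fin n)) c).source)
    (hp : ∀ x ∈ (chartAt (EuclideanSpace ℝ (Fin n)) c).source, FunSmoothAt (n := n) p x) :
    ContDiff ℝ ∞ (chartExtend (n := n) c p) := by
  set e := chartAt (EuclideanSpace ℝ (Fin n)) c with he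
  refine contDiff_iff_contDiffAt.2 fun y => ?_
  by_cases hy : y ∈ e '' tsupport p
  · have hyt : y ∈ e.target := by
      obtain ⟨x, hx, rfl⟩ := hy
      exact e.map_source (hs hx)
    refine ContDiffAt.congr_of_eventuallyEq ?_ (chartExtend_eventuallyEq p hyt)
    have h1 : ContMDiffAt 𝓘(ℝ, EuclideanSpace ℝ (Fin n)) (𝓡 n) ∞ e.symm y := by
      have h := contMDiffOn_extChartAt_symm (I := 𝓡 n) (n := ∞) c
      have h2 : (extChartAt (𝓡 n) c).target = e.target := by simp [he]
      rw [h2] at h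
      exact h.contMDiffAt (e.open_target.mem_nhds hyt)
    exact ((hp _ (e.map_target hyt)).comp y h1).contDiffAt
  · refine contDiffAt_const (c := (0 : ℝ)) |>.congr_of_eventuallyEq ?_
    filter_upwards [(isCompact_chart_tsupport hs).isClosed.isOpen_compl.mem_nhds hy] with z hz
    exact chartExtend_eq_zero hz

variable [MeasurableSpace M] [BorelSpace M]

/-- The divergence theorem for a field `h ∂ᵢ` with `h` supported in a chart. -/
theorem integral_divergence_chart (g : Metric n M) {h : M → ℝ} {c : M}
    (hh : SmoothFun (n := n) h)
    (hs : tsupport h ⊆ (chartAt (EuclideanSpace ℝ (Fin n)) c).source) (i : Fin n) :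
    ∫ x, divergence g (h • coordField c (basisVec c i)) x ∂(vol g) = 0 := by
  set e := chartAt (EuclideanSpace ℝ (Fin n)) c with he
  have hzero : ∀ x, x ∉ tsupport h → divergence g (h • coordField c (basisVec c i)) x = 0 := by
    intro x hx
    rw [← divergence_zero g x]
    refine divergence_congr g ?_
    filter_upwards [(isClosed_tsupport h).isOpen_compl.mem_nhds hx] with y hy
    rw [Pi.smul_apply', image_eq_zero_of_notMem_tsupport hy, zero_smul]
    rfl
  let u : VectorFields n M := ⟨_, fieldSmooth_smul_coordField hh hs (basisVec c i)⟩
  have hcont : Continuous (divergence g (h • coordField c (basisVec c i))) :=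
    (smoothFun_divergence g u).continuous
  rw [integral_vol_eq_chart g c hcont fun x hx => hzero x fun h1 => hx (hs h1)]
  set p : M → ℝ := fun y => h y * volDensity g c y with hp
  have hps : tsupport p ⊆ tsupport h := closure_mono fun x hx h0 => hx (by simp [hp, h0])
  have hpsm : ∀ x ∈ e.source, FunSmoothAt (n := n) p x := fun x hx =>
    (hh x).mul (funSmoothAt_volDensity g hx)
  have hF := contDiff_chartExtend (c := c) (hps.trans hs) hpsm
  rw [← integral_fderiv_eq_zero (μ := (volume : Measure (EuclideanSpace ℝ (Fin n))))
    (hF.of_le (by simp)) (hasCompactSupport_chartExtend (hps.trans hs))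
    (EuclideanSpace.single i (1 : ℝ)),
    ← setIntegral_eq_integral_of_forall_compl_eq_zero (s := e.target)
      (f := fun y => fderiv ℝ (chartExtend c p) y (EuclideanSpace.single i (1 : ℝ)))]
  · refine setIntegral_congr_fun e.open_target.measurableSet fun y hy => ?_
    have hx := e.map_target hy
    rw [volDensity_mul_divergence g hx (FunSmoothAt.diffAt (hh _)),
      dFun_coordField hx (FunSmoothAt.diffAt (hpsm _ hx)),
      (chartExtend_eventuallyEq p hy).fderiv_eq]
    change fderiv ℝ (p ∘ e.symm) (e (e.symm y)) _ = _
    rw [e.right_inv hy]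
    rfl
  · intro y hy
    have h1 : chartExtend c p =ᶠ[𝓝 y] fun _ => 0 := by
      have hy2 : y ∉ e '' tsupport p := by
        rintro ⟨x, hx, rfl⟩
        exact hy (e.map_source (hs (hps hx)))
      filter_upwards [(isCompact_chart_tsupport
        (hps.trans hs)).isClosed.isOpen_compl.mem_nhds hy2] with z hz
      exact chartExtend_eq_zero hz
    rw [h1.fderiv_eq]
    simp

theorem integrable_vol (g : Metric n M) {f : M → ℝ} (hf : Continuous f) :
    Integrable f (vol g) :=
  hf.integrable_of_hasCompactSupport (HasCompactSupport.of_compactSpace _)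

/-- The divergence theorem on a closed manifold. The field is a finite sum of fields `h ∂ᵢ`, each
supported in a chart. -/
theorem integral_divergence (g : Metric n M) (u : VectorFields n M) :
    ∫ x, divergence g u x ∂(vol g) = 0 := by
  set h : partitionIndex n M × Fin n → M → ℝ := fun a x =>
    g.inner x (cutoffDualField g a.1.1 a.2 x) (u x) * partition n M a.1.1 x with hdef
  have hh : ∀ a, SmoothFun (n := n) (h a) := fun a =>
    (smoothFun_inner g _ u).mul (partition n M a.1.1).contMDiff
  have hs : ∀ a, tsupport (h a) ⊆ (chartAt (EuclideanSpace ℝ (Fin n)) a.1.1).source := by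
    intro a
    refine (closure_mono fun x hx => ?_).trans (partition_isSubordinate n M a.1.1)
    intro h0
    exact hx (by simp [hdef, h0])
  have hu : (u : Π x : M, TangentSpace (𝓡 n) x) =
      ∑ a, h a • coordField a.1.1 (basisVec a.1.1 a.2) := by
    ext1 x
    rw [Finset.sum_apply]
    conv_lhs => rw [← isDual_cutoffField g x (u x)]
    refine Finset.sum_congr rfl fun a _ => ?_
    exact smul_smul _ _ _
  have hd : ∀ x, divergence g u x =
      ∑ a, divergence g (h a • coordField a.1.1 (basisVec a.1.1 a.2)) x := by
    intro x
    rw [hu, divergence_sum g fun a _ =>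
      (fieldSmooth_smul_coordField (hh a) (hs a) _ x).diffAt]
  simp only [hd]
  rw [integral_finsetSum]
  · exact Finset.sum_eq_zero fun a _ => integral_divergence_chart g (hh a) (hs a) a.2
  · intro a _
    let v : VectorFields n M := ⟨_, fieldSmooth_smul_coordField (hh a) (hs a) (basisVec a.1.1 a.2)⟩
    exact integrable_vol g (smoothFun_divergence g v).continuous

/-- Integration by parts: minus the divergence is the formal adjoint of the differential. -/
theorem integral_dFun (g : Metric n M) {f : M → ℝ} (hf : SmoothFun (n := n) f)
    (u : VectorFields n M) :
    ∫ x, dFun (n := n) f x (u x) ∂(vol g) = -∫ x, f x * divergence g u x ∂(vol g) := by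
  have h := integral_divergence g (funSmul f hf u)
  have h1 : ∀ x, divergence g (funSmul f hf u) x =
      dFun (n := n) f x (u x) + f x * divergence g u x := fun x =>
    divergence_smul g (FunSmoothAt.diffAt (hf x)) (u.diffAt x)
  simp only [h1] at h
  rw [integral_add (g := fun x => f x * divergence g u x)
    (integrable_vol g (smoothFun_dFun hf u).continuous)
    (integrable_vol g (hf.mul (smoothFun_divergence g u)).continuous)] at h
  linarith

instance isOpenPosMeasure_vol (g : Metric n M) : (vol g).IsOpenPosMeasure := by
  refine ⟨fun U hU ⟨x, hx⟩ h0 => ?_⟩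
  set e := chartAt (EuclideanSpace ℝ (Fin n)) x with he
  have hV : IsOpen (U ∩ e.source) := hU.inter e.open_source
  have h1 : vol g (U ∩ e.source) = 0 := measure_mono_null inter_subset_left h0
  have h2 : vol g (U ∩ e.source) = chartMeasure g x (U ∩ e.source) := by
    rw [← Measure.restrict_apply hU.measurableSet, vol_restrict_source,
      Measure.restrict_apply hU.measurableSet]
  rw [h2, chartMeasure_apply g x hV.measurableSet inter_subset_right] at h1
  have hopen : IsOpen (e '' (U ∩ e.source)) :=
    e.isOpen_image_of_subset_source hV inter_subset_right
  have hm : AEMeasurable (fun y => ENNReal.ofReal (volDensity g x (e.symm y)))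
      (volume.restrict (e '' (U ∩ e.source))) := by
    refine (ENNReal.continuous_ofReal.comp_continuousOn (((continuousOn_volDensity g x).comp
      e.continuousOn_symm e.symm.mapsTo).mono ?_)).aemeasurable hopen.measurableSet
    rintro _ ⟨z, hz, rfl⟩
    exact e.map_source hz.2
  rw [setLIntegral_eq_zero_iff' hopen.measurableSet hm] at h1
  have h3 : volume (e '' (U ∩ e.source)) = 0 := by
    rw [← nonpos_iff_eq_zero]
    refine (measure_mono fun y hy => ?_).trans_eq (ae_iff.1 h1)
    simp only [mem_ofPred_eq, Classical.not_imp]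
    refine ⟨hy, ?_⟩
    obtain ⟨z, hz, rfl⟩ := hy
    simp only [ENNReal.ofReal_eq_zero, not_le]
    rw [e.left_inv hz.2]
    exact volDensity_pos g hz.2
  exact hopen.measure_ne_zero volume ⟨e x, x, ⟨hx, mem_chart_source _ x⟩, rfl⟩ h3

/-- A continuous function vanishes if the integral of its square does. This is how the fundamental
lemma of the calculus of variations is used. -/
theorem eq_zero_of_integral_mul_self (g : Metric n M) {f : M → ℝ} (hf : Continuous f)
    (h : ∫ x, f x * f x ∂(vol g) = 0) (x : M) : f x = 0 := by
  have h1 := (integral_eq_zero_iff_of_nonneg (fun x => mul_self_nonneg (f x))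
    (integrable_vol g (hf.mul hf))).1 h
  have h2 := (Continuous.ae_eq_iff_eq (vol g) (hf.mul hf) continuous_const).1 h1
  exact mul_self_eq_zero.1 (congrFun h2 x)

end DivergenceTheorem

/-! ### The inertia operator and the coadjoint action -/

section TwoForms

variable {n : ℕ} {M : Type*} [TopologicalSpace M] [ChartedSpace (EuclideanSpace ℝ (Fin n)) M]
  [IsManifold (𝓡 n) ∞ M]

theorem twoFormInner_comm (g : Metric n M)
    (w w' : Π x : M, TangentSpace (𝓡 n) x → TangentSpace (𝓡 n) x → ℝ) (x : M) :
    twoFormInner g w w' x = twoFormInner g w' w x := by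
  unfold twoFormInner
  congr 1
  have h1 : ∀ A : Fin n → Fin n → Fin n → Fin n → ℝ, ∑ i, ∑ j, ∑ k, ∑ l, A i j k l =
      ∑ i, ∑ j, ∑ k, ∑ l, A k l i j := by
    intro A
    have e : ∀ B : Fin n → Fin n → ℝ, ∑ i, ∑ j, B i j = ∑ p : Fin n × Fin n, B p.1 p.2 :=
      fun B => (Fintype.sum_prod_type (fun p : Fin n × Fin n => B p.1 p.2)).symm
    have h2 : ∀ A : Fin n → Fin n → Fin n → Fin n → ℝ, ∑ i, ∑ j, ∑ k, ∑ l, A i j k l =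
        ∑ p : Fin n × Fin n, ∑ q : Fin n × Fin n, A p.1 p.2 q.1 q.2 := by
      intro A
      simp only [e]
    rw [h2, h2 (fun i j k l => A k l i j), Finset.sum_comm]
  rw [h1]
  refine Finset.sum_congr rfl fun i _ => Finset.sum_congr rfl fun j _ =>
    Finset.sum_congr rfl fun k _ => Finset.sum_congr rfl fun l _ => ?_
  rw [gram_inv_symm g x x k i, gram_inv_symm g x x l j]
  ring

theorem twoFormInner_zero_left (g : Metric n M)
    (w w' : Π x : M, TangentSpace (𝓡 n) x → TangentSpace (𝓡 n) x → ℝ) {x : M}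
    (hw : ∀ p q, w x p q = 0) : twoFormInner g w w' x = 0 := by
  simp [twoFormInner, hw]

/-- There is a self-dual system, an orthonormal basis, at every point. -/
theorem exists_isDual_self (g : Metric n M) (x : M) :
    ∃ (m : ℕ) (X : Fin m → TangentSpace (𝓡 n) x), IsDual g X X := by
  let core := g.toRiemannianMetric.toCore x
  let : NormedAddCommGroup (TangentSpace (𝓡 n) x) := core.toNormedAddCommGroup
  let : InnerProductSpace ℝ (TangentSpace (𝓡 n) x) := InnerProductSpace.ofCore core.toCore
  have : FiniteDimensional ℝ (TangentSpace (𝓡 n) x) :=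
    inferInstanceAs (FiniteDimensional ℝ (EuclideanSpace ℝ (Fin n)))
  let b := stdOrthonormalBasis ℝ (TangentSpace (𝓡 n) x)
  exact ⟨_, b, fun v => b.sum_repr' v⟩

end TwoForms

section HodgeProjections

variable {n : ℕ} {M : Type*} [TopologicalSpace M] [ChartedSpace (EuclideanSpace ℝ (Fin n)) M]
  [IsManifold (𝓡 n) ∞ M] [CompactSpace M] [T2Space M] [MeasurableSpace M] [BorelSpace M]

theorem inner_toL2 (g : Metric n M) (u v : VectorFields n M) :
    inner ℝ (toL2 g u) (toL2 g v) = ∫ x, g.inner x (u x) (v x) ∂(vol g) :=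
  UniformSpace.Completion.inner_coe _ _

theorem toL2_add (g : Metric n M) (u v : VectorFields n M) :
    toL2 g (u + v) = toL2 g u + toL2 g v :=
  UniformSpace.Completion.coe_add (α := PreL2 g) _ _

theorem toL2_smul (g : Metric n M) (r : ℝ) (u : VectorFields n M) :
    toL2 g (r • u) = r • toL2 g u :=
  (UniformSpace.Completion.toComplₗᵢ (𝕜 := ℝ) (E := PreL2 g)).map_smul r _

theorem smul_field_apply (r : ℝ) (u : VectorFields n M) (x : M) : (r • u) x = r • u x := rfl

theorem toField_apply {u : Π x : M, TangentSpace (𝓡 n) x}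
    (h : ContMDiff (𝓡 n) (𝓡 n).tangent ∞ (fun x => (⟨x, u x⟩ : TangentBundle (𝓡 n) M))) (x : M) :
    toField u x = u x := by
  unfold toField
  rw [dif_pos h]
  rfl

theorem toField_coe (u : VectorFields n M) : toField (u : Π x : M, TangentSpace (𝓡 n) x) = u := by
  ext x
  exact toField_apply u.contMDiff x

theorem adField_eq (u v : VectorFields n M) : adField u v = -bracket u v :=
  toField_coe (-bracket u v)

theorem adField_apply (u v : VectorFields n M) (x : M) :
    adField u v x = -mlieBracket (𝓡 n) u v x := by
  rw [adField_eq]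
  rfl

/-- The coadjoint action `ad*_u m = L_u m + div(u) m`, from the Leibniz rule for `u(m(v))` and the
divergence theorem. -/
theorem adStar_pairing (g : Metric n M) (u : VectorFields n M) (m : OneForms n M)
    (v : VectorFields n M) : adStar u (pairing g m) v =
      ∫ x, (lieForm u m v x + divergence g u x * m x (v x)) ∂(vol g) := by
  have hf := smoothFun_form m v
  have h1 := integral_dFun g hf u
  have h2 : adStar u (pairing g m) v = ∫ x, -(m x (bracket u v x)) ∂(vol g) := by
    unfold adStar pairing
    congr 1
    ext x
    rw [adField_apply, map_neg, bracket_apply]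
  have i1 := integrable_vol g (smoothFun_dFun hf u).continuous
  have i2 := integrable_vol g (smoothFun_form m (bracket u v)).continuous
  have i3 := integrable_vol g (hf.mul (smoothFun_divergence g u)).continuous
  have h3 : ∀ x, lieForm u m v x + divergence g u x * m x (v x) =
      (dFun (n := n) (fun y => m y (v y)) x (u x) + m x (v x) * divergence g u x)
        + -(m x (bracket u v x)) := by
    intro x
    rw [bracket_apply]
    unfold lieForm
    ring
  simp only [h3]
  have i13 : Integrable (fun x => dFun (n := n) (fun y => m y (v y)) x (u x)
      + m x (v x) * divergence g u x) (vol g) := i1.add i3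
  have i2' : Integrable (fun x => -(m x (bracket u v x))) (vol g) := i2.neg
  have i3' : Integrable (fun x => m x (v x) * divergence g u x) (vol g) := i3
  rw [h2, integral_add i13 i2', integral_add i1 i3', h1]
  ring

/-- Gradients are tested against fields by the divergence. -/
theorem integral_inner_gradField (g : Metric n M) {f : M → ℝ} (hf : SmoothFun (n := n) f)
    (v : VectorFields n M) : inner ℝ (toL2 g (gradField g f hf)) (toL2 g v) =
      -∫ x, f x * divergence g v x ∂(vol g) := by
  rw [inner_toL2, ← integral_dFun g hf v]
  congr 1
  ext x
  rw [gradField_apply, inner_sharp]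

/-- A harmonic field is closed and co-closed: pairing `Δk♭` with `k♭` gives `‖dk♭‖² + ‖δk♭‖² = 0`.
-/
theorem IsHarmonicField.closed_coclosed {g : Metric n M} {k : VectorFields n M}
    (hk : IsHarmonicField g k) :
    (∀ x v w, dForm (flat g k) x v w = 0) ∧ ∀ x, divergence g k x = 0 := by
  have h := hk (flatForm g k)
  set D : M → ℝ := fun x => divergence g k x with hD
  have hDs : SmoothFun (n := n) D := smoothFun_divergence g k
  have hcod : codiffOne g (flat g k) = fun x => -D x := funext (codiffOne_flat g k)
  -- the right side of the harmonic equation, paired with `k`, is `-‖δk♭‖²`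
  have hr : ∫ x, (-dFun (n := n) (codiffOne g (flat g k)) x) (sharp g (flatForm g k) x) ∂(vol g)
      = -∫ x, D x * D x ∂(vol g) := by
    rw [← integral_dFun g hDs k]
    congr 1
    ext x
    have h1 : sharp g (flatForm g k) x = k x := congrFun (sharp_flat g k) x
    rw [h1, hcod, dFun_neg]
    simp
  rw [hr] at h
  have hT := smoothFun_twoFormInner g (flatForm g k) (flatForm g k)
  have hdual : ∀ x, ∃ (m : ℕ) (X : Fin m → TangentSpace (𝓡 n) x), IsDual g X X :=
    exists_isDual_self g
  have hd : ∀ x, FormDiffAt (flatForm g k) x := (flatForm g k).diffAt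
  have heq : ∀ x, ∀ (m : ℕ) (X : Fin m → TangentSpace (𝓡 n) x), IsDual g X X →
      twoFormInner g (dForm (flatForm g k)) (dForm (flatForm g k)) x =
      (1 / 2) * ∑ a, ∑ b, dForm (flatForm g k) x (X a) (X b) *
        dForm (flatForm g k) x (X a) (X b) := fun x m X hX =>
    twoFormInner_eq hX _ _ (dBilin _ x (hd x)) (dBilin _ x (hd x)) (fun _ _ => rfl) fun _ _ => rfl
  have hpos : ∀ x, 0 ≤ twoFormInner g (dForm (flatForm g k)) (dForm (flatForm g k)) x := by
    intro x
    obtain ⟨m, X, hX⟩ := hdual x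
    rw [heq x m X hX]
    exact mul_nonneg (by norm_num) (Finset.sum_nonneg fun a _ => Finset.sum_nonneg fun b _ =>
      mul_self_nonneg _)
  have h1 : 0 ≤ ∫ x, twoFormInner g (dForm (flatForm g k)) (dForm (flatForm g k)) x ∂(vol g) :=
    integral_nonneg hpos
  have h2 : 0 ≤ ∫ x, D x * D x ∂(vol g) := integral_nonneg fun x => mul_self_nonneg _
  have h3 : ∫ x, twoFormInner g (dForm (flatForm g k)) (dForm (flatForm g k)) x ∂(vol g) =
      -∫ x, D x * D x ∂(vol g) := h
  refine ⟨fun x v w => ?_, eq_zero_of_integral_mul_self g hDs.continuous (by linarith)⟩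
  have h4 : (fun x => twoFormInner g (dForm (flatForm g k)) (dForm (flatForm g k)) x) = 0 :=
    (Continuous.ae_eq_iff_eq (vol g) hT.continuous continuous_const).1
      ((integral_eq_zero_iff_of_nonneg hpos (integrable_vol g hT.continuous)).1 (by linarith))
  obtain ⟨m, X, hX⟩ := hdual x
  have h5 := congrFun h4 x
  simp only [Pi.zero_apply] at h5
  rw [heq x m X hX] at h5
  have h6 : ∑ a, ∑ b, dForm (flatForm g k) x (X a) (X b) *
        dForm (flatForm g k) x (X a) (X b) = 0 := by linarith
  have h7 : ∀ a b, dForm (flatForm g k) x (X a) (X b) = 0 := by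
    intro a b
    have h8 := (Finset.sum_eq_zero_iff_of_nonneg fun a _ => Finset.sum_nonneg fun b _ =>
      mul_self_nonneg _).1 h6 a (Finset.mem_univ a)
    exact mul_self_eq_zero.1 ((Finset.sum_eq_zero_iff_of_nonneg fun b _ =>
      mul_self_nonneg _).1 h8 b (Finset.mem_univ b))
  change dForm (flatForm g k) x v w = 0
  rw [dBilin_apply (hd x), ← hX v, ← hX w]
  simp only [map_sum, map_smul, LinearMap.sum_apply, LinearMap.smul_apply, ← dBilin_apply, h7,
    smul_zero, Finset.sum_const_zero]

theorem toL2_mem_closure_span (g : Metric n M) {S : Set (VectorFields n M)}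
    {u : VectorFields n M} (hu : u ∈ S) :
    toL2 g u ∈ (Submodule.span ℝ (toL2 g '' S)).topologicalClosure :=
  Submodule.le_topologicalClosure _ (Submodule.subset_span ⟨u, hu, rfl⟩)

/-- Orthogonality to a closed span of smooth fields may be tested on the generators. -/
theorem mem_orthogonal_span (g : Metric n M) {S : Set (VectorFields n M)} {w : L2 g}
    (h : ∀ u ∈ S, inner ℝ w (toL2 g u) = 0) :
    w ∈ (Submodule.span ℝ (toL2 g '' S)).topologicalClosureᗮ := by
  rw [Submodule.orthogonal_closure, Submodule.mem_orthogonal]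
  intro z hz
  induction hz using Submodule.span_induction with
  | mem z hz =>
    obtain ⟨u, hu, rfl⟩ := hz
    rw [real_inner_comm]
    exact h u hu
  | zero => exact inner_zero_left _
  | add a b _ _ ha hb => rw [inner_add_left, ha, hb, add_zero]
  | smul r a _ ha => rw [inner_smul_left, ha, mul_zero]

/-- `P̄_κ` fixes harmonic fields, since these are also co-closed. -/
theorem Pbar_harmonic (g : Metric n M) (κ : ℝ) {h : VectorFields n M} (hh : IsHarmonicField g h) :
    Pbar g κ (toL2 g h) = toL2 g h := by
  have h1 : (harmonicL2 g).starProjection (toL2 g h) = toL2 g h :=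
    Submodule.starProjection_eq_self_iff.2 (toL2_mem_closure_span g hh)
  have h2 : (coclosedL2 g).starProjection (toL2 g h) = toL2 g h :=
    Submodule.starProjection_eq_self_iff.2 (toL2_mem_closure_span g fun x => by
      rw [codiffOne_flat, hh.closed_coclosed.2 x, neg_zero])
  unfold Pbar
  rw [add_apply, smul_apply, smul_apply, h1, h2, ← add_smul]
  simp

/-- `P̄_κ` annihilates gradients, which are orthogonal to the co-closed fields. -/
theorem Pbar_grad (g : Metric n M) (κ : ℝ) {f : M → ℝ} (hf : SmoothFun (n := n) f) :
    Pbar g κ (toL2 g (gradField g f hf)) = 0 := by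
  have h1 : (harmonicL2 g).starProjection (toL2 g (gradField g f hf)) = 0 := by
    refine (harmonicL2 g).starProjection_apply_eq_zero_iff.2 (mem_orthogonal_span g fun k hk => ?_)
    rw [integral_inner_gradField]
    simp [IsHarmonicField.closed_coclosed (show IsHarmonicField g k from hk) |>.2]
  have h2 : (coclosedL2 g).starProjection (toL2 g (gradField g f hf)) = 0 := by
    refine (coclosedL2 g).starProjection_apply_eq_zero_iff.2
      (mem_orthogonal_span g fun k hk => ?_)
    have h3 : ∀ x, divergence g k x = 0 := fun x => by
      have h4 := hk x
      rw [codiffOne_flat] at h4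
      linarith
    rw [integral_inner_gradField]
    simp [h3]
  unfold Pbar
  rw [add_apply, smul_apply, smul_apply, h1, h2]
  simp

/-- On co-exact fields `P̄_κ` is multiplication by `1 - κ`: they are co-closed and orthogonal to the
harmonic fields. -/
theorem Pbar_coexact (g : Metric n M) (κ : ℝ) {σ : OneForms n M}
    {w : Π x : M, TangentSpace (𝓡 n) x → TangentSpace (𝓡 n) x → ℝ} (hw : IsCodiffTwo g w σ)
    (hσ : ∀ x, divergence g (sharpField g σ) x = 0) :
    Pbar g κ (toL2 g (sharpField g σ)) = (1 - κ) • toL2 g (sharpField g σ) := by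
  have h1 : (harmonicL2 g).starProjection (toL2 g (sharpField g σ)) = 0 := by
    refine (harmonicL2 g).starProjection_apply_eq_zero_iff.2 (mem_orthogonal_span g fun k hk => ?_)
    have hk' : IsHarmonicField g k := hk
    have h2 := hw (flatForm g k)
    have h3 : ∀ x, twoFormInner g (dForm (flatForm g k)) w x = 0 := fun x =>
      twoFormInner_zero_left g _ _ (hk'.closed_coclosed.1 x)
    simp only [h3, integral_zero] at h2
    rw [inner_toL2, h2]
    congr 1
    ext x
    have h4 : sharp g (flatForm g k) x = k x := congrFun (sharp_flat g k) x
    rw [h4, sharpField_apply, inner_sharp]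
  have h2 : (coclosedL2 g).starProjection (toL2 g (sharpField g σ)) = toL2 g (sharpField g σ) :=
    Submodule.starProjection_eq_self_iff.2 (toL2_mem_closure_span g fun x => by
      rw [codiffOne_flat, hσ x, neg_zero])
  unfold Pbar
  rw [add_apply, smul_apply, smul_apply, h1, h2]
  simp

/-- `P̄_κ` is self-adjoint. -/
theorem inner_Pbar (g : Metric n M) (κ : ℝ) (a b : L2 g) :
    inner ℝ (Pbar g κ a) b = inner ℝ a (Pbar g κ b) := by
  unfold Pbar
  simp only [add_apply, smul_apply, inner_add_left, inner_add_right, inner_smul_left,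
    inner_smul_right, Submodule.inner_starProjection_left_eq_right]
  simp

/-- The codifferential of a two-form is co-closed, which is dual to `d² = 0`. -/
theorem IsCodiffTwo.coclosed {g : Metric n M} {σ : OneForms n M}
    {w : Π x : M, TangentSpace (𝓡 n) x → TangentSpace (𝓡 n) x → ℝ} (hw : IsCodiffTwo g w σ)
    (x : M) : divergence g (sharpField g σ) x = 0 := by
  set D : M → ℝ := divergence g (sharpField g σ) with hD
  have hDs : SmoothFun (n := n) D := smoothFun_divergence g _
  -- test the adjunction on `dD`, for `D` the divergence of `σ♯`: then `∫ D² = 0`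
  have h := hw (dForms g D hDs)
  have h0 : ∀ x, twoFormInner g (dForm (dForms g D hDs)) w x = 0 := by
    intro x
    refine twoFormInner_zero_left g _ _ fun p q => ?_
    have h1 : (dForms g D hDs : Π x : M, TangentSpace (𝓡 n) x →L[ℝ] ℝ) =
        fun y => dFun (n := n) D y := funext (dForms_apply g D hDs)
    rw [h1]
    exact dForm_dFun (hDs x) p q
  simp only [h0, integral_zero] at h
  have h2 := integral_dFun g hDs (sharpField g σ)
  have h3 : ∫ x, σ x (sharp g (dForms g D hDs) x) ∂(vol g) =
      ∫ x, dFun (n := n) D x (sharpField g σ x) ∂(vol g) := by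
    congr 1
    ext x
    rw [← inner_sharp g σ, g.symm, inner_sharp, dForms_apply, sharpField_apply]
  rw [← h3, ← h] at h2
  exact eq_zero_of_integral_mul_self g hDs.continuous (by linarith) x

/-- `𝒜` is the inertia operator of the inner product `⟨·,·⟩_{αβκ}`. -/
theorem innerABK_eq_pairing (g : Metric n M) {α β γ κ : ℝ} (hγ : 1 - γ = (1 - κ) ^ 2)
    {u : VectorFields n M} {m : OneForms n M} (hm : IsInertia g α β γ u m)
    (v : VectorFields n M) : innerABK g α β κ u v = pairing g m v := by
  obtain ⟨f, w, σ, τ, ⟨hf, -, hfL⟩, ⟨⟨η, hη⟩, hσ, hdσ⟩, hτ, hmx⟩ := hm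
  set G := gradField g f hf with hG
  set s := sharpField g σ with hs
  have hs0 : ∀ x, divergence g s x = 0 := hσ.coclosed
  -- `h` is the harmonic part of `u`, and `u = h - G - s` its Hodge decomposition
  set h : VectorFields n M := u + G + s with hh
  have hflat : flat g h = fun x => (flat g u x + dFun f x) + σ x := by
    ext1 x
    change g.inner x (u x + G x + s x) = _
    rw [map_add, map_add]
    have h1 : g.inner x (G x) = dFun f x := congrFun (flat_sharp g (dFun f)) x
    have h2 : g.inner x (s x) = σ x := congrFun (flat_sharp g σ) x
    rw [h1, h2]
    rfl
  have hu : ∀ x, FormDiffAt (flat g u) x := (flatForm g u).diffAt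
  have hdf : ∀ x, FormDiffAt (dFun (n := n) f) x := fun x => formDiffAt_dFun (hf x)
  have hclosed : ∀ x v w, dForm (flat g h) x v w = 0 := by
    intro x p q
    have hsum : FormDiffAt (fun x => flat g u x + dFun f x) x := fun V hV =>
      (hu x V hV).add (hdf x V hV)
    rw [hflat, dForm_add hsum (σ.diffAt x), dForm_add (hu x) (hdf x), dForm_dFun (hf x),
      ← hdσ x p q]
    ring
  have hdiv : ∀ x, divergence g h x = 0 := by
    intro x
    have h1 : (h : Π x : M, TangentSpace (𝓡 n) x) = (u + G : VectorFields n M) + s := rfl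
    have h2 : ((u + G : VectorFields n M) : Π x : M, TangentSpace (𝓡 n) x) = u + G := rfl
    rw [h1, divergence_add g ((u + G).diffAt x) (s.diffAt x), h2,
      divergence_add g (u.diffAt x) (G.diffAt x), hs0 x]
    have h3 := hfL x
    rw [codiffOne_flat] at h3
    unfold codiffOne at h3
    have h4 : divergence g G x = divergence g (sharp g (dFun f)) x := rfl
    rw [h4]
    linarith
  have hharm : IsHarmonicField g h := by
    intro c
    have h1 : ∀ x, twoFormInner g (dForm c) (dForm (flat g h)) x = 0 := fun x => by
      rw [twoFormInner_comm]
      exact twoFormInner_zero_left g _ _ (hclosed x)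
    have h2 : codiffOne g (flat g h) = fun _ => 0 := funext fun x => by
      rw [codiffOne_flat, hdiv x, neg_zero]
    simp only [h1, h2, dFun_const]
    simp
  have hL2 : toL2 g h = toL2 g u + toL2 g G + toL2 g s := by rw [hh, toL2_add, toL2_add]
  have hP : Pbar g κ (toL2 g u) = toL2 g h - (1 - κ) • toL2 g s := by
    have h1 : toL2 g u = toL2 g h - toL2 g G - toL2 g s := by rw [hL2]; abel
    rw [h1, map_sub, map_sub, Pbar_harmonic g κ hharm, Pbar_grad, Pbar_coexact g κ hσ hs0]
    abel
  -- `P̄_κ² u = h - (1 - κ)² s`, and `(1 - κ)² = 1 - γ`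
  have hPP : Pbar g κ (Pbar g κ (toL2 g u)) = toL2 g (u + G + γ • s) := by
    rw [hP, map_sub, map_smul, Pbar_harmonic g κ hharm, Pbar_coexact g κ hσ hs0, smul_smul,
      ← pow_two, ← hγ, hL2, toL2_add, toL2_add, toL2_smul, sub_smul, one_smul]
    abel
  have hfun : ∀ x, g.inner x ((u + G + γ • s) x) (v x) =
      flat g u x (v x) + dFun (n := n) f x (v x) + γ * σ x (v x) := by
    intro x
    change g.inner x (u x + G x + γ • s x) _ = _
    rw [map_add, map_add, map_smul]
    have h1 : g.inner x (G x) = dFun f x := congrFun (flat_sharp g (dFun f)) x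
    have h2 : g.inner x (s x) = σ x := congrFun (flat_sharp g σ) x
    rw [h1, h2]
    rfl
  -- the terms with `α` and `β`, integrated by parts
  have hα := hτ (flatForm g v)
  have hα2 : ∫ x, twoFormInner g (dForm (flat g u)) (dForm (flat g v)) x ∂(vol g) =
      ∫ x, τ x (v x) ∂(vol g) := by
    rw [show (fun x => τ x (v x)) = fun x => τ x (sharp g (flatForm g v) x) from funext fun x => by
      have h4 : sharp g (flatForm g v) x = v x := congrFun (sharp_flat g v) x
      rw [h4], ← hα]
    congr 1
    ext x
    rw [twoFormInner_comm]
    rfl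
  have hB := smoothFun_codiff g u
  have hβ : ∫ x, codiffOne g (flat g u) x * codiffOne g (flat g v) x ∂(vol g) =
      ∫ x, dFun (n := n) (codiffOne g (flat g u)) x (v x) ∂(vol g) := by
    rw [integral_dFun g hB v, ← integral_neg]
    congr 1
    ext x
    rw [codiffOne_flat g v]
    ring
  unfold innerABK pairing
  rw [hα2, hβ, ← inner_Pbar, hPP, inner_toL2]
  simp only [hmx, add_apply, smul_apply, smul_eq_mul]
  have i1 : Integrable (fun x => g.inner x ((u + G + γ • s) x) (v x)) (vol g) :=
    integrable_inner g _ _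
  have i2 := integrable_vol g (smoothFun_form τ v).continuous
  have i3 := integrable_vol g (smoothFun_dFun hB v).continuous
  simp only [hfun] at i1 ⊢
  have i12 : Integrable (fun x => flat g u x (v x) + dFun (n := n) f x (v x) + γ * σ x (v x)
      + α * τ x (v x)) (vol g) := i1.add (i2.const_mul α)
  rw [integral_add i12 (i3.const_mul β), integral_add i1 (i2.const_mul α),
    integral_const_mul, integral_const_mul]

end HodgeProjections

/-! ### Smooth families of functions -/

section Families

variable {n : ℕ} {M : Type*} [TopologicalSpace M] [ChartedSpace (EuclideanSpace ℝ (Fin n)) M]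
  [IsManifold (𝓡 n) ∞ M] {P : Type*} [NormedAddCommGroup P] [NormedSpace ℝ P]

/-- A smooth family of real functions on `M`, with parameters in the set `W`. -/
abbrev FunFamily (n : ℕ) {M : Type*} [TopologicalSpace M]
    [ChartedSpace (EuclideanSpace ℝ (Fin n)) M] (W : Set P) (F : P → M → ℝ) : Prop :=
  ContMDiffOn (𝓘(ℝ, P).prod (𝓡 n)) 𝓘(ℝ, ℝ) ∞ (fun q : P × M => F q.1 q.2) (W ×ˢ univ)

/-- The field `(e, X)` on the product of the parameter space with `M`. -/
theorem contMDiff_productField (e : P) (X : VectorFields n M) :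
    ContMDiff (𝓘(ℝ, P).prod (𝓡 n)) (𝓘(ℝ, P).prod (𝓡 n)).tangent ∞
      (fun q : P × M => (⟨q, (e, X q.2)⟩ : TangentBundle (𝓘(ℝ, P).prod (𝓡 n)) (P × M))) := by
  have h1 : ContMDiff 𝓘(ℝ, P) 𝓘(ℝ, P).tangent ∞
      (fun p : P => (⟨p, e⟩ : TangentBundle 𝓘(ℝ, P) P)) :=
    contMDiff_vectorSpace_iff_contDiff.2 contDiff_const
  have h2 : ContMDiff (𝓘(ℝ, P).prod (𝓡 n)) (𝓘(ℝ, P).tangent.prod (𝓡 n).tangent) ∞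
      (fun q : P × M => ((⟨q.1, e⟩ : TangentBundle 𝓘(ℝ, P) P),
        (⟨q.2, X q.2⟩ : TangentBundle (𝓡 n) M))) :=
    (h1.comp contMDiff_fst).prodMk (X.contMDiff.comp contMDiff_snd)
  exact contMDiff_equivTangentBundleProd_symm.comp h2

/-- The derivative of a smooth family of maps, in a parameter direction and along a vector field at
the same time, is smooth. -/
theorem contMDiffOn_tangent_family {E' H' M' : Type*} [NormedAddCommGroup E'] [NormedSpace ℝ E']
    [TopologicalSpace H'] {I' : ModelWithCorners ℝ E' H'} [TopologicalSpace M']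
    [ChartedSpace H' M'] [IsManifold I' ∞ M'] {W : Set P} (hW : IsOpen W) {F : P × M → M'}
    (hF : ContMDiffOn (𝓘(ℝ, P).prod (𝓡 n)) I' ∞ F (W ×ˢ univ)) (e : P) (X : VectorFields n M) :
    ContMDiffOn (𝓘(ℝ, P).prod (𝓡 n)) I'.tangent ∞
      (fun q : P × M => (⟨F q, mfderiv (𝓘(ℝ, P).prod (𝓡 n)) I' F q (e, X q.2)⟩ :
        TangentBundle I' M')) (W ×ˢ univ) := by
  have hO : IsOpen (W ×ˢ (univ : Set M)) := hW.prod isOpen_univ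
  have h1 := hF.contMDiffOn_tangentMapWithin (m := ∞) (by simp) hO.uniqueMDiffOn
  have h2 := h1.comp (contMDiff_productField (n := n) e X).contMDiffOn (s := W ×ˢ univ)
    (fun q hq => hq)
  refine h2.congr fun q hq => ?_
  simp only [Function.comp_apply, tangentMapWithin]
  rw [mfderivWithin_of_isOpen hO hq]

/-- The derivative of a family of functions in a parameter direction. -/
def paramDeriv (e : P) (F : P → M → ℝ) (p : P) (x : M) : ℝ := fderiv ℝ (fun p => F p x) p e

variable {W : Set P} {F G : P → M → ℝ}

theorem FunFamily.mdiffAt (hW : IsOpen W) (hF : FunFamily n W F) {p : P} (hp : p ∈ W) (x : M) :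
    MDifferentiableAt (𝓘(ℝ, P).prod (𝓡 n)) 𝓘(ℝ, ℝ) (fun q : P × M => F q.1 q.2) (p, x) :=
  (hF.contMDiffAt ((hW.prod isOpen_univ).mem_nhds ⟨hp, mem_univ x⟩)).mdifferentiableAt (by simp)

theorem FunFamily.smoothFun (hF : FunFamily n W F) {p : P} (hp : p ∈ W) :
    SmoothFun (n := n) (F p) := by
  have h : ContMDiff (𝓡 n) (𝓘(ℝ, P).prod (𝓡 n)) ∞ (fun x : M => (p, x)) :=
    contMDiff_const.prodMk contMDiff_id
  exact contMDiffOn_univ.1 (hF.comp h.contMDiffOn fun x _ => ⟨hp, mem_univ x⟩)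

theorem FunFamily.contDiffOn (hF : FunFamily n W F) (x : M) :
    ContDiffOn ℝ ∞ (fun p => F p x) W := by
  have h : ContMDiff 𝓘(ℝ, P) (𝓘(ℝ, P).prod (𝓡 n)) ∞ (fun p : P => (p, x)) :=
    contMDiff_id.prodMk contMDiff_const
  exact (hF.comp h.contMDiffOn fun p hp => ⟨hp, mem_univ x⟩).contDiffOn

theorem FunFamily.differentiableAt (hW : IsOpen W) (hF : FunFamily n W F) {p : P} (hp : p ∈ W)
    (x : M) : DifferentiableAt ℝ (fun p => F p x) p :=
  ((hF.contDiffOn x).contDiffAt (hW.mem_nhds hp)).differentiableAt (by simp)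

theorem FunFamily.mfderiv_eq (hW : IsOpen W) (hF : FunFamily n W F) {p : P} (hp : p ∈ W) (x : M)
    (e : P) (v : TangentSpace (𝓡 n) x) :
    mfderiv (𝓘(ℝ, P).prod (𝓡 n)) 𝓘(ℝ, ℝ) (fun q : P × M => F q.1 q.2) (p, x) (e, v) =
      paramDeriv e F p x + dFun (n := n) (F p) x v := by
  refine (mfderiv_prod_eq_add_apply (hF.mdiffAt hW hp x)).trans ?_
  simp only [mfderiv_eq_fderiv]
  rfl

theorem FunFamily.dFun (hW : IsOpen W) (hF : FunFamily n W F) (X : VectorFields n M) :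
    FunFamily n W (fun p x => EulerArnold.dFun (n := n) (F p) x (X x)) := by
  have h := (contMDiff_snd_tangentBundle_modelSpace ℝ 𝓘(ℝ, ℝ)).comp_contMDiffOn
    (contMDiffOn_tangent_family hW hF (0 : P) X)
  refine h.congr fun q hq => ?_
  refine Eq.trans ?_ (hF.mfderiv_eq hW hq.1 q.2 0 (X q.2)).symm
  simp [paramDeriv]

theorem FunFamily.paramDeriv (hW : IsOpen W) (hF : FunFamily n W F) (e : P) :
    FunFamily n W (EulerArnold.paramDeriv e F) := by
  have h := (contMDiff_snd_tangentBundle_modelSpace ℝ 𝓘(ℝ, ℝ)).comp_contMDiffOn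
    (contMDiffOn_tangent_family hW hF e (0 : VectorFields n M))
  refine h.congr fun q hq => ?_
  refine Eq.trans ?_ (hF.mfderiv_eq hW hq.1 q.2 e 0).symm
  simp

/-- Parameter derivatives commute with derivatives on `M`, by the symmetry of second derivatives in
a chart. -/
theorem FunFamily.dFun_paramDeriv (hW : IsOpen W) (hF : FunFamily n W F) (e : P)
    {p : P} (hp : p ∈ W) (x : M) (v : TangentSpace (𝓡 n) x) :
    EulerArnold.dFun (n := n) (EulerArnold.paramDeriv e F p) x v =
      fderiv ℝ (fun p => EulerArnold.dFun (n := n) (F p) x v) p e := by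
  set φ := extChartAt (𝓡 n) x with hφ
  set y₀ := φ x with hy₀
  set f : P × EuclideanSpace ℝ (Fin n) → ℝ := fun q => F q.1 (φ.symm q.2) with hf
  have hT : φ.target ∈ 𝓝 y₀ := extChartAt_target_mem_nhds x
  have hTo : IsOpen φ.target := isOpen_extChartAt_target x
  have hfs : ContDiffOn ℝ ∞ f (W ×ˢ φ.target) := by
    have h1 : ContMDiffOn 𝓘(ℝ, P × EuclideanSpace ℝ (Fin n)) (𝓘(ℝ, P).prod (𝓡 n)) ∞
        (fun q : P × EuclideanSpace ℝ (Fin n) => (q.1, φ.symm q.2)) (W ×ˢ φ.target) :=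
      contDiff_fst.contMDiff.contMDiffOn.prodMk ((contMDiffOn_extChartAt_symm x).comp
        contDiff_snd.contMDiff.contMDiffOn fun q hq => hq.2)
    exact (hF.comp h1 fun q hq => ⟨hq.1, mem_univ _⟩).contDiffOn
  have hO : IsOpen (W ×ˢ φ.target) := hW.prod hTo
  have hat : ∀ q ∈ W ×ˢ φ.target, ContDiffAt ℝ ∞ f q := fun q hq =>
    hfs.contDiffAt (hO.mem_nhds hq)
  have hq₀ : (p, y₀) ∈ W ×ˢ φ.target := ⟨hp, mem_of_mem_nhds hT⟩
  have hd : ∀ q ∈ W ×ˢ φ.target, HasFDerivAt f (fderiv ℝ f q) q := fun q hq =>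
    ((hat q hq).differentiableAt (by simp)).hasFDerivAt
  have hpart1 : ∀ q ∈ W ×ˢ φ.target, HasFDerivAt (fun p' => f (p', q.2))
      ((fderiv ℝ f q).comp (ContinuousLinearMap.inl ℝ P (EuclideanSpace ℝ (Fin n)))) q.1 := by
    intro q hq
    exact HasFDerivAt.comp (g := f) (f := fun p' => (p', q.2)) q.1 (hd q hq)
      (hasFDerivAt_prodMk_left q.1 q.2)
  have hpart2 : ∀ q ∈ W ×ˢ φ.target, HasFDerivAt (fun y => f (q.1, y))
      ((fderiv ℝ f q).comp (ContinuousLinearMap.inr ℝ P (EuclideanSpace ℝ (Fin n)))) q.2 := by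
    intro q hq
    exact HasFDerivAt.comp (g := f) (f := fun y => (q.1, y)) q.2 (hd q hq)
      (hasFDerivAt_prodMk_right q.1 q.2)
  have hdd : HasFDerivAt (fderiv ℝ f) (fderiv ℝ (fderiv ℝ f) (p, y₀)) (p, y₀) :=
    (((hat _ hq₀).fderiv_right (m := ∞) (by simp)).differentiableAt (by simp)).hasFDerivAt
  have hsymm : IsSymmSndFDerivAt ℝ f (p, y₀) :=
    (hat _ hq₀).isSymmSndFDerivAt (by simpa using! two_le_infty)
  -- the derivative on `M` of the parameter derivative, in the chart
  have hL : EulerArnold.dFun (n := n) (EulerArnold.paramDeriv e F p) x v =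
      fderiv ℝ (fderiv ℝ f) (p, y₀) (0, v) (e, 0) := by
    have hs := (hF.paramDeriv hW e).smoothFun hp x
    refine (dFun_eq_fderiv (FunSmoothAt.diffAt hs) v).trans ?_
    have h1 : (EulerArnold.paramDeriv e F p) ∘ φ.symm =ᶠ[𝓝 y₀]
        fun y => fderiv ℝ f (p, y) (e, 0) := by
      filter_upwards [hT] with y hy
      have h2 := (hpart1 (p, y) ⟨hp, hy⟩).fderiv
      change fderiv ℝ (fun p' => f (p', y)) p e = _
      rw [h2]
      rfl
    have h3 : HasFDerivAt (fun y => fderiv ℝ f (p, y) (e, 0))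
        ((ContinuousLinearMap.apply ℝ ℝ ((e, 0) : P × EuclideanSpace ℝ (Fin n))).comp
          ((fderiv ℝ (fderiv ℝ f) (p, y₀)).comp
            (ContinuousLinearMap.inr ℝ P (EuclideanSpace ℝ (Fin n))))) y₀ :=
      (ContinuousLinearMap.apply ℝ ℝ ((e, 0) : P × EuclideanSpace ℝ (Fin n))).hasFDerivAt.comp y₀
        (hdd.comp y₀ (hasFDerivAt_prodMk_right p y₀))
    rw [h1.fderiv_eq, h3.fderiv]
    rfl
  have hR : fderiv ℝ (fun p => EulerArnold.dFun (n := n) (F p) x v) p e =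
      fderiv ℝ (fderiv ℝ f) (p, y₀) (e, 0) (0, v) := by
    have h1 : (fun p => EulerArnold.dFun (n := n) (F p) x v) =ᶠ[𝓝 p]
        fun p' => fderiv ℝ f (p', y₀) (0, v) := by
      filter_upwards [hW.mem_nhds hp] with p' hp'
      refine (dFun_eq_fderiv (FunSmoothAt.diffAt (hF.smoothFun hp' x)) v).trans ?_
      have h2 := (hpart2 (p', y₀) ⟨hp', hq₀.2⟩).fderiv
      change fderiv ℝ (fun y => f (p', y)) y₀ v = _
      rw [h2]
      rfl
    let v' : EuclideanSpace ℝ (Fin n) := v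
    have h3 : HasFDerivAt (fun p' => fderiv ℝ f (p', y₀) (0, v'))
        ((ContinuousLinearMap.apply ℝ ℝ ((0, v') : P × EuclideanSpace ℝ (Fin n))).comp
          ((fderiv ℝ (fderiv ℝ f) (p, y₀)).comp
            (ContinuousLinearMap.inl ℝ P (EuclideanSpace ℝ (Fin n))))) p :=
      (ContinuousLinearMap.apply ℝ ℝ ((0, v') : P × EuclideanSpace ℝ (Fin n))).hasFDerivAt.comp p
        (hdd.comp p (hasFDerivAt_prodMk_left p y₀))
    have h4 : fderiv ℝ (fun p' => fderiv ℝ f (p', y₀) (0, v')) p e =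
        fderiv ℝ (fderiv ℝ f) (p, y₀) (e, 0) (0, v') := by
      rw [h3.fderiv]
      rfl
    rw [h1.fderiv_eq]
    exact h4
  rw [hL, hR]
  exact hsymm.eq _ _

end Families

/-! ### Families under the integral and families of fields -/

/-- A derivative at a point of the line `s ↦ p + s • e` is a derivative in the direction `e`. -/
theorem hasDerivAt_of_hasLineDerivAt {P E : Type*} [AddCommGroup P] [Module ℝ P]
    [NormedAddCommGroup E] [NormedSpace ℝ E] {f : P → E} {d : E} {p e : P} {r : ℝ}
    (h : HasLineDerivAt ℝ f d (p + r • e) e) : HasDerivAt (fun s : ℝ => f (p + s • e)) d r := by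
  have h2 : HasDerivAt (fun s : ℝ => f (p + r • e + s • e)) d (r - r) := by
    rw [sub_self]
    exact h
  have h3 := h2.scomp (h := fun s : ℝ => s - r) r ((hasDerivAt_id' r).sub_const r)
  simp only [one_smul] at h3
  refine h3.congr_of_eventuallyEq (Eventually.of_forall fun s => ?_)
  simp only [Function.comp_apply]
  rw [add_assoc, ← add_smul, add_sub_cancel]

section FunFamilies

variable {n : ℕ} {M : Type*} [TopologicalSpace M] [ChartedSpace (EuclideanSpace ℝ (Fin n)) M]
  [IsManifold (𝓡 n) ∞ M] {P : Type*} [NormedAddCommGroup P] [NormedSpace ℝ P]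
  {W : Set P} {F G : P → M → ℝ}

theorem FunFamily.hasLineDerivAt (hW : IsOpen W) (hF : FunFamily n W F) {p : P} (hp : p ∈ W)
    (x : M) (e : P) : HasLineDerivAt ℝ (fun p => F p x) (EulerArnold.paramDeriv e F p x) p e :=
  (hF.differentiableAt hW hp x).hasFDerivAt.hasLineDerivAt e

theorem FunFamily.paramDeriv_eq (hW : IsOpen W) (hF : FunFamily n W F) {p : P} (hp : p ∈ W)
    {x : M} {e : P} {d : ℝ} (h : HasLineDerivAt ℝ (fun p => F p x) d p e) :
    EulerArnold.paramDeriv e F p x = d :=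
  (hF.hasLineDerivAt hW hp x e).unique h

theorem FunFamily.hasLineDerivAt_dFun (hW : IsOpen W) (hF : FunFamily n W F) {p : P} (hp : p ∈ W)
    (X : VectorFields n M) (x : M) (e : P) :
    HasLineDerivAt ℝ (fun p => EulerArnold.dFun (n := n) (F p) x (X x))
      (EulerArnold.dFun (n := n) (EulerArnold.paramDeriv e F p) x (X x)) p e := by
  rw [hF.dFun_paramDeriv hW e hp x]
  exact (hF.dFun hW X).hasLineDerivAt hW hp x e

theorem FunFamily.const {f : M → ℝ} (hf : SmoothFun (n := n) f) :
    FunFamily n W (fun _ x => f x) :=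
  (hf.comp contMDiff_snd).contMDiffOn

theorem FunFamily.add (hF : FunFamily n W F) (hG : FunFamily n W G) :
    FunFamily n W (fun p x => F p x + G p x) := ContMDiffOn.add hF hG

theorem FunFamily.sub (hF : FunFamily n W F) (hG : FunFamily n W G) :
    FunFamily n W (fun p x => F p x - G p x) := ContMDiffOn.sub hF hG

theorem FunFamily.mul (hF : FunFamily n W F) (hG : FunFamily n W G) :
    FunFamily n W (fun p x => F p x * G p x) := ContMDiffOn.mul hF hG

theorem FunFamily.sum {ι : Type*} (s : Finset ι) {F : ι → P → M → ℝ}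
    (hF : ∀ i ∈ s, FunFamily n W (F i)) : FunFamily n W (fun p x => ∑ i ∈ s, F i p x) := by
  intro q hq
  exact ContMDiffWithinAt.sum fun i hi => hF i hi q hq

theorem FunFamily.continuousAt (hW : IsOpen W) (hF : FunFamily n W F) {p : P} (hp : p ∈ W)
    (x : M) : ContinuousAt (fun p => F p x) p :=
  (hF.differentiableAt hW hp x).continuousAt

variable [CompactSpace M]

/-- A smooth family of functions is bounded, locally uniformly in the parameter. -/
theorem FunFamily.exists_bound (hW : IsOpen W) (hF : FunFamily n W F) {p : P} (hp : p ∈ W) :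
    ∃ C : ℝ, ∀ᶠ p' in 𝓝 p, p' ∈ W ∧ ∀ x, ‖F p' x‖ ≤ C := by
  have hc : Continuous (F p) := (hF.smoothFun hp).continuous
  obtain ⟨C, hC⟩ := (isCompact_univ (X := M)).exists_bound_of_continuousOn hc.continuousOn
  have hO : IsOpen (W ×ˢ (univ : Set M)) := hW.prod isOpen_univ
  have h1 : IsOpen ((W ×ˢ (univ : Set M)) ∩
      (fun q : P × M => F q.1 q.2) ⁻¹' Metric.ball 0 (C + 1)) :=
    hF.continuousOn.isOpen_inter_preimage hO Metric.isOpen_ball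
  obtain ⟨U, V, hU, -, hpU, hV, hUV⟩ := generalized_tube_lemma (isCompact_singleton (x := p))
    (isCompact_univ (X := M)) h1 (by
      rintro ⟨p', x⟩ ⟨hp', -⟩
      rw [mem_singleton_iff] at hp'
      subst hp'
      refine ⟨⟨hp, mem_univ x⟩, ?_⟩
      simp only [mem_preimage, mem_ball_zero_iff]
      exact (hC x (mem_univ x)).trans_lt (by linarith))
  refine ⟨C + 1, ?_⟩
  filter_upwards [hU.mem_nhds (hpU rfl), hW.mem_nhds hp] with p' hp' hpW
  refine ⟨hpW, fun x => ?_⟩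
  have h2 := (hUV (show (p', x) ∈ U ×ˢ V from ⟨hp', hV (mem_univ x)⟩)).2
  simp only [mem_preimage, mem_ball_zero_iff] at h2
  exact h2.le

variable [T2Space M] [MeasurableSpace M] [BorelSpace M]

theorem FunFamily.integrable (g : Metric n M) (hF : FunFamily n W F) {p : P} (hp : p ∈ W) :
    Integrable (F p) (vol g) := integrable_vol g (hF.smoothFun hp).continuous

theorem FunFamily.continuousOn_integral (g : Metric n M) (hW : IsOpen W) (hF : FunFamily n W F) :
    ContinuousOn (fun p => ∫ x, F p x ∂(vol g)) W := by
  intro p hp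
  obtain ⟨C, hC⟩ := hF.exists_bound hW hp
  refine ContinuousAt.continuousWithinAt (continuousAt_of_dominated (bound := fun _ => C) ?_ ?_
    (integrable_const C) (ae_of_all _ fun x => hF.continuousAt hW hp x))
  · filter_upwards [hC] with p' hp'
    exact (hF.integrable g hp'.1).aestronglyMeasurable
  · filter_upwards [hC] with p' hp'
    exact ae_of_all _ hp'.2

/-- Differentiation under the integral sign. -/
theorem FunFamily.hasLineDerivAt_integral (g : Metric n M) (hW : IsOpen W) (hF : FunFamily n W F)
    {p : P} (hp : p ∈ W) (e : P) :
    HasLineDerivAt ℝ (fun p => ∫ x, F p x ∂(vol g))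
      (∫ x, EulerArnold.paramDeriv e F p x ∂(vol g)) p e := by
  obtain ⟨C, hC⟩ := (hF.paramDeriv hW e).exists_bound hW hp
  have hcont : ContinuousAt (fun r : ℝ => p + r • e) 0 := by fun_prop
  have h0 : p + (0 : ℝ) • e = p := by simp
  have hC' : {r : ℝ | p + r • e ∈ W ∧ ∀ x, ‖EulerArnold.paramDeriv e F (p + r • e) x‖ ≤ C} ∈
      𝓝 (0 : ℝ) := by
    rw [← h0] at hC
    exact hcont.eventually hC
  have hm : ∀ᶠ r : ℝ in 𝓝 0, AEStronglyMeasurable (F (p + r • e)) (vol g) := by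
    filter_upwards [hC'] with r hr
    exact (hF.integrable g hr.1).aestronglyMeasurable
  have h := hasDerivAt_integral_of_dominated_loc_of_deriv_le (μ := vol g) (x₀ := (0 : ℝ))
    (F := fun r x => F (p + r • e) x) (F' := fun r x => EulerArnold.paramDeriv e F (p + r • e) x)
    (bound := fun _ => C) hC' hm (by simpa using hF.integrable g hp)
    (by simpa using ((hF.paramDeriv hW e).integrable g hp).aestronglyMeasurable)
    (ae_of_all _ fun x r hr => hr.2 x) (integrable_const C)
    (ae_of_all _ fun x r hr => ?_)
  · have h2 := h.2
    simp only [h0] at h2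
    exact h2
  · exact hasDerivAt_of_hasLineDerivAt (hF.hasLineDerivAt hW hr.1 x e)

end FunFamilies

section FieldFamilies

variable {n : ℕ} {M : Type*} [TopologicalSpace M] [ChartedSpace (EuclideanSpace ℝ (Fin n)) M]
  [IsManifold (𝓡 n) ∞ M] [CompactSpace M] [T2Space M] [MeasurableSpace M] [BorelSpace M]
  {P : Type*} [NormedAddCommGroup P] [NormedSpace ℝ P]
  {g : Metric n M} {W : Set P} {u v : P → VectorFields n M}

/-- A smooth family of vector fields with parameters in `W`: the inner products with the fixed
smooth fields are smooth functions on `W × M`. By means of a global frame this is the usual notion.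
-/
def FieldFamily (g : Metric n M) (W : Set P) (u : P → VectorFields n M) : Prop :=
  ∀ v : VectorFields n M, FunFamily n W (fun p x => g.inner x (v x) (u p x))

theorem FieldFamily.of_contMDiffOn (g : Metric n M) (hu : ContMDiffOn (𝓘(ℝ, P).prod (𝓡 n))
    (𝓡 n).tangent ∞ (fun q : P × M => (⟨q.2, u q.1 q.2⟩ : TangentBundle (𝓡 n) M))
    (W ×ˢ univ)) : FieldFamily g W u := by
  intro v
  let _ : RiemannianBundle (fun x : M => TangentSpace (𝓡 n) x) := ⟨g.toRiemannianMetric⟩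
  have hv : ContMDiffOn (𝓘(ℝ, P).prod (𝓡 n)) (𝓡 n).tangent ∞
      (fun q : P × M => (⟨q.2, v q.2⟩ : TangentBundle (𝓡 n) M)) (W ×ˢ univ) :=
    (v.contMDiff.comp contMDiff_snd).contMDiffOn
  exact ContMDiffOn.inner_bundle (b := fun q : P × M => q.2) (v := fun q => v q.2)
    (w := fun q => u q.1 q.2) hv hu

theorem FieldFamily.const (v : VectorFields n M) : FieldFamily g W (fun _ => v) := fun w =>
  FunFamily.const (smoothFun_inner g w v)

theorem FieldFamily.inner (hu : FieldFamily g W u) (hv : FieldFamily g W v) :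
    FunFamily n W (fun p x => g.inner x (u p x) (v p x)) := by
  have h : (fun p x => g.inner x (u p x) (v p x)) = fun p x => ∑ a,
      g.inner x ((frame g).Y a x) (u p x) * g.inner x ((frame g).X a x) (v p x) := by
    ext p x
    conv_lhs => rw [← frame_sum_inner (frame g) (u p x)]
    simp only [map_sum, map_smul, sum_apply, smul_apply, smul_eq_mul]
  rw [h]
  exact FunFamily.sum _ fun a _ => ContMDiffOn.mul (hu _) (hv _)

/-- A vector of `T_x M`, as a vector of the model space. It serves to differentiate curves in
`T_x M`, which has no norm of its own. -/
def toModel {x : M} (v : TangentSpace (𝓡 n) x) : EuclideanSpace ℝ (Fin n) := v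

theorem FieldFamily.differentiableAt (hW : IsOpen W) (hu : FieldFamily g W u) {p : P}
    (hp : p ∈ W) (x : M) : DifferentiableAt ℝ (fun p => toModel (u p x)) p := by
  have h : (fun p => toModel (u p x)) = fun p => ∑ a,
      g.inner x ((frame g).Y a x) (u p x) • toModel ((frame g).X a x) := by
    ext1 p
    exact (frame_sum_inner (frame g) (u p x)).symm
  rw [h]
  exact DifferentiableAt.fun_sum fun a _ =>
    ((hu _).differentiableAt hW hp x).smul_const _

/-- The derivative of a family of fields in a parameter direction. -/
def fieldDeriv (e : P) (u : P → VectorFields n M) (p : P) : VectorFields n M :=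
  toField fun x => fderiv ℝ (fun p => toModel (u p x)) p e

theorem fderiv_inner_toModel (hW : IsOpen W) (hu : FieldFamily g W u) {p : P} (hp : p ∈ W)
    (x : M) (e : P) (w : TangentSpace (𝓡 n) x) :
    fderiv ℝ (fun p => g.inner x w (u p x)) p e =
      g.inner x w (fderiv ℝ (fun p => toModel (u p x)) p e) := by
  have h := (hu.differentiableAt hW hp x).hasFDerivAt
  let L : EuclideanSpace ℝ (Fin n) →L[ℝ] ℝ := g.inner x w
  have h2 : HasFDerivAt (fun p => g.inner x w (u p x))
    (L.comp (fderiv ℝ (fun p => toModel (u p x)) p)) p := L.hasFDerivAt.comp p h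
  rw [h2.fderiv]
  rfl

/-- The pointwise derivative of a smooth family is a smooth field, so that `toField` in the
definition of `fieldDeriv` does not take its default value. -/
theorem fieldDeriv_apply (hW : IsOpen W) (hu : FieldFamily g W u) {p : P} (hp : p ∈ W)
    (x : M) (e : P) : fieldDeriv e u p x = fderiv ℝ (fun p => toModel (u p x)) p e := by
  refine toField_apply (contMDiff_of_inner g fun v => ?_) x
  have h := ((hu v).paramDeriv hW e).smoothFun hp
  have h2 : (fun x => g.inner x (v x) (fderiv ℝ (fun p => toModel (u p x)) p e)) =
      EulerArnold.paramDeriv e (fun p x => g.inner x (v x) (u p x)) p :=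
    funext fun x => (fderiv_inner_toModel hW hu hp x e (v x)).symm
  exact h2 ▸ h

theorem inner_fieldDeriv (hW : IsOpen W) (hu : FieldFamily g W u) {p : P} (hp : p ∈ W)
    (x : M) (e : P) (w : TangentSpace (𝓡 n) x) :
    HasLineDerivAt ℝ (fun p => g.inner x w (u p x)) (g.inner x w (fieldDeriv e u p x)) p e := by
  rw [fieldDeriv_apply hW hu hp]
  rw [← fderiv_inner_toModel hW hu hp]
  have h := (hu.differentiableAt hW hp x)
  let L : EuclideanSpace ℝ (Fin n) →L[ℝ] ℝ := g.inner x w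
  have h2 : DifferentiableAt ℝ (fun p => g.inner x w (u p x)) p :=
    L.differentiableAt.comp p h
  exact h2.hasFDerivAt.hasLineDerivAt e

theorem paramDeriv_inner (hW : IsOpen W) (hu : FieldFamily g W u) {p : P} (hp : p ∈ W)
    (x : M) (e : P) (w : VectorFields n M) :
    EulerArnold.paramDeriv e (fun p x => g.inner x (w x) (u p x)) p x =
      g.inner x (w x) (fieldDeriv e u p x) :=
  (hu w).paramDeriv_eq hW hp (inner_fieldDeriv hW hu hp x e (w x))

theorem FieldFamily.deriv (hW : IsOpen W) (hu : FieldFamily g W u) (e : P) :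
    FieldFamily g W (fieldDeriv e u) := by
  intro v
  refine ((hu v).paramDeriv hW e).congr fun q hq => ?_
  exact (paramDeriv_inner hW hu hq.1 q.2 e v).symm

end FieldFamilies

/-! ### The derivative of the inner product along families -/

section WeakDerivative

/-- A curve in an inner product space that is weakly differentiable with a continuous weak
derivative is differentiable; it is enough to test on a subspace that contains the curve. -/
theorem hasDerivAt_of_weak {H : Type*} [NormedAddCommGroup H] [InnerProductSpace ℝ H]
    (S : Submodule ℝ H) {U U' : ℝ → H} {r₀ : ℝ} (hU : ∀ᶠ r in 𝓝 r₀, U r ∈ S) (hU' : U' r₀ ∈ S)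
    (hc : ContinuousAt U' r₀)
    (hw : ∀ᶠ r in 𝓝 r₀, ∀ w ∈ S, HasDerivAt (fun r => inner ℝ (U r) w) (inner ℝ (U' r) w) r) :
    HasDerivAt U (U' r₀) r₀ := by
  rw [hasDerivAt_iff_isLittleO, Asymptotics.isLittleO_iff]
  intro ε hε
  have h1 : ∀ᶠ r in 𝓝 r₀, ‖U' r - U' r₀‖ ≤ ε := by
    have h2 := Metric.continuousAt_iff'.1 hc ε hε
    filter_upwards [h2] with r hr
    rw [← dist_eq_norm]
    exact hr.le
  obtain ⟨δ, hδ, hball⟩ := Metric.eventually_nhds_iff_ball.1 (hU.and (h1.and hw))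
  filter_upwards [Metric.ball_mem_nhds r₀ hδ] with r hr
  have hr0 : r₀ ∈ Metric.ball r₀ δ := Metric.mem_ball_self hδ
  -- test on the remainder itself
  set w : H := U r - U r₀ - (r - r₀) • U' r₀ with hwdef
  have hwS : w ∈ S := S.sub_mem (S.sub_mem (hball r hr).1 (hball r₀ hr0).1) (S.smul_mem _ hU')
  have h2 := (convex_ball r₀ δ).norm_image_sub_le_of_norm_hasDerivWithin_le
    (f := fun s => inner ℝ (U s) w - s * inner ℝ (U' r₀) w)
    (f' := fun s => inner ℝ (U' s) w - 1 * inner ℝ (U' r₀) w) (C := ε * ‖w‖)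
    (fun s hs => (((hball s hs).2.2 w hwS).sub
      ((hasDerivAt_id' s).mul_const _)).hasDerivWithinAt)
    (fun s hs => by
      rw [one_mul, ← inner_sub_left]
      exact (norm_inner_le_norm _ _).trans
        (mul_le_mul_of_nonneg_right (hball s hs).2.1 (norm_nonneg _)))
    hr0 hr
  have h3 : inner ℝ (U r) w - r * inner ℝ (U' r₀) w -
      (inner ℝ (U r₀) w - r₀ * inner ℝ (U' r₀) w) = ‖w‖ * ‖w‖ := by
    rw [← real_inner_self_eq_norm_mul_norm]
    conv_rhs => rw [hwdef, inner_sub_left, inner_sub_left, inner_smul_left]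
    simp only [conj_trivial]
    ring
  rw [h3, Real.norm_of_nonneg (mul_self_nonneg _)] at h2
  rcases eq_or_lt_of_le (norm_nonneg w) with h0 | h0
  · rw [← h0]
    positivity
  · have : ‖w‖ * ‖w‖ ≤ (ε * ‖r - r₀‖) * ‖w‖ := by linarith
    exact le_of_mul_le_mul_right this h0

end WeakDerivative

section InnerFamilies

variable {n : ℕ} {M : Type*} [TopologicalSpace M] [ChartedSpace (EuclideanSpace ℝ (Fin n)) M]
  [IsManifold (𝓡 n) ∞ M] [CompactSpace M] [T2Space M] [MeasurableSpace M] [BorelSpace M]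
  {P : Type*} [NormedAddCommGroup P] [NormedSpace ℝ P]
  {g : Metric n M} {W : Set P} {u v : P → VectorFields n M}

/-- The divergence in a global frame: it involves the field only through its components
`g(Y_a, u)`, which are smooth families of functions if `u` is one of fields. -/
theorem divergence_frame (F : GlobalFrame g) (u : VectorFields n M) (x : M) :
    divergence g u x = ∑ a, (dFun (n := n) (fun y => g.inner y (F.Y a y) (u y)) x (F.X a x)
      + g.inner x (F.Y a x) (u x) * divergence g (F.X a) x) := by
  have h1 : (u : Π x : M, TangentSpace (𝓡 n) x) =
      ∑ a, (fun y => g.inner y (F.Y a y) (u y)) • (F.X a : Π x : M, TangentSpace (𝓡 n) x) := by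
    ext1 x
    rw [Finset.sum_apply]
    exact (F.dual x (u x)).symm
  have hs : ∀ a, FunDiffAt (n := n) (fun y => g.inner y (F.Y a y) (u y)) x := fun a =>
    FunSmoothAt.diffAt (smoothFun_inner g _ u x)
  conv_lhs => rw [h1]
  refine (divergence_sum g fun a _ =>
    (funSmul _ (smoothFun_inner g (F.Y a) u) (F.X a)).diffAt x).trans ?_
  exact Finset.sum_congr rfl fun a _ => divergence_smul g (hs a) ((F.X a).diffAt x)

/-- `du♭(X, Y)` through inner products of `u` with fixed fields. -/
theorem dForm_flat_eq (u X Y : VectorFields n M) (x : M) :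
    dForm (flat g u) x (X x) (Y x) =
      dFun (n := n) (fun y => g.inner y (Y y) (u y)) x (X x)
        - dFun (n := n) (fun y => g.inner y (X y) (u y)) x (Y x)
        - g.inner x (bracket X Y x) (u x) := by
  refine (dForm_eq (a := flat g u) ((flatForm g u).diffAt x) (X.diffAt x) (Y.diffAt x)).trans ?_
  unfold extDerivFields
  have h : ∀ Z : VectorFields n M, (fun y => flat g u y (Z y)) = fun y => g.inner y (Z y) (u y) :=
    fun Z => funext fun y => g.symm y _ _
  rw [h X, h Y, bracket_apply, g.symm x (mlieBracket (𝓡 n) X Y x) (u x)]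
  rfl

theorem FieldFamily.divergence (hW : IsOpen W) (hu : FieldFamily g W u) :
    FunFamily n W (fun p x => EulerArnold.divergence g (u p) x) := by
  have h : (fun p x => EulerArnold.divergence g (u p) x) = fun p x => ∑ a,
      (dFun (n := n) (fun y => g.inner y ((frame g).Y a y) (u p y)) x ((frame g).X a x)
      + g.inner x ((frame g).Y a x) (u p x) * EulerArnold.divergence g ((frame g).X a) x) := by
    ext p x
    exact divergence_frame (frame g) (u p) x
  rw [h]
  exact FunFamily.sum _ fun a _ => ((hu _).dFun hW _).add
    ((hu _).mul (FunFamily.const (smoothFun_divergence g _)))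

theorem hasLineDerivAt_dFun_inner (hW : IsOpen W) (hu : FieldFamily g W u) {p : P} (hp : p ∈ W)
    (X Y : VectorFields n M) (x : M) (e : P) :
    HasLineDerivAt ℝ (fun p => dFun (n := n) (fun y => g.inner y (Y y) (u p y)) x (X x))
      (dFun (n := n) (fun y => g.inner y (Y y) (fieldDeriv e u p y)) x (X x)) p e := by
  have h := (hu Y).hasLineDerivAt_dFun hW hp X x e
  have h2 : paramDeriv e (fun p x => g.inner x (Y x) (u p x)) p =
      fun y => g.inner y (Y y) (fieldDeriv e u p y) :=
    funext fun y => paramDeriv_inner hW hu hp y e Y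
  rwa [h2] at h

theorem hasLineDerivAt_divergence (hW : IsOpen W) (hu : FieldFamily g W u) {p : P} (hp : p ∈ W)
    (x : M) (e : P) : HasLineDerivAt ℝ (fun p => divergence g (u p) x)
      (divergence g (fieldDeriv e u p) x) p e := by
  have h : (fun p => divergence g (u p) x) = fun p => ∑ a,
      (dFun (n := n) (fun y => g.inner y ((frame g).Y a y) (u p y)) x ((frame g).X a x)
      + g.inner x ((frame g).Y a x) (u p x) * divergence g ((frame g).X a) x) :=
    funext fun p => divergence_frame (frame g) (u p) x
  rw [h, divergence_frame (frame g) (fieldDeriv e u p) x]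
  refine HasDerivAt.fun_sum fun a _ => ?_
  exact HasDerivAt.add (hasLineDerivAt_dFun_inner hW hu hp _ _ x e)
    (HasDerivAt.mul_const (inner_fieldDeriv hW hu hp x e _) _)

theorem FieldFamily.dForm (hW : IsOpen W) (hu : FieldFamily g W u) (X Y : VectorFields n M) :
    FunFamily n W (fun p x => EulerArnold.dForm (flat g (u p)) x (X x) (Y x)) := by
  simp only [dForm_flat_eq]
  exact (((hu Y).dFun hW X).sub ((hu X).dFun hW Y)).sub (hu _)

theorem hasLineDerivAt_dForm (hW : IsOpen W) (hu : FieldFamily g W u) {p : P} (hp : p ∈ W)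
    (X Y : VectorFields n M) (x : M) (e : P) :
    HasLineDerivAt ℝ (fun p => dForm (flat g (u p)) x (X x) (Y x))
      (dForm (flat g (fieldDeriv e u p)) x (X x) (Y x)) p e := by
  simp only [dForm_flat_eq]
  exact HasDerivAt.sub (HasDerivAt.sub (hasLineDerivAt_dFun_inner hW hu hp X Y x e)
    (hasLineDerivAt_dFun_inner hW hu hp Y X x e)) (inner_fieldDeriv hW hu hp x e _)

theorem twoFormInner_flat_frame (u v : VectorFields n M) (x : M) :
    twoFormInner g (dForm (flat g u)) (dForm (flat g v)) x = (1 / 2) * ∑ i, ∑ j,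
      dForm (flat g u) x ((frame g).X i x) ((frame g).X j x) *
        dForm (flat g v) x ((frame g).Y i x) ((frame g).Y j x) :=
  twoFormInner_frame (frame g) (flat g u) (flat g v) ((flatForm g u).diffAt x)
    ((flatForm g v).diffAt x)

theorem FieldFamily.twoFormInner (hW : IsOpen W) (hu : FieldFamily g W u)
    (hv : FieldFamily g W v) : FunFamily n W (fun p x =>
      EulerArnold.twoFormInner g (EulerArnold.dForm (flat g (u p)))
        (EulerArnold.dForm (flat g (v p))) x) := by
  simp only [twoFormInner_flat_frame]
  exact (FunFamily.const contMDiff_const).mul (FunFamily.sum _ fun i _ => FunFamily.sum _ fun j _ =>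
    (hu.dForm hW _ _).mul (hv.dForm hW _ _))

theorem hasLineDerivAt_twoFormInner (hW : IsOpen W) (hu : FieldFamily g W u)
    (hv : FieldFamily g W v) {p : P} (hp : p ∈ W) (x : M) (e : P) :
    HasLineDerivAt ℝ (fun p => twoFormInner g (dForm (flat g (u p))) (dForm (flat g (v p))) x)
      (twoFormInner g (dForm (flat g (fieldDeriv e u p))) (dForm (flat g (v p))) x +
        twoFormInner g (dForm (flat g (u p))) (dForm (flat g (fieldDeriv e v p))) x) p e := by
  simp only [twoFormInner_flat_frame]
  rw [← mul_add, ← Finset.sum_add_distrib]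
  simp only [← Finset.sum_add_distrib]
  refine HasDerivAt.const_mul _ (HasDerivAt.fun_sum fun i _ => HasDerivAt.fun_sum fun j _ => ?_)
  have h := HasDerivAt.mul (hasLineDerivAt_dForm hW hu hp ((frame g).X i) ((frame g).X j) x e)
    (hasLineDerivAt_dForm hW hv hp ((frame g).Y i) ((frame g).Y j) x e)
  simp only [zero_smul, add_zero] at h
  exact h

theorem innerABK_eq (g : Metric n M) (α β κ : ℝ) (u v : VectorFields n M) :
    innerABK g α β κ u v = inner ℝ (Pbar g κ (toL2 g u)) (Pbar g κ (toL2 g v))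
      + α * ∫ x, twoFormInner g (dForm (flat g u)) (dForm (flat g v)) x ∂(vol g)
      + β * ∫ x, divergence g u x * divergence g v x ∂(vol g) := by
  unfold innerABK
  simp only [codiffOne_flat, neg_mul_neg]

/-- The inclusion of the smooth fields into `L²` as a linear map. -/
def toL2Linear (g : Metric n M) : VectorFields n M →ₗ[ℝ] L2 g where
  toFun := toL2 g
  map_add' := toL2_add g
  map_smul' := toL2_smul g

theorem FieldFamily.continuousOn_toL2 (hW : IsOpen W) (hu : FieldFamily g W u) :
    ContinuousOn (fun p => toL2 g (u p)) W := by
  intro p hp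
  refine ContinuousAt.continuousWithinAt ?_
  have h1 := (((hu.inner hu).continuousOn_integral g hW).continuousAt (hW.mem_nhds hp))
  have h2 := (((hu (u p)).continuousOn_integral g hW).continuousAt (hW.mem_nhds hp))
  have hsq : ∀ q, ‖toL2 g (u q) - toL2 g (u p)‖ * ‖toL2 g (u q) - toL2 g (u p)‖ =
      (∫ x, g.inner x (u q x) (u q x) ∂(vol g)) - 2 * (∫ x, g.inner x (u p x) (u q x) ∂(vol g))
        + ∫ x, g.inner x (u p x) (u p x) ∂(vol g) := by
    intro q
    rw [← real_inner_self_eq_norm_mul_norm, inner_sub_left, inner_sub_right, inner_sub_right,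
      real_inner_comm (toL2 g (u p)) (toL2 g (u q)), inner_toL2, inner_toL2, inner_toL2]
    ring
  have h3 : Tendsto (fun q => ‖toL2 g (u q) - toL2 g (u p)‖ * ‖toL2 g (u q) - toL2 g (u p)‖)
      (𝓝 p) (𝓝 0) := by
    simp only [hsq]
    have h4 := (h1.tendsto.sub (h2.tendsto.const_mul 2)).add_const
      (∫ x, g.inner x (u p x) (u p x) ∂(vol g))
    convert h4 using 2
    ring
  have h5 := (Real.continuous_sqrt.tendsto 0).comp h3
  rw [Real.sqrt_zero] at h5
  rw [ContinuousAt, tendsto_iff_norm_sub_tendsto_zero]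
  refine h5.congr fun q => ?_
  simp only [Function.comp_apply]
  exact Real.sqrt_mul_self (norm_nonneg _)

/-- A smooth family of fields is differentiable as a family in `L²`. Differentiation under the
integral gives the weak derivative, tested on smooth fields; its continuity gives the strong one.
-/
theorem hasLineDerivAt_toL2 (hW : IsOpen W) (hu : FieldFamily g W u) {p : P} (hp : p ∈ W)
    (e : P) : HasLineDerivAt ℝ (fun p => toL2 g (u p)) (toL2 g (fieldDeriv e u p)) p e := by
  have hcont : ContinuousAt (fun r : ℝ => p + r • e) 0 := by fun_prop
  have h0 : p + (0 : ℝ) • e = p := by simp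
  have hW0 : ∀ᶠ r : ℝ in 𝓝 0, p + r • e ∈ W := hcont.eventually (by
    change ∀ᶠ y in 𝓝 (p + (0 : ℝ) • e), y ∈ W
    rw [h0]
    exact hW.mem_nhds hp)
  have hc : ContinuousAt (fun r : ℝ => toL2 g (fieldDeriv e u (p + r • e))) 0 := by
    refine ContinuousAt.comp (g := fun q => toL2 g (fieldDeriv e u q)) ?_ hcont
    exact ((hu.deriv hW e).continuousOn_toL2 hW).continuousAt (hW.mem_nhds (by rwa [h0]))
  have h := hasDerivAt_of_weak (LinearMap.range (toL2Linear g))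
    (U := fun r : ℝ => toL2 g (u (p + r • e)))
    (U' := fun r : ℝ => toL2 g (fieldDeriv e u (p + r • e))) (r₀ := 0)
    (Eventually.of_forall fun r => ⟨_, rfl⟩) ⟨_, rfl⟩ hc ?_
  · simp only [h0] at h
    exact h
  · filter_upwards [hW0] with r hr
    rintro _ ⟨w, rfl⟩
    have h1 := (hu w).hasLineDerivAt_integral g hW hr e
    have h2 : paramDeriv e (fun p x => g.inner x (w x) (u p x)) (p + r • e) =
        fun x => g.inner x (w x) (fieldDeriv e u (p + r • e) x) :=
      funext fun x => paramDeriv_inner hW hu hr x e w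
    rw [h2] at h1
    have h3 : HasDerivAt (fun s : ℝ => inner ℝ (toL2 g w) (toL2 g (u (p + s • e))))
        (inner ℝ (toL2 g w) (toL2 g (fieldDeriv e u (p + r • e)))) r := by
      simp only [inner_toL2]
      exact hasDerivAt_of_hasLineDerivAt h1
    simp only [real_inner_comm _ (toL2 g w)] at h3
    exact h3

/-- The Leibniz rule for the inner product of two families. In the first term, the projections are
only known to be continuous on `L²`, which is why differentiability in `L²` is needed. -/
theorem hasLineDerivAt_innerABK (hW : IsOpen W) (hu : FieldFamily g W u) (hv : FieldFamily g W v)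
    (α β κ : ℝ) {p : P} (hp : p ∈ W) (e : P) :
    HasLineDerivAt ℝ (fun p => innerABK g α β κ (u p) (v p))
      (innerABK g α β κ (fieldDeriv e u p) (v p) + innerABK g α β κ (u p) (fieldDeriv e v p))
      p e := by
  simp only [innerABK_eq]
  have h1 : HasLineDerivAt ℝ (fun p => inner ℝ (Pbar g κ (toL2 g (u p))) (Pbar g κ (toL2 g (v p))))
      (inner ℝ (Pbar g κ (toL2 g (u p))) (Pbar g κ (toL2 g (fieldDeriv e v p))) +
        inner ℝ (Pbar g κ (toL2 g (fieldDeriv e u p))) (Pbar g κ (toL2 g (v p)))) p e := by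
    have a1 := (Pbar g κ).hasFDerivAt.comp_hasDerivAt (0 : ℝ) (hasLineDerivAt_toL2 hW hu hp e)
    have a2 := (Pbar g κ).hasFDerivAt.comp_hasDerivAt (0 : ℝ) (hasLineDerivAt_toL2 hW hv hp e)
    have a3 := HasDerivAt.inner ℝ a1 a2
    simp only [Function.comp_apply, zero_smul, add_zero] at a3
    exact a3
  have h2 : HasLineDerivAt ℝ (fun p => ∫ x, twoFormInner g (dForm (flat g (u p)))
      (dForm (flat g (v p))) x ∂(vol g))
      ((∫ x, twoFormInner g (dForm (flat g (fieldDeriv e u p))) (dForm (flat g (v p))) x ∂(vol g))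
        + ∫ x, twoFormInner g (dForm (flat g (u p))) (dForm (flat g (fieldDeriv e v p))) x
          ∂(vol g)) p e := by
    have a1 := (hu.twoFormInner hW hv).hasLineDerivAt_integral g hW hp e
    rw [show paramDeriv e (fun p x => twoFormInner g (dForm (flat g (u p)))
      (dForm (flat g (v p))) x) p = fun x => _ from funext fun x =>
        (hu.twoFormInner hW hv).paramDeriv_eq hW hp
          (hasLineDerivAt_twoFormInner hW hu hv hp x e)] at a1
    rwa [integral_add (((hu.deriv hW e).twoFormInner hW hv).integrable g hp)
      ((hu.twoFormInner hW (hv.deriv hW e)).integrable g hp)] at a1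
  have h3 : HasLineDerivAt ℝ (fun p => ∫ x, divergence g (u p) x * divergence g (v p) x ∂(vol g))
      ((∫ x, divergence g (fieldDeriv e u p) x * divergence g (v p) x ∂(vol g))
        + ∫ x, divergence g (u p) x * divergence g (fieldDeriv e v p) x ∂(vol g)) p e := by
    have hmul : ∀ {u v : P → VectorFields n M}, FieldFamily g W u → FieldFamily g W v →
        FunFamily n W (fun p x => divergence g (u p) x * divergence g (v p) x) := fun hu hv =>
      (hu.divergence hW).mul (hv.divergence hW)
    have a0 : ∀ x, HasLineDerivAt ℝ (fun p => divergence g (u p) x * divergence g (v p) x)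
        (divergence g (fieldDeriv e u p) x * divergence g (v p) x +
          divergence g (u p) x * divergence g (fieldDeriv e v p) x) p e := by
      intro x
      have b := HasDerivAt.mul (hasLineDerivAt_divergence hW hu hp x e)
        (hasLineDerivAt_divergence hW hv hp x e)
      simp only [zero_smul, add_zero] at b
      exact b
    have a1 := (hmul hu hv).hasLineDerivAt_integral g hW hp e
    rw [show paramDeriv e (fun p x => divergence g (u p) x * divergence g (v p) x) p = fun x => _
      from funext fun x => (hmul hu hv).paramDeriv_eq hW hp (a0 x)] at a1
    rwa [integral_add ((hmul (hu.deriv hW e) hv).integrable g hp)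
      ((hmul hu (hv.deriv hW e)).integrable g hp)] at a1
  have h4 := HasDerivAt.add (HasDerivAt.add h1 (HasDerivAt.const_mul α h2))
    (HasDerivAt.const_mul β h3)
  refine HasDerivAt.congr_deriv h4 ?_
  ring

theorem continuousOn_innerABK (hW : IsOpen W) (hu : FieldFamily g W u) (hv : FieldFamily g W v)
    (α β κ : ℝ) : ContinuousOn (fun p => innerABK g α β κ (u p) (v p)) W := by
  simp only [innerABK_eq]
  refine ContinuousOn.add (ContinuousOn.add ?_ ?_) ?_
  · exact ((Pbar g κ).continuous.comp_continuousOn (hu.continuousOn_toL2 hW)).inner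
      ((Pbar g κ).continuous.comp_continuousOn (hv.continuousOn_toL2 hW))
  · exact continuousOn_const.mul ((hu.twoFormInner hW hv).continuousOn_integral g hW)
  · exact continuousOn_const.mul (FunFamily.continuousOn_integral g hW
      ((hu.divergence hW).mul (hv.divergence hW)))

end InnerFamilies

/-! ### The equation on one-forms -/

section Bilinear

variable {n : ℕ} {M : Type*} [TopologicalSpace M] [ChartedSpace (EuclideanSpace ℝ (Fin n)) M]
  [IsManifold (𝓡 n) ∞ M] [CompactSpace M] [T2Space M] [MeasurableSpace M] [BorelSpace M]
  (g : Metric n M) (α β κ : ℝ)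

theorem innerABK_comm (u v : VectorFields n M) :
    innerABK g α β κ u v = innerABK g α β κ v u := by
  simp only [innerABK_eq]
  rw [real_inner_comm]
  simp only [twoFormInner_comm g (dForm (flat g u)), mul_comm (divergence g u _)]

theorem innerABK_add_left (u v w : VectorFields n M) :
    innerABK g α β κ (u + v) w = innerABK g α β κ u w + innerABK g α β κ v w := by
  simp only [innerABK_eq]
  have h1 : ∀ x, twoFormInner g (dForm (flat g (u + v : VectorFields n M))) (dForm (flat g w)) x =
      twoFormInner g (dForm (flat g u)) (dForm (flat g w)) x +
        twoFormInner g (dForm (flat g v)) (dForm (flat g w)) x := by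
    intro x
    have h2 : flat g (u + v : VectorFields n M) = fun x => flat g u x + flat g v x :=
      funext fun x => map_add (g.inner x) _ _
    have h3 : ∀ p q, dForm (flat g (u + v : VectorFields n M)) x p q =
        dForm (flat g u) x p q + dForm (flat g v) x p q := by
      intro p q
      rw [h2]
      exact dForm_add (a := flat g u) (b := flat g v) ((flatForm g u).diffAt x)
        ((flatForm g v).diffAt x) p q
    simp only [twoFormInner_flat_frame, h3, add_mul, Finset.sum_add_distrib, mul_add]
  have h2 : ∀ x, divergence g (u + v : VectorFields n M) x * divergence g w x =
      divergence g u x * divergence g w x + divergence g v x * divergence g w x := by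
    intro x
    rw [← add_mul]
    congr 1
    exact divergence_add g (u.diffAt x) (v.diffAt x)
  simp only [h1, h2]
  have hT : ∀ a : VectorFields n M, Integrable
      (fun x => twoFormInner g (dForm (flat g a)) (dForm (flat g w)) x) (vol g) := fun a =>
    integrable_vol g (smoothFun_twoFormInner g (flatForm g a) (flatForm g w)).continuous
  rw [integral_add (hT u) (hT v), integral_add
      (f := fun x => divergence g u x * divergence g w x)
      (g := fun x => divergence g v x * divergence g w x)
      (integrable_vol g ((smoothFun_divergence g u).mul (smoothFun_divergence g w)).continuous)
      (integrable_vol g ((smoothFun_divergence g v).mul (smoothFun_divergence g w)).continuous),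
    toL2_add, map_add, inner_add_left]
  ring

theorem innerABK_add_right (u v w : VectorFields n M) :
    innerABK g α β κ u (v + w) = innerABK g α β κ u v + innerABK g α β κ u w := by
  simp only [innerABK_comm g α β κ u]
  exact innerABK_add_left g α β κ v w u

theorem innerABK_zero_left (w : VectorFields n M) : innerABK g α β κ 0 w = 0 := by
  have h := innerABK_add_left g α β κ 0 0 w
  rw [add_zero] at h
  linarith

theorem innerABK_zero_right (w : VectorFields n M) : innerABK g α β κ w 0 = 0 := by
  rw [innerABK_comm, innerABK_zero_left]

theorem innerABK_neg_right (u w : VectorFields n M) :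
    innerABK g α β κ u (-w) = -innerABK g α β κ u w := by
  have h := innerABK_add_right g α β κ u w (-w)
  rw [add_neg_cancel, innerABK_zero_right] at h
  linarith

end Bilinear

section Equation

variable {n : ℕ} {M : Type*} [TopologicalSpace M] [ChartedSpace (EuclideanSpace ℝ (Fin n)) M]
  [IsManifold (𝓡 n) ∞ M] [CompactSpace M] [T2Space M] [MeasurableSpace M] [BorelSpace M]
  {g : Metric n M} {J : Set ℝ} {u : ℝ → VectorFields n M} {m : ℝ → OneForms n M}

theorem timeDeriv_eq (u : ℝ → VectorFields n M) (t : ℝ) : timeDeriv u t = fieldDeriv 1 u t := by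
  unfold timeDeriv fieldDeriv
  congr 1

theorem hasDerivAt_of_hasLineDerivAt_one {E : Type*} [NormedAddCommGroup E] [NormedSpace ℝ E]
    {f : ℝ → E} {d : E} {t : ℝ} (h : HasLineDerivAt ℝ f d t 1) : HasDerivAt f d t := by
  have h2 := hasDerivAt_of_hasLineDerivAt (f := f) (d := d) (p := (0 : ℝ)) (e := (1 : ℝ)) (r := t)
    (by simpa using h)
  simpa using h2

theorem fieldDeriv_const {P : Type*} [NormedAddCommGroup P] [NormedSpace ℝ P] (e p : P)
    (v : VectorFields n M) : fieldDeriv e (fun _ => v) p = 0 := by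
  unfold fieldDeriv
  simp only [fderiv_fun_const, Pi.zero_apply, zero_apply]
  exact toField_coe (0 : VectorFields n M)

theorem FieldFamily.of_isSmoothFieldCurve (g : Metric n M) (hu : IsSmoothFieldCurve J u) :
    FieldFamily g J u := FieldFamily.of_contMDiffOn g hu

theorem IsSmoothFormCurve.funFamily (hm : IsSmoothFormCurve J m) (v : VectorFields n M) :
    FunFamily n J (fun t x => m t x (v x)) := by
  intro q hq
  have hv : ContMDiff (𝓘(ℝ, ℝ).prod (𝓡 n)) (𝓡 n).tangent ∞
      (fun q : ℝ × M => (⟨q.2, v q.2⟩ : TangentBundle (𝓡 n) M)) :=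
    v.contMDiff.comp contMDiff_snd
  have h2 := ContMDiffWithinAt.clm_bundle_apply (F₁ := EuclideanSpace ℝ (Fin n)) (F₂ := ℝ)
    (E₁ := fun x : M => TangentSpace (𝓡 n) x) (E₂ := fun _ : M => ℝ) (b := fun q : ℝ × M => q.2)
    (ϕ := fun q => m q.1 q.2) (v := fun q => v q.2) (hm q hq) (hv q).contMDiffWithinAt
  exact (contMDiffWithinAt_totalSpace.1 h2).2

theorem smoothFun_lieForm (u : VectorFields n M) (m : OneForms n M) (v : VectorFields n M) :
    SmoothFun (n := n) (lieForm u m v) :=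
  (smoothFun_dFun (smoothFun_form m v) u).sub (smoothFun_form m (bracket u v))

/-- The left side of the equation `ṁ + L_u m + m div(u) = 0`, evaluated on `V`. -/
def equationTerm (g : Metric n M) (u : ℝ → VectorFields n M) (m : ℝ → OneForms n M) (t : ℝ)
    (V : VectorFields n M) (x : M) : ℝ :=
  deriv (fun s => m s x (V x)) t + lieForm (u t) (m t) V x + m t x (V x) * divergence g (u t) x

theorem smoothFun_equationTerm (hJ : IsOpen J)
    (hm : ∀ v : VectorFields n M, FunFamily n J (fun t x => m t x (v x)))
    {t : ℝ} (ht : t ∈ J) (V : VectorFields n M) :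
    SmoothFun (n := n) (equationTerm g u m t V) := by
  have h1 := ((hm V).paramDeriv hJ (1 : ℝ)).smoothFun ht
  have h2 : paramDeriv (1 : ℝ) (fun t x => m t x (V x)) t =
      fun x => deriv (fun s => m s x (V x)) t := rfl
  rw [h2] at h1
  exact (ContMDiff.add h1 (smoothFun_lieForm _ _ V)).add
    ((smoothFun_form _ V).mul (smoothFun_divergence g (u t)))

/-- The Euler–Arnold functional, evaluated on `V`, is the integral of the equation evaluated on
`V`. -/
theorem eulerArnold_eq_integral (hJ : IsOpen J) (hu : FieldFamily g J u)
    (hm : ∀ v : VectorFields n M, FunFamily n J (fun t x => m t x (v x))) {α β κ : ℝ}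
    (hum : ∀ t ∈ J, ∀ v, innerABK g α β κ (u t) v = pairing g (m t) v)
    {t : ℝ} (ht : t ∈ J) (V : VectorFields n M) :
    (innerABK g α β κ (timeDeriv u t) + adStar (u t) (innerABK g α β κ (u t))) V =
      ∫ x, equationTerm g u m t V x ∂(vol g) := by
  have hd := hasDerivAt_of_hasLineDerivAt_one
    (hasLineDerivAt_innerABK hJ hu (FieldFamily.const V) α β κ ht 1)
  rw [fieldDeriv_const, innerABK_zero_right, add_zero, ← timeDeriv_eq] at hd
  have hd2 := hasDerivAt_of_hasLineDerivAt_one ((hm V).hasLineDerivAt_integral g hJ ht 1)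
  have heq : (fun t => innerABK g α β κ (u t) V) =ᶠ[𝓝 t] fun t => ∫ x, m t x (V x) ∂(vol g) := by
    filter_upwards [hJ.mem_nhds ht] with s hs
    exact hum s hs V
  have h1 := hd.unique (hd2.congr_of_eventuallyEq heq)
  have h2 : adStar (u t) (innerABK g α β κ (u t)) V = adStar (u t) (pairing g (m t)) V :=
    hum t ht _
  have h3 : paramDeriv (1 : ℝ) (fun t x => m t x (V x)) t =
      fun x => deriv (fun s => m s x (V x)) t := rfl
  rw [Pi.add_apply, h1, h2, adStar_pairing, h3, ← integral_add]
  · congr 1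
    ext x
    unfold equationTerm
    ring
  · rw [← h3]
    exact ((hm V).paramDeriv hJ (1 : ℝ)).integrable g ht
  · exact integrable_vol g ((smoothFun_lieForm _ _ V).add
      ((smoothFun_divergence g (u t)).mul (smoothFun_form _ V))).continuous

/-- The equation on one-forms is the abstract Euler–Arnold equation. -/
theorem solvesEquation_iff (hJ : IsOpen J) (hu : FieldFamily g J u)
    (hm : ∀ v : VectorFields n M, FunFamily n J (fun t x => m t x (v x))) {α β κ : ℝ}
    (hum : ∀ t ∈ J, ∀ v, innerABK g α β κ (u t) v = pairing g (m t) v) :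
    SolvesEquation g J u m ↔ SolvesEulerArnold g α β κ J u := by
  constructor
  · intro h t ht
    ext V
    rw [eulerArnold_eq_integral hJ hu hm hum ht V, Pi.zero_apply]
    have h0 : ∀ x, equationTerm g u m t V x = 0 := h t ht V
    simp [h0]
  · intro h t ht V
    have hQ := smoothFun_equationTerm (g := g) (u := u) hJ hm ht V
    refine eq_zero_of_integral_mul_self g hQ.continuous ?_
    -- test on `Q V` with `Q` the left side evaluated on `V`; by tensoriality this gives `∫ Q²`
    have h1 := eulerArnold_eq_integral hJ hu hm hum ht (funSmul _ hQ V)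
    rw [h t ht, Pi.zero_apply] at h1
    rw [h1]
    congr 1
    ext x
    have hd : DifferentiableAt ℝ (fun s => m s x (V x)) t := (hm V).differentiableAt hJ ht x
    have h2 : (fun s => m s x (funSmul _ hQ V x)) =
        fun s => equationTerm g u m t V x * m s x (V x) := by
      ext s
      rw [funSmul_apply, map_smul, smul_eq_mul]
    have h3 : lieForm (u t) (m t) (funSmul _ hQ V) x =
        equationTerm g u m t V x * lieForm (u t) (m t) V x :=
      (tensorialAt_lieForm (u t) ((m t).diffAt x)).smul (FunSmoothAt.diffAt (hQ x)) (V.diffAt x)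
    have h4 : m t x (funSmul _ hQ V x) = equationTerm g u m t V x * m t x (V x) := by
      rw [funSmul_apply, map_smul, smul_eq_mul]
    have h5 : equationTerm g u m t (funSmul _ hQ V) x =
        deriv (fun s => m s x (funSmul _ hQ V x)) t + lieForm (u t) (m t) (funSmul _ hQ V) x
          + m t x (funSmul _ hQ V x) * divergence g (u t) x := rfl
    have h6 : equationTerm g u m t V x = deriv (fun s => m s x (V x)) t + lieForm (u t) (m t) V x
          + m t x (V x) * divergence g (u t) x := rfl
    rw [h5, h2, h3, h4, deriv_const_mul _ hd]
    generalize equationTerm g u m t V x = q at h6 ⊢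
    rw [h6]
    ring

end Equation

/-! ### Inverses of families of diffeomorphisms -/

section Inverse

variable {P E : Type*} [NormedAddCommGroup P] [NormedSpace ℝ P] [CompleteSpace P]
  [NormedAddCommGroup E] [NormedSpace ℝ E] [FiniteDimensional ℝ E]

/-- The inverse function theorem with parameters: a smooth family of maps, one of which has a
differentiable left inverse near a point, has a smooth family of local right inverses. -/
theorem exists_local_inverse_family {f : P × E → E} {p₀ : P} {x₀ : E}
    (hf : ContDiffAt ℝ ∞ f (p₀, x₀)) {h : E → E} (hh : DifferentiableAt ℝ h (f (p₀, x₀)))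
    (hhf : ∀ᶠ x in 𝓝 x₀, h (f (p₀, x)) = x) :
    ∃ ψ : P × E → E, ContDiffAt ℝ ∞ ψ (p₀, f (p₀, x₀)) ∧ ψ (p₀, f (p₀, x₀)) = x₀ ∧
      ∀ᶠ q in 𝓝 (p₀, f (p₀, x₀)), f (q.1, ψ q) = q.2 := by
  have : CompleteSpace E := FiniteDimensional.complete ℝ E
  set y₀ := f (p₀, x₀) with hy₀
  -- solve `f (p, x) = y` for `x`, with `(p, y)` as the parameter of the implicit function theorem
  let F : (P × E) × E → E := fun q => f (q.1.1, q.2) - q.1.2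
  let u : (P × E) × E := ((p₀, y₀), x₀)
  have hF : ContDiffAt ℝ ∞ F u := by
    have h1 : ContDiffAt ℝ ∞ (fun q : (P × E) × E => (q.1.1, q.2)) u := by fun_prop
    have h2 : ContDiffAt ℝ ∞ (fun q : (P × E) × E => f (q.1.1, q.2)) u :=
      ContDiffAt.comp u (g := f) (f := fun q : (P × E) × E => (q.1.1, q.2)) hf h1
    have h3 : ContDiffAt ℝ ∞ (fun q : (P × E) × E => q.1.2) u := by fun_prop
    exact h2.sub h3
  have hinv : (fderiv ℝ F u ∘L .inr ℝ (P × E) E).IsInvertible := by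
    set B := fderiv ℝ F u ∘L .inr ℝ (P × E) E with hB
    have h1 : HasFDerivAt (fun x => F ((p₀, y₀), x)) B x₀ :=
      HasFDerivAt.comp (g := F) (f := fun x => ((p₀, y₀), x)) x₀
        (hF.differentiableAt (by simp)).hasFDerivAt (hasFDerivAt_prodMk_right (p₀, y₀) x₀)
    have h2 : HasFDerivAt (fun x => f (p₀, x)) B x₀ := by
      have h3 := h1.add_const y₀
      refine h3.congr_of_eventuallyEq (Eventually.of_forall fun x => ?_)
      simp [F]
    have h4 : HasFDerivAt (fun x => h (f (p₀, x))) ((fderiv ℝ h y₀).comp B) x₀ :=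
      HasFDerivAt.comp (g := h) (f := fun x => f (p₀, x)) x₀ hh.hasFDerivAt h2
    have h5 : (fderiv ℝ h y₀).comp B = ContinuousLinearMap.id ℝ E :=
      (h4.congr_of_eventuallyEq
        (hhf.mono fun x hx => hx.symm)).unique (hasFDerivAt_id x₀)
    -- the left inverse makes the partial derivative injective, hence invertible
    have h6 : Function.Injective B := fun a b hab => by
      have h7 := congrArg (fun L : E →L[ℝ] E => L a) h5
      have h8 := congrArg (fun L : E →L[ℝ] E => L b) h5
      simp only [ContinuousLinearMap.comp_apply, ContinuousLinearMap.id_apply] at h7 h8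
      rw [← h7, ← h8, hab]
    refine ⟨(LinearEquiv.ofInjectiveEndo (B : E →ₗ[ℝ] E) h6).toContinuousLinearEquiv, ?_⟩
    ext v
    rfl
  refine ⟨hF.implicitFunction (by simp) hinv, hF.contDiffAt_implicitFunction (by simp) hinv,
    hF.implicitFunction_apply_self (by simp) hinv, ?_⟩
  filter_upwards [hF.eventually_apply_implicitFunction (by simp) hinv] with q hq
  have h0 : F u = 0 := sub_self _
  rw [h0] at hq
  exact sub_eq_zero.1 hq

end Inverse

section InverseManifold

variable {n : ℕ} {M : Type*} [TopologicalSpace M] [ChartedSpace (EuclideanSpace ℝ (Fin n)) M]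
  [IsManifold (𝓡 n) ∞ M] {P : Type*} [NormedAddCommGroup P] [NormedSpace ℝ P] [CompleteSpace P]
  {W : Set P} {Φ : P → Diff n M}

/-- The inverses of a smooth family of diffeomorphisms form a smooth family. -/
theorem contMDiffOn_symm_family (hW : IsOpen W)
    (hΦ : ContMDiffOn (𝓘(ℝ, P).prod (𝓡 n)) (𝓡 n) ∞ (fun q : P × M => Φ q.1 q.2) (W ×ˢ univ)) :
    ContMDiffOn (𝓘(ℝ, P).prod (𝓡 n)) (𝓡 n) ∞ (fun q : P × M => (Φ q.1).symm q.2)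
      (W ×ˢ univ) := by
  rintro ⟨p₀, y₀⟩ ⟨hp₀, -⟩
  refine ContMDiffAt.contMDiffWithinAt ?_
  set x₀ := (Φ p₀).symm y₀ with hx₀
  have hxy : Φ p₀ x₀ = y₀ := (Φ p₀).apply_symm_apply y₀
  have hO : IsOpen (W ×ˢ (univ : Set M)) := hW.prod isOpen_univ
  set e := extChartAt (𝓡 n) x₀ with he
  set e' := extChartAt (𝓡 n) y₀ with he'
  have hΦ₀ : ContMDiffAt (𝓘(ℝ, P).prod (𝓡 n)) (𝓡 n) ∞ (fun q : P × M => Φ q.1 q.2) (p₀, x₀) :=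
    hΦ.contMDiffAt (hO.mem_nhds ⟨hp₀, mem_univ _⟩)
  have hsx : ContMDiffAt 𝓘(ℝ, EuclideanSpace ℝ (Fin n)) (𝓡 n) ∞ e.symm (e x₀) :=
    (contMDiffOn_extChartAt_symm x₀).contMDiffAt (extChartAt_target_mem_nhds x₀)
  have hsy : ContMDiffAt 𝓘(ℝ, EuclideanSpace ℝ (Fin n)) (𝓡 n) ∞ e'.symm (e' y₀) :=
    (contMDiffOn_extChartAt_symm y₀).contMDiffAt (extChartAt_target_mem_nhds y₀)
  have hex : e.symm (e x₀) = x₀ := extChartAt_to_inv x₀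
  have hey : e'.symm (e' y₀) = y₀ := extChartAt_to_inv y₀
  let f : P × EuclideanSpace ℝ (Fin n) → EuclideanSpace ℝ (Fin n) :=
    fun q => e' (Φ q.1 (e.symm q.2))
  let h : EuclideanSpace ℝ (Fin n) → EuclideanSpace ℝ (Fin n) :=
    fun η => e ((Φ p₀).symm (e'.symm η))
  have hfv : f (p₀, e x₀) = e' y₀ := by
    change e' (Φ p₀ (e.symm (e x₀))) = _
    rw [hex, hxy]
  have hlift : ContMDiffAt 𝓘(ℝ, P × EuclideanSpace ℝ (Fin n)) (𝓘(ℝ, P).prod (𝓡 n)) ∞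
      (fun q : P × EuclideanSpace ℝ (Fin n) => (q.1, e.symm q.2)) (p₀, e x₀) := by
    refine contDiff_fst.contMDiff.contMDiffAt.prodMk ?_
    exact ContMDiffAt.comp (g := e.symm) (f := fun q : P × EuclideanSpace ℝ (Fin n) => q.2)
      (p₀, e x₀) hsx contDiff_snd.contMDiff.contMDiffAt
  have hmid : ContMDiffAt 𝓘(ℝ, P × EuclideanSpace ℝ (Fin n)) (𝓡 n) ∞
      (fun q : P × EuclideanSpace ℝ (Fin n) => Φ q.1 (e.symm q.2)) (p₀, e x₀) := by
    refine ContMDiffAt.comp (g := fun q : P × M => Φ q.1 q.2) (p₀, e x₀) ?_ hlift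
    simpa only [hex] using hΦ₀
  have hf : ContDiffAt ℝ ∞ f (p₀, e x₀) := by
    refine ContMDiffAt.contDiffAt (ContMDiffAt.comp (g := e') (p₀, e x₀) ?_ hmid)
    change ContMDiffAt _ _ _ e' (Φ p₀ (e.symm (e x₀)))
    rw [hex, hxy]
    exact contMDiffAt_extChartAt
  have hh : ContDiffAt ℝ ∞ h (f (p₀, e x₀)) := by
    rw [hfv]
    refine ContMDiffAt.contDiffAt (ContMDiffAt.comp (g := e) (e' y₀) ?_
      (ContMDiffAt.comp (g := (Φ p₀).symm) (e' y₀) (Φ p₀).symm.contMDiff.contMDiffAt hsy))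
    rw [hey]
    exact contMDiffAt_extChartAt
  have hhf : ∀ᶠ ξ in 𝓝 (e x₀), h (f (p₀, ξ)) = ξ := by
    have h1 : ContinuousAt (fun ξ => Φ p₀ (e.symm ξ)) (e x₀) :=
      (Φ p₀).continuous.continuousAt.comp hsx.continuousAt
    have h2 : e'.source ∈ 𝓝 (Φ p₀ (e.symm (e x₀))) := by
      rw [hex, hxy]
      exact extChartAt_source_mem_nhds y₀
    filter_upwards [h1 h2, extChartAt_target_mem_nhds x₀] with ξ hξ hξ2
    change e ((Φ p₀).symm (e'.symm (e' (Φ p₀ (e.symm ξ))))) = ξ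
    rw [e'.left_inv hξ, (Φ p₀).symm_apply_apply, e.right_inv hξ2]
  obtain ⟨ψ, hψ, hψ₀, hfψ⟩ := exists_local_inverse_family hf (hh.differentiableAt (by simp)) hhf
  rw [hfv] at hψ hψ₀ hfψ
  have hin : ContMDiffAt (𝓘(ℝ, P).prod (𝓡 n)) 𝓘(ℝ, P × EuclideanSpace ℝ (Fin n)) ∞
      (fun q : P × M => (q.1, e' q.2)) (p₀, y₀) := by
    have h1 : ContMDiffAt (𝓘(ℝ, P).prod (𝓡 n)) 𝓘(ℝ, EuclideanSpace ℝ (Fin n)) ∞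
        (fun q : P × M => e' q.2) (p₀, y₀) :=
      ContMDiffAt.comp (g := e') (f := fun q : P × M => q.2) (p₀, y₀)
        (contMDiffAt_extChartAt (I := 𝓡 n) (x := y₀)) contMDiffAt_snd
    exact ContMDiffAt.prodMk_space contMDiffAt_fst h1
  have hψM : ContMDiffAt (𝓘(ℝ, P).prod (𝓡 n)) 𝓘(ℝ, EuclideanSpace ℝ (Fin n)) ∞
      (fun q : P × M => ψ (q.1, e' q.2)) (p₀, y₀) :=
    ContMDiffAt.comp (g := ψ) (f := fun q : P × M => (q.1, e' q.2)) (p₀, y₀)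
      hψ.contMDiffAt hin
  have hres : ContMDiffAt (𝓘(ℝ, P).prod (𝓡 n)) (𝓡 n) ∞
      (fun q : P × M => e.symm (ψ (q.1, e' q.2))) (p₀, y₀) := by
    refine ContMDiffAt.comp (g := e.symm) (p₀, y₀) ?_ hψM
    simpa only [hψ₀] using hsx
  refine hres.congr_of_eventuallyEq ?_
  -- near `(p₀, y₀)` the local right inverse is the inverse, since `Φ p` is injective
  have hc : ContinuousAt (fun q : P × M => Φ q.1 (e.symm (ψ (q.1, e' q.2)))) (p₀, y₀) := by
    refine ContinuousAt.comp (g := fun q : P × M => Φ q.1 q.2)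
      (f := fun q : P × M => (q.1, e.symm (ψ (q.1, e' q.2)))) ?_
      (continuousAt_fst.prodMk hres.continuousAt)
    simp only [hψ₀, hex]
    exact hΦ₀.continuousAt
  have hsrc : e'.source ∈ 𝓝 (Φ p₀ (e.symm (ψ (p₀, e' y₀)))) := by
    rw [hψ₀, hex, hxy]
    exact extChartAt_source_mem_nhds y₀
  have hsrc2 : ∀ᶠ q : P × M in 𝓝 (p₀, y₀), q.2 ∈ e'.source :=
    continuousAt_snd (extChartAt_source_mem_nhds (I := 𝓡 n) y₀)
  filter_upwards [hc hsrc, hsrc2, hin.continuousAt.eventually hfψ] with q hq1 hq2 hq3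
  have h1 : Φ q.1 (e.symm (ψ (q.1, e' q.2))) = q.2 := e'.injOn hq1 hq2 hq3
  rw [← h1, (Φ q.1).symm_apply_apply, h1]

end InverseManifold

/-! ### Velocities and the structure equation -/

section Velocity

variable {n : ℕ} {M : Type*} [TopologicalSpace M] [ChartedSpace (EuclideanSpace ℝ (Fin n)) M]
  [IsManifold (𝓡 n) ∞ M] {P : Type*} [NormedAddCommGroup P] [NormedSpace ℝ P]
  {W : Set P} {Φ : P → Diff n M}

/-- A family of diffeomorphisms, smooth for parameters in the set `W`. -/
def DiffFamily (W : Set P) (Φ : P → Diff n M) : Prop :=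
  ContMDiffOn (𝓘(ℝ, P).prod (𝓡 n)) (𝓡 n) ∞ (fun q : P × M => Φ q.1 q.2) (W ×ˢ univ)

/-- The velocity at `Φ p x` of the family in the parameter direction `e`. -/
def pointVelocity (e : P) (Φ : P → Diff n M) (p : P) (x : M) : TangentSpace (𝓡 n) (Φ p x) :=
  mfderiv 𝓘(ℝ, P) (𝓡 n) (fun p' => Φ p' x) p e

/-- The velocity of a family of diffeomorphisms in the parameter direction `e`, translated to the
identity. -/
def familyVelocity (e : P) (Φ : P → Diff n M) (p : P) : VectorFields n M :=
  toField fun y => toModel (pointVelocity e Φ p ((Φ p).symm y))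

theorem DiffFamily.mdifferentiableAt (hW : IsOpen W) (hΦ : DiffFamily W Φ) {p : P} (hp : p ∈ W)
    (x : M) :
    MDifferentiableAt (𝓘(ℝ, P).prod (𝓡 n)) (𝓡 n) (fun q : P × M => Φ q.1 q.2) (p, x) :=
  (ContMDiffOn.contMDiffAt hΦ ((hW.prod isOpen_univ).mem_nhds ⟨hp, mem_univ x⟩)).mdifferentiableAt
    (by simp)

theorem DiffFamily.contMDiffAt_param (hW : IsOpen W) (hΦ : DiffFamily W Φ) {p : P} (hp : p ∈ W)
    (x : M) : ContMDiffAt 𝓘(ℝ, P) (𝓡 n) ∞ (fun p => Φ p x) p := by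
  have h : ContMDiff 𝓘(ℝ, P) (𝓘(ℝ, P).prod (𝓡 n)) ∞ (fun p : P => (p, x)) :=
    contMDiff_id.prodMk contMDiff_const
  have h2 : ContMDiffAt (𝓘(ℝ, P).prod (𝓡 n)) (𝓡 n) ∞ (fun q : P × M => Φ q.1 q.2) (p, x) :=
    ContMDiffOn.contMDiffAt hΦ ((hW.prod isOpen_univ).mem_nhds ⟨hp, mem_univ x⟩)
  exact ContMDiffAt.comp (g := fun q : P × M => Φ q.1 q.2) p h2 h.contMDiffAt

theorem pointVelocity_eq (hW : IsOpen W) (hΦ : DiffFamily W Φ) {p : P} (hp : p ∈ W) (x : M)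
    (e : P) :
    mfderiv (𝓘(ℝ, P).prod (𝓡 n)) (𝓡 n) (fun q : P × M => Φ q.1 q.2) (p, x)
      (e, (0 : TangentSpace (𝓡 n) x)) = pointVelocity e Φ p x := by
  refine (mfderiv_prod_eq_add_apply (hΦ.mdifferentiableAt hW hp x)).trans ?_
  simp only [map_zero, add_zero]
  rfl

theorem tangentBundle_mk_congr {y z : M} (h : z = y) (v : EuclideanSpace ℝ (Fin n)) :
    (⟨z, v⟩ : TangentBundle (𝓡 n) M) = ⟨y, v⟩ := by rw [h]

theorem DiffFamily.contMDiffOn_pointVelocity [CompleteSpace P] (hW : IsOpen W)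
    (hΦ : DiffFamily W Φ) (e : P) :
    ContMDiffOn (𝓘(ℝ, P).prod (𝓡 n)) (𝓡 n).tangent ∞
      (fun q : P × M => (⟨q.2, toModel (pointVelocity e Φ q.1 ((Φ q.1).symm q.2))⟩ :
        TangentBundle (𝓡 n) M)) (W ×ˢ univ) := by
  have h1 := contMDiffOn_tangent_family hW hΦ e (0 : VectorFields n M)
  have h2 : ContMDiffOn (𝓘(ℝ, P).prod (𝓡 n)) (𝓘(ℝ, P).prod (𝓡 n)) ∞
      (fun q : P × M => (q.1, (Φ q.1).symm q.2)) (W ×ˢ univ) :=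
    contMDiffOn_fst.prodMk (contMDiffOn_symm_family hW hΦ)
  refine (h1.comp h2 fun q hq => ⟨hq.1, mem_univ _⟩).congr fun q hq => ?_
  have h3 := pointVelocity_eq hW hΦ hq.1 ((Φ q.1).symm q.2) e
  have h4 := tangentBundle_mk_congr ((Φ q.1).apply_symm_apply q.2).symm
    (toModel (pointVelocity e Φ q.1 ((Φ q.1).symm q.2)))
  refine h4.trans ?_
  rw [← h3]
  rfl

variable [CompactSpace M] [T2Space M] [MeasurableSpace M] [BorelSpace M]
  [FiniteDimensional ℝ P]

/-- The translated velocity is a smooth field, so that `familyVelocity` is not the default value of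
`toField`. -/
theorem familyVelocity_apply (hW : IsOpen W) (hΦ : DiffFamily W Φ) {p : P} (hp : p ∈ W)
    (e : P) (y : M) :
    familyVelocity e Φ p y = toModel (pointVelocity e Φ p ((Φ p).symm y)) := by
  have : CompleteSpace P := FiniteDimensional.complete ℝ P
  have h : ContMDiff (𝓡 n) (𝓘(ℝ, P).prod (𝓡 n)) ∞ (fun x : M => (p, x)) :=
    contMDiff_const.prodMk contMDiff_id
  refine toField_apply (u := fun y => toModel (pointVelocity e Φ p ((Φ p).symm y))) ?_ y
  exact contMDiffOn_univ.1 ((hΦ.contMDiffOn_pointVelocity hW e).comp h.contMDiffOn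
    fun x _ => ⟨hp, mem_univ x⟩)

theorem familyVelocity_apply_apply (hW : IsOpen W) (hΦ : DiffFamily W Φ) {p : P} (hp : p ∈ W)
    (e : P) (x : M) : familyVelocity e Φ p (Φ p x) = pointVelocity e Φ p x := by
  rw [familyVelocity_apply hW hΦ hp e (Φ p x), (Φ p).symm_apply_apply]
  rfl

theorem DiffFamily.fieldFamily (g : Metric n M) (hW : IsOpen W) (hΦ : DiffFamily W Φ) (e : P) :
    FieldFamily g W (familyVelocity e Φ) := by
  have : CompleteSpace P := FiniteDimensional.complete ℝ P
  refine FieldFamily.of_contMDiffOn g ((hΦ.contMDiffOn_pointVelocity hW e).congr fun q hq => ?_)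
  rw [familyVelocity_apply hW hΦ hq.1 e q.2]

/-- The chain rule for `F p (Φ p x)`: the second term is the derivative along the velocity. -/
theorem hasLineDerivAt_comp_family (hW : IsOpen W) (hΦ : DiffFamily W Φ) {F : P → M → ℝ}
    (hF : FunFamily n W F) {p : P} (hp : p ∈ W) (e : P) (x : M) :
    HasLineDerivAt ℝ (fun p => F p (Φ p x))
      (paramDeriv e F p (Φ p x) + dFun (n := n) (F p) (Φ p x) (familyVelocity e Φ p (Φ p x)))
      p e := by
  have h1 := (hΦ.contMDiffAt_param hW hp x).mdifferentiableAt (by simp)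
  have h2 : MDifferentiableAt 𝓘(ℝ, P) (𝓘(ℝ, P).prod (𝓡 n)) (fun p : P => (p, Φ p x)) p :=
    mdifferentiableAt_id.prodMk h1
  have h3 := hF.mdiffAt hW hp (Φ p x)
  have h4 : MDifferentiableAt 𝓘(ℝ, P) 𝓘(ℝ, ℝ) (fun p : P => F p (Φ p x)) p :=
    MDifferentiableAt.comp (g := fun q : P × M => F q.1 q.2) (f := fun p : P => (p, Φ p x)) p h3 h2
  have h5 : fderiv ℝ (fun p : P => F p (Φ p x)) p e =
      paramDeriv e F p (Φ p x) + dFun (n := n) (F p) (Φ p x) (familyVelocity e Φ p (Φ p x)) := by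
    rw [familyVelocity_apply_apply hW hΦ hp, ← hF.mfderiv_eq hW hp, ← mfderiv_eq_fderiv]
    have h6 := mfderiv_comp (g := fun q : P × M => F q.1 q.2) (f := fun p : P => (p, Φ p x)) p h3 h2
    have h7 := mfderiv_prodMk (f := fun p : P => p) (g := fun p : P => Φ p x) (x := p)
      (I := 𝓘(ℝ, P)) (I' := 𝓘(ℝ, P)) (I'' := 𝓡 n) mdifferentiableAt_id h1
    have h8 : mfderiv 𝓘(ℝ, P) (𝓘(ℝ, P).prod (𝓡 n)) (fun p : P => (p, Φ p x)) p e =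
        (e, pointVelocity e Φ p x) := by
      rw [h7]
      have h9 : mfderiv 𝓘(ℝ, P) 𝓘(ℝ, P) (fun p : P => p) p = ContinuousLinearMap.id ℝ P :=
        mfderiv_id
      rw [h9]
      rfl
    exact (congrArg (fun L : P →L[ℝ] ℝ => L e) h6).trans
      (congrArg (mfderiv (𝓘(ℝ, P).prod (𝓡 n)) 𝓘(ℝ, ℝ) (fun q : P × M => F q.1 q.2) (p, Φ p x)) h8)
  rw [← h5]
  exact (mdifferentiableAt_iff_differentiableAt.1 h4).hasFDerivAt.hasLineDerivAt e

/-- Tangent vectors are determined by their action on smooth functions. -/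
theorem tangent_ext {x : M} {v w : TangentSpace (𝓡 n) x}
    (h : ∀ f : M → ℝ, SmoothFun (n := n) f → dFun (n := n) f x v = dFun (n := n) f x w) :
    v = w := by
  have hx : x ∈ (chartAt (EuclideanSpace ℝ (Fin n)) x).source := mem_chart_source _ x
  obtain ⟨b⟩ : Nonempty (SmoothBumpFunction (𝓡 n) x) := inferInstance
  have h1 : ∀ i, component x (coordRepr x x v) i = component x (coordRepr x x w) i := by
    intro i
    have hs : SmoothFun (n := n) (fun y => b y • coordFun x i y) :=
      b.contMDiff_smul fun y hy => (funSmoothAt_coordFun hy i).contMDiffWithinAt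
    have he : (fun y => b y • coordFun x i y) =ᶠ[𝓝 x] coordFun x i := by
      filter_upwards [b.eventuallyEq_one] with y hy
      simp [hy]
    have h2 := h _ hs
    rwa [dFun_congr he, dFun_coordFun hx, dFun_coordFun hx] at h2
  rw [← sum_coordField hx v, ← sum_coordField hx w]
  simp only [h1]

variable {g : Metric n M}

/-- The parameter derivative of a family of fields, acting on a function. -/
theorem dFun_fieldDeriv (hW : IsOpen W) {u : P → VectorFields n M} (hu : FieldFamily g W u)
    {p : P} (hp : p ∈ W) (f : M → ℝ) (e : P) (y : M) :
    paramDeriv e (fun p y => dFun (n := n) f y (u p y)) p y =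
      dFun (n := n) f y (fieldDeriv e u p y) := by
  rw [fieldDeriv_apply hW hu hp]
  let L : EuclideanSpace ℝ (Fin n) →L[ℝ] ℝ := dFun (n := n) f y
  have h2 : HasFDerivAt (fun p => dFun (n := n) f y (u p y))
    (L.comp (fderiv ℝ (fun p => toModel (u p y)) p)) p :=
      L.hasFDerivAt.comp p (hu.differentiableAt hW hp y).hasFDerivAt
  unfold paramDeriv
  rw [h2.fderiv]
  rfl

theorem FieldFamily.dFun (hu : FieldFamily g W u) {f : M → ℝ} (hf : SmoothFun (n := n) f) :
    FunFamily n W (fun p y => EulerArnold.dFun (n := n) f y (u p y)) := by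
  have h : (fun p y => EulerArnold.dFun (n := n) f y (u p y)) = fun p y => ∑ a,
      g.inner y ((frame g).Y a y) (u p y) *
        EulerArnold.dFun (n := n) f y ((frame g).X a y) := by
    ext p y
    conv_lhs => rw [← frame_sum_inner (frame g) (u p y)]
    simp only [map_sum, map_smul, smul_eq_mul]
  rw [h]
  exact FunFamily.sum _ fun a _ => (hu _).mul (FunFamily.const (smoothFun_dFun hf _))

/-- The structure equation `∂₂ u₁ - ∂₁ u₂ = [u₁, u₂]` for the velocities `u₁, u₂` of a family of
diffeomorphisms in two parameter directions. It expresses the symmetry of the second derivatives of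
`p ↦ f (Φ p x)`. -/
theorem fieldDeriv_familyVelocity (g : Metric n M) (hW : IsOpen W) (hΦ : DiffFamily W Φ) {p : P}
    (hp : p ∈ W) (e₁ e₂ : P) (y : M) :
    fieldDeriv e₂ (familyVelocity e₁ Φ) p y = fieldDeriv e₁ (familyVelocity e₂ Φ) p y +
      bracket (familyVelocity e₁ Φ p) (familyVelocity e₂ Φ p) y := by
  refine tangent_ext fun f hf => ?_
  obtain ⟨x, hx⟩ := (Φ p).surjective y
  have hxy : Φ p x = y := hx
  subst hxy
  have hfam := fun e : P => hΦ.fieldFamily g hW e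
  have hcomp : ContDiffAt ℝ ∞ (fun p => f (Φ p x)) p :=
    (ContMDiffAt.comp (g := f) p hf.contMDiffAt (hΦ.contMDiffAt_param hW hp x)).contDiffAt
  have hsymm : IsSymmSndFDerivAt ℝ (fun p => f (Φ p x)) p :=
    hcomp.isSymmSndFDerivAt (by simpa using! two_le_infty)
  have hdd : HasFDerivAt (fderiv ℝ (fun p => f (Φ p x)))
      (fderiv ℝ (fderiv ℝ (fun p => f (Φ p x))) p) p :=
    ((hcomp.fderiv_right (m := ∞) (by simp)).differentiableAt (by simp)).hasFDerivAt
  have hfirst : ∀ e, (fun p => dFun (n := n) f (Φ p x) (familyVelocity e Φ p (Φ p x))) =ᶠ[𝓝 p]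
      fun p => fderiv ℝ (fun p => f (Φ p x)) p e := by
    intro e
    filter_upwards [hW.mem_nhds hp] with q hq
    have h1 := hasLineDerivAt_comp_family hW hΦ (FunFamily.const (W := W) hf) hq e x
    have h2 : paramDeriv e (fun (_ : P) x => f x) q (Φ q x) = 0 := by simp [paramDeriv]
    rw [h2, zero_add] at h1
    have h3 : DifferentiableAt ℝ (fun p => f (Φ p x)) q :=
      (ContMDiffAt.comp (g := f) q hf.contMDiffAt
        (hΦ.contMDiffAt_param hW hq x)).contDiffAt.differentiableAt (by simp)
    exact h1.unique (h3.hasFDerivAt.hasLineDerivAt e)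
  have hsecond : ∀ e e' : P, fderiv ℝ (fderiv ℝ (fun p => f (Φ p x))) p e' e =
      dFun (n := n) f (Φ p x) (fieldDeriv e' (familyVelocity e Φ) p (Φ p x)) +
        dFun (n := n) (fun y => dFun (n := n) f y (familyVelocity e Φ p y)) (Φ p x)
          (familyVelocity e' Φ p (Φ p x)) := by
    intro e e'
    have h1 := hasLineDerivAt_comp_family hW hΦ ((hfam e).dFun hf) hp e' x
    rw [dFun_fieldDeriv hW (hfam e) hp] at h1
    have h2 : HasFDerivAt (fun p => fderiv ℝ (fun p => f (Φ p x)) p e)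
        ((ContinuousLinearMap.apply ℝ ℝ e).comp (fderiv ℝ (fderiv ℝ (fun p => f (Φ p x))) p)) p :=
      (ContinuousLinearMap.apply ℝ ℝ e).hasFDerivAt.comp p hdd
    have h3 := (h2.congr_of_eventuallyEq (hfirst e)).hasLineDerivAt e'
    exact (h1.unique h3).symm
  have h12 := hsecond e₁ e₂
  have h21 := hsecond e₂ e₁
  have hs := hsymm.eq e₂ e₁
  have hb := dFun_mlieBracket (hf (Φ p x)) ((familyVelocity e₁ Φ p).diffAt (Φ p x))
    ((familyVelocity e₂ Φ p).diffAt (Φ p x))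
  rw [map_add, bracket_apply, hb]
  linarith

end Velocity

/-! ### The first variation of the energy -/

section ParamIntegral

/-- Differentiation under an integral over a compact interval, for functions that are continuous
with their derivative on an open strip. -/
theorem hasDerivAt_intervalIntegral_of_continuousOn {ε a b : ℝ} {J : Set ℝ} (hε : 0 < ε)
    (hab : a ≤ b) (hJ : Icc a b ⊆ J) {f f' : ℝ × ℝ → ℝ} (hf : ContinuousOn f (Ioo (-ε) ε ×ˢ J))
    (hf' : ContinuousOn f' (Ioo (-ε) ε ×ˢ J))
    (hd : ∀ s ∈ Ioo (-ε) ε, ∀ t ∈ J, HasDerivAt (fun s => f (s, t)) (f' (s, t)) s) :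
    HasDerivAt (fun s => ∫ t in a..b, f (s, t)) (∫ t in a..b, f' (0, t)) 0 := by
  have hsub : Icc (-(ε / 2)) (ε / 2) ×ˢ Icc a b ⊆ Ioo (-ε) ε ×ˢ J :=
    Set.prod_mono (Icc_subset_Ioo (by linarith) (by linarith)) hJ
  obtain ⟨C, hC⟩ := (isCompact_Icc.prod isCompact_Icc).exists_bound_of_continuousOn (hf'.mono hsub)
  have hu : uIcc a b = Icc a b := uIcc_of_le hab
  have hslice : ∀ {F : ℝ × ℝ → ℝ}, ContinuousOn F (Ioo (-ε) ε ×ˢ J) → ∀ s ∈ Ioo (-ε) ε,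
      ContinuousOn (fun t => F (s, t)) (uIcc a b) := by
    intro F hF s hs
    rw [hu]
    exact hF.comp (by fun_prop) fun t ht => ⟨hs, hJ ht⟩
  have h0 : (0 : ℝ) ∈ Ioo (-ε) ε := ⟨by linarith, hε⟩
  have hnhds : Ioo (-(ε / 2)) (ε / 2) ∈ 𝓝 (0 : ℝ) := Ioo_mem_nhds (by linarith) (by linarith)
  have hsm : ∀ s ∈ Ioo (-(ε / 2)) (ε / 2), s ∈ Ioo (-ε) ε := fun s hs =>
    ⟨by linarith [hs.1], by linarith [hs.2]⟩
  refine (intervalIntegral.hasDerivAt_integral_of_dominated_loc_of_deriv_le (μ := volume)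
    (F := fun s t => f (s, t)) (F' := fun s t => f' (s, t)) (x₀ := (0 : ℝ)) (bound := fun _ => C)
    hnhds ?_ ?_ ?_ ?_ ?_ ?_).2
  · filter_upwards [hnhds] with s hs
    exact ((hslice hf s (hsm s hs)).intervalIntegrable.def'.aestronglyMeasurable)
  · exact (hslice hf 0 h0).intervalIntegrable
  · exact ((hslice hf' 0 h0).intervalIntegrable.def'.aestronglyMeasurable)
  · refine ae_of_all _ fun t ht s hs => hC (s, t) ⟨Ioo_subset_Icc_self hs, ?_⟩
    rw [← hu]
    exact uIoc_subset_uIcc ht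
  · exact intervalIntegrable_const
  · refine ae_of_all _ fun t ht s hs => hd s (hsm s hs) t (hJ ?_)
    rw [← hu]
    exact uIoc_subset_uIcc ht

end ParamIntegral

section Variation

variable {n : ℕ} {M : Type*} [TopologicalSpace M] [ChartedSpace (EuclideanSpace ℝ (Fin n)) M]
  [IsManifold (𝓡 n) ∞ M] [CompactSpace M] [T2Space M] [MeasurableSpace M] [BorelSpace M]

/-- Along a curve in the parameter space, the points `Φ p x` move with the velocity of the family.
-/
theorem mfderiv_line_eq_pointVelocity {P : Type*} [NormedAddCommGroup P] [NormedSpace ℝ P]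
    {W : Set P} {Φ : P → Diff n M} (hW : IsOpen W) (hΦ : DiffFamily W Φ) {l : ℝ → P} {e : P}
    {r : ℝ} (hl : HasDerivAt l e r) (hr : l r ∈ W) (x : M) :
    mfderiv 𝓘(ℝ, ℝ) (𝓡 n) (fun r => Φ (l r) x) r (1 : ℝ) = pointVelocity e Φ (l r) x := by
  have h1 : MDifferentiableAt 𝓘(ℝ, ℝ) 𝓘(ℝ, P) l r :=
    hl.differentiableAt.mdifferentiableAt
  have h2 := (hΦ.contMDiffAt_param hW hr x).mdifferentiableAt (by simp)
  have h3 := mfderiv_comp (g := fun p : P => Φ p x) (f := l) r h2 h1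
  have h4 : mfderiv 𝓘(ℝ, ℝ) 𝓘(ℝ, P) l r (1 : ℝ) = e := by
    rw [mfderiv_eq_fderiv]
    exact hl.deriv
  refine (congrArg (fun L : ℝ →L[ℝ] EuclideanSpace ℝ (Fin n) => L 1) h3).trans ?_
  exact congrArg (mfderiv 𝓘(ℝ, P) (𝓡 n) (fun p : P => Φ p x) (l r)) h4

variable {g : Metric n M} {S J : Set ℝ}

/-- The left side of the abstract Euler–Arnold equation, a functional on `𝔛(M)`. -/
def eulerArnoldTerm (g : Metric n M) (α β κ : ℝ) (u : ℝ → VectorFields n M) (t : ℝ)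
    (w : VectorFields n M) : ℝ :=
  innerABK g α β κ (timeDeriv u t) w + adStar (u t) (innerABK g α β κ (u t)) w

theorem solvesEulerArnold_iff (α β κ : ℝ) (u : ℝ → VectorFields n M) :
    SolvesEulerArnold g α β κ J u ↔ ∀ t ∈ J, ∀ w, eulerArnoldTerm g α β κ u t w = 0 := by
  refine forall₂_congr fun t _ => ?_
  rw [funext_iff]
  rfl

theorem eulerArnoldTerm_eq (α β κ : ℝ) (u : ℝ → VectorFields n M) (t : ℝ)
    (w : VectorFields n M) : eulerArnoldTerm g α β κ u t w =
      innerABK g α β κ (timeDeriv u t) w - innerABK g α β κ (u t) (bracket (u t) w) := by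
  unfold eulerArnoldTerm adStar
  rw [adField_eq, innerABK_neg_right, sub_eq_add_neg]

theorem timeDeriv_congr {u v : ℝ → VectorFields n M} {t : ℝ} (h : u =ᶠ[𝓝 t] v) :
    timeDeriv u t = timeDeriv v t := by
  rw [timeDeriv_eq, timeDeriv_eq]
  unfold fieldDeriv
  congr 1
  ext1 x
  have h1 : (fun p => toModel (u p x)) =ᶠ[𝓝 t] fun p => toModel (v p x) :=
    h.mono fun s hs => by simp only [hs]
  exact congrArg (fun L : ℝ →L[ℝ] EuclideanSpace ℝ (Fin n) => L 1) h1.fderiv_eq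

theorem eulerArnoldTerm_congr (α β κ : ℝ) {u v : ℝ → VectorFields n M} {t : ℝ}
    (h : u =ᶠ[𝓝 t] v) (w : VectorFields n M) :
    eulerArnoldTerm g α β κ u t w = eulerArnoldTerm g α β κ v t w := by
  unfold eulerArnoldTerm
  rw [timeDeriv_congr h, h.self_of_nhds]

/-- The time derivative of a two-parameter family at fixed `s`. -/
theorem timeDeriv_slice {W : Set (ℝ × ℝ)} (hW : IsOpen W) {u : ℝ × ℝ → VectorFields n M}
    (hu : FieldFamily g W u) {s t : ℝ} (hst : (s, t) ∈ W) :
    timeDeriv (fun t => u (s, t)) t = fieldDeriv ((0 : ℝ), (1 : ℝ)) u (s, t) := by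
  unfold timeDeriv fieldDeriv
  congr 1
  ext1 x
  have h1 := (hu.differentiableAt hW hst x).hasFDerivAt
  have h2 : HasDerivAt (fun t : ℝ => (s, t)) ((0 : ℝ), (1 : ℝ)) t :=
    (hasDerivAt_const t s).prodMk (hasDerivAt_id t)
  exact (HasFDerivAt.comp_hasDerivAt (l := fun p => toModel (u p x)) (f := fun t : ℝ => (s, t))
    t h1 h2).deriv

theorem IsSmoothFamily.diffFamily {Φ : ℝ → ℝ → Diff n M} (hΦ : IsSmoothFamily S J Φ) :
    DiffFamily (S ×ˢ J) (fun p : ℝ × ℝ => Φ p.1 p.2) := by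
  have h : ContMDiff (𝓘(ℝ, ℝ × ℝ).prod (𝓡 n)) (𝓘(ℝ, ℝ).prod (𝓘(ℝ, ℝ).prod (𝓡 n))) ∞
      (fun q : (ℝ × ℝ) × M => (q.1.1, q.1.2, q.2)) :=
    (contDiff_fst.contMDiff.comp contMDiff_fst).prodMk
      ((contDiff_snd.contMDiff.comp contMDiff_fst).prodMk contMDiff_snd)
  exact ContMDiffOn.comp hΦ h.contMDiffOn fun q hq => ⟨hq.1.1, hq.1.2, mem_univ _⟩

/-- The reduced velocity of the curve `t ↦ Φ s t` is the velocity of the family in the direction of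
`t`. -/
theorem rightTranslate_velocity_eq (hS : IsOpen S) (hJ : IsOpen J) {Φ : ℝ → ℝ → Diff n M}
    (hΦ : IsSmoothFamily S J Φ) {s t : ℝ} (hs : s ∈ S) (ht : t ∈ J) :
    rightTranslate (Φ s t) (velocity (Φ s) t) =
      familyVelocity ((0 : ℝ), (1 : ℝ)) (fun p : ℝ × ℝ => Φ p.1 p.2) (s, t) := by
  unfold rightTranslate familyVelocity
  congr 1
  ext1 y
  have h2 : HasDerivAt (fun t : ℝ => (s, t)) ((0 : ℝ), (1 : ℝ)) t :=
    (hasDerivAt_const t s).prodMk (hasDerivAt_id t)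
  exact mfderiv_line_eq_pointVelocity (hS.prod hJ) hΦ.diffFamily h2 ⟨hs, ht⟩ _

theorem energy_eq (hS : IsOpen S) (hJ : IsOpen J) {Φ : ℝ → ℝ → Diff n M}
    (hΦ : IsSmoothFamily S J Φ) (α β κ : ℝ) {a b s : ℝ} (hab : a ≤ b) (hI : Icc a b ⊆ J)
    (hs : s ∈ S) : energy g α β κ a b (Φ s) = (1 / 2) * ∫ t in a..b, innerABK g α β κ
        (familyVelocity ((0 : ℝ), (1 : ℝ)) (fun p : ℝ × ℝ => Φ p.1 p.2) (s, t))
        (familyVelocity ((0 : ℝ), (1 : ℝ)) (fun p : ℝ × ℝ => Φ p.1 p.2) (s, t)) := by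
  unfold energy
  congr 1
  refine intervalIntegral.integral_congr fun t ht => ?_
  rw [uIcc_of_le hab] at ht
  simp only [metricDiff]
  rw [rightTranslate_velocity_eq hS hJ hΦ hs (hI ht)]

/-- A family that is constant along a line has zero velocity in that direction. It applies to a
variation at the fixed endpoints. -/
theorem familyVelocity_eq_zero {P : Type*} [NormedAddCommGroup P] [NormedSpace ℝ P]
    [FiniteDimensional ℝ P] {W : Set P} {Φ : P → Diff n M} (hW : IsOpen W)
    (hΦ : DiffFamily W Φ) {p e : P} (hp : p ∈ W) {ψ : Diff n M}
    (h : ∀ᶠ r in 𝓝 (0 : ℝ), Φ (p + r • e) = ψ) : familyVelocity e Φ p = 0 := by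
  ext1 y
  rw [familyVelocity_apply hW hΦ hp]
  have hl : HasDerivAt (fun r : ℝ => p + r • e) e 0 := by
    simpa using ((hasDerivAt_id (0 : ℝ)).smul_const e).const_add p
  have h0 : p + (0 : ℝ) • e = p := by simp
  have h1 := mfderiv_line_eq_pointVelocity hW hΦ hl (by rwa [h0]) ((Φ p).symm y)
  have h2 : mfderiv 𝓘(ℝ, ℝ) (𝓡 n) (fun r : ℝ => Φ (p + r • e) ((Φ p).symm y)) 0 = 0 := by
    have h3 : (fun r : ℝ => Φ (p + r • e) ((Φ p).symm y)) =ᶠ[𝓝 0] fun _ => ψ ((Φ p).symm y) :=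
      h.mono fun r hr => by simp only [hr]
    refine (h3.mfderiv_eq).trans ?_
    exact mfderiv_const
  have h4 : toModel (pointVelocity e Φ (p + (0 : ℝ) • e) ((Φ p).symm y)) = 0 :=
    h1.symm.trans (congrArg (fun L : ℝ →L[ℝ] EuclideanSpace ℝ (Fin n) => L 1) h2)
  rw [h0] at h4
  exact h4

/-- The first variation formula: the derivative of the energy at `s = 0` is minus the integral of
the Euler–Arnold functional of the curve, evaluated on the variation field. -/
theorem hasDerivAt_energy (hJ : IsOpen J) (α β κ : ℝ) {a b ε : ℝ} (hab : a < b)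
    (hI : Icc a b ⊆ J) (hε : 0 < ε) {φ : ℝ → Diff n M} {Φ : ℝ → ℝ → Diff n M}
    (hΦ : IsSmoothFamily (Ioo (-ε) ε) J Φ) (hφ : ∀ t ∈ J, Φ 0 t = φ t)
    (hend : ∀ s ∈ Ioo (-ε) ε, Φ s a = φ a ∧ Φ s b = φ b) :
    HasDerivAt (fun s => energy g α β κ a b (Φ s))
      (-∫ t in a..b, eulerArnoldTerm g α β κ (reducedVelocity φ) t
        (familyVelocity ((1 : ℝ), (0 : ℝ)) (fun p : ℝ × ℝ => Φ p.1 p.2) (0, t))) 0 := by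
  have hS : IsOpen (Ioo (-ε) ε) := isOpen_Ioo
  have h0 : (0 : ℝ) ∈ Ioo (-ε) ε := ⟨by linarith, hε⟩
  set Ψ : ℝ × ℝ → Diff n M := fun p => Φ p.1 p.2 with hΨ
  set W := Ioo (-ε) ε ×ˢ J with hWdef
  have hW : IsOpen W := hS.prod hJ
  have hfam : DiffFamily W Ψ := hΦ.diffFamily
  set U := familyVelocity ((0 : ℝ), (1 : ℝ)) Ψ with hUdef
  set V := familyVelocity ((1 : ℝ), (0 : ℝ)) Ψ with hVdef
  have hU : FieldFamily g W U := hfam.fieldFamily g hW _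
  have hV : FieldFamily g W V := hfam.fieldFamily g hW _
  have hred : ∀ t ∈ J, reducedVelocity φ t = U (0, t) := by
    intro t ht
    rw [hUdef, ← rightTranslate_velocity_eq hS hJ hΦ h0 ht]
    unfold reducedVelocity rightTranslate
    congr 1
    ext1 y
    have h1 : (fun s => φ s ((φ t).symm y)) =ᶠ[𝓝 t] fun s => Φ 0 s ((φ t).symm y) := by
      filter_upwards [hJ.mem_nhds ht] with s hs
      rw [hφ s hs]
    have h2 : mfderiv 𝓘(ℝ, ℝ) (𝓡 n) (fun s => φ s ((φ t).symm y)) t =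
        mfderiv 𝓘(ℝ, ℝ) (𝓡 n) (fun s => Φ 0 s ((φ t).symm y)) t := h1.mfderiv_eq
    rw [hφ t ht]
    exact congrArg (fun L : ℝ →L[ℝ] EuclideanSpace ℝ (Fin n) => L 1) h2
  have hterm : ∀ t ∈ J, eulerArnoldTerm g α β κ (reducedVelocity φ) t (V (0, t)) =
      innerABK g α β κ (fieldDeriv ((0 : ℝ), (1 : ℝ)) U (0, t)) (V (0, t)) -
        innerABK g α β κ (U (0, t)) (bracket (U (0, t)) (V (0, t))) := by
    intro t ht
    have h1 : reducedVelocity φ =ᶠ[𝓝 t] fun t => U (0, t) := by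
      filter_upwards [hJ.mem_nhds ht] with s hs
      exact hred s hs
    rw [eulerArnoldTerm_congr α β κ h1, eulerArnoldTerm_eq, timeDeriv_slice hW hU ⟨h0, ht⟩]
  -- the structure equation `∂_s U = ∂_t V + [U, V]`
  have hUs : ∀ t ∈ J, fieldDeriv ((1 : ℝ), (0 : ℝ)) U (0, t) =
      fieldDeriv ((0 : ℝ), (1 : ℝ)) V (0, t) + bracket (U (0, t)) (V (0, t)) := by
    intro t ht
    ext1 x
    exact fieldDeriv_familyVelocity g hW hfam ⟨h0, ht⟩ _ _ x
  -- differentiation under the integral sign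
  have hdU : FieldFamily g W (fieldDeriv ((1 : ℝ), (0 : ℝ)) U) := hU.deriv hW _
  have hder : ∀ s ∈ Ioo (-ε) ε, ∀ t ∈ J, HasDerivAt
      (fun s => innerABK g α β κ (U (s, t)) (U (s, t)))
      (2 * innerABK g α β κ (fieldDeriv ((1 : ℝ), (0 : ℝ)) U (s, t)) (U (s, t))) s := by
    intro s hs t ht
    have h1 := hasLineDerivAt_innerABK hW hU hU α β κ (p := (s, t)) ⟨hs, ht⟩ ((1 : ℝ), (0 : ℝ))
    rw [innerABK_comm g α β κ (U (s, t)), ← two_mul] at h1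
    have h2 : ((s, t) : ℝ × ℝ) = ((0 : ℝ), t) + s • ((1 : ℝ), (0 : ℝ)) := by simp
    rw [h2] at h1
    have h3 := hasDerivAt_of_hasLineDerivAt h1
    rw [← h2] at h3
    refine h3.congr_of_eventuallyEq (Eventually.of_forall fun r => ?_)
    simp
  have hE := hasDerivAt_intervalIntegral_of_continuousOn hε hab.le hI
    (f := fun p => innerABK g α β κ (U p) (U p))
    (f' := fun p => 2 * innerABK g α β κ (fieldDeriv ((1 : ℝ), (0 : ℝ)) U p) (U p))
    (continuousOn_innerABK hW hU hU α β κ)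
    (continuousOn_const.mul (continuousOn_innerABK hW hdU hU α β κ)) hder
  have hE2 := hE.const_mul (1 / 2)
  have hen : (fun s => energy g α β κ a b (Φ s)) =ᶠ[𝓝 0]
      fun s => 1 / 2 * ∫ t in a..b, innerABK g α β κ (U (s, t)) (U (s, t)) := by
    filter_upwards [hS.mem_nhds h0] with s hs
    exact energy_eq hS hJ hΦ α β κ hab.le hI hs
  refine (hE2.congr_of_eventuallyEq hen).congr_deriv ?_
  -- integration by parts in time
  have hslice : ∀ {F : ℝ × ℝ → ℝ}, ContinuousOn F W →
      IntervalIntegrable (fun t => F (0, t)) volume a b := by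
    intro F hF
    refine ContinuousOn.intervalIntegrable ?_
    rw [uIcc_of_le hab.le]
    exact hF.comp (by fun_prop) fun t ht => ⟨h0, hI ht⟩
  have hdV : FieldFamily g W (fieldDeriv ((0 : ℝ), (1 : ℝ)) V) := hV.deriv hW _
  have hdUt : FieldFamily g W (fieldDeriv ((0 : ℝ), (1 : ℝ)) U) := hU.deriv hW _
  have hiV := continuousOn_innerABK hW hdV hU α β κ
  have hiU := continuousOn_innerABK hW hV hdUt α β κ
  have hiS := continuousOn_innerABK hW hdU hU α β κ
  have hparts : ∫ t in a..b, (innerABK g α β κ (fieldDeriv ((0 : ℝ), (1 : ℝ)) V (0, t)) (U (0, t)) +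
      innerABK g α β κ (V (0, t)) (fieldDeriv ((0 : ℝ), (1 : ℝ)) U (0, t))) = 0 := by
    have h1 : ∀ t ∈ uIcc a b, HasDerivAt (fun t => innerABK g α β κ (V (0, t)) (U (0, t)))
        (innerABK g α β κ (fieldDeriv ((0 : ℝ), (1 : ℝ)) V (0, t)) (U (0, t)) +
          innerABK g α β κ (V (0, t)) (fieldDeriv ((0 : ℝ), (1 : ℝ)) U (0, t))) t := by
      intro t ht
      rw [uIcc_of_le hab.le] at ht
      have h1 := hasLineDerivAt_innerABK hW hV hU α β κ (p := ((0 : ℝ), t)) ⟨h0, hI ht⟩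
        ((0 : ℝ), (1 : ℝ))
      have h2 : (((0 : ℝ), t) : ℝ × ℝ) = ((0 : ℝ), (0 : ℝ)) + t • ((0 : ℝ), (1 : ℝ)) := by simp
      rw [h2] at h1
      have h3 := hasDerivAt_of_hasLineDerivAt h1
      rw [← h2] at h3
      refine h3.congr_of_eventuallyEq (Eventually.of_forall fun r => ?_)
      simp
    rw [intervalIntegral.integral_eq_sub_of_hasDerivAt h1
      ((hslice hiV).add (hslice hiU))]
    -- the boundary terms vanish because the endpoints are fixed
    have hz : ∀ c ∈ J, (∀ s ∈ Ioo (-ε) ε, Φ s c = φ c) → V (0, c) = 0 := by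
      intro c hc hcs
      refine familyVelocity_eq_zero hW hfam (p := (0, c)) ⟨h0, hc⟩ (ψ := φ c) ?_
      filter_upwards [hS.mem_nhds h0] with r hr
      have := hcs r hr
      simpa [hΨ] using this
    rw [hz a (hI ⟨le_rfl, hab.le⟩) fun s hs => (hend s hs).1,
      hz b (hI ⟨hab.le, le_rfl⟩) fun s hs => (hend s hs).2, innerABK_zero_left, innerABK_zero_left,
      sub_self]
  have hsum : ∫ t in a..b, (innerABK g α β κ (fieldDeriv ((1 : ℝ), (0 : ℝ)) U (0, t)) (U (0, t)) +
      eulerArnoldTerm g α β κ (reducedVelocity φ) t (V (0, t))) = 0 := by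
    refine Eq.trans ?_ hparts
    refine intervalIntegral.integral_congr fun t ht => ?_
    rw [uIcc_of_le hab.le] at ht
    simp only [hterm t (hI ht), hUs t (hI ht), innerABK_add_left,
      innerABK_comm g α β κ (bracket (U (0, t)) (V (0, t))),
      innerABK_comm g α β κ (fieldDeriv ((0 : ℝ), (1 : ℝ)) U (0, t))]
    ring
  -- the functional is integrable along the curve, being a combination of continuous terms
  have hiT : IntervalIntegrable
      (fun t => eulerArnoldTerm g α β κ (reducedVelocity φ) t (V (0, t))) volume a b := by
    have h1 : IntervalIntegrable (fun t =>
        innerABK g α β κ (fieldDeriv ((0 : ℝ), (1 : ℝ)) V (0, t)) (U (0, t)) +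
        innerABK g α β κ (V (0, t)) (fieldDeriv ((0 : ℝ), (1 : ℝ)) U (0, t)) -
        innerABK g α β κ (fieldDeriv ((1 : ℝ), (0 : ℝ)) U (0, t)) (U (0, t))) volume a b :=
      ((hslice hiV).add (hslice hiU)).sub (hslice hiS)
    refine (intervalIntegrable_congr fun t ht => ?_).1 h1
    have ht' : t ∈ Icc a b := by
      rw [← uIcc_of_le hab.le]
      exact uIoc_subset_uIcc ht
    simp only [hterm t (hI ht'), hUs t (hI ht'), innerABK_add_left,
      innerABK_comm g α β κ (bracket (U (0, t)) (V (0, t))),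
      innerABK_comm g α β κ (fieldDeriv ((0 : ℝ), (1 : ℝ)) U (0, t))]
    ring
  rw [intervalIntegral.integral_add (hslice hiS) hiT] at hsum
  rw [intervalIntegral.integral_const_mul]
  linarith

end Variation

/-! ### Diffeomorphisms with prescribed initial velocity -/

section Shear

variable {E : Type*} [NormedAddCommGroup E] [NormedSpace ℝ E] [FiniteDimensional ℝ E]

/-- Small compactly supported perturbations of the identity are diffeomorphisms. -/
theorem exists_perturbation_homeomorph {H : E → E} (hH : ContDiff ℝ ∞ H)
    (hc : HasCompactSupport H) :
    ∃ δ > (0 : ℝ), ∀ r ∈ Ioo (-δ) δ, ∃ h : E ≃ₜ E, (∀ y, h y = y + r • H y) ∧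
      ContDiff ℝ ∞ h.symm := by
  have : CompleteSpace E := FiniteDimensional.complete ℝ E
  obtain ⟨C, hC⟩ := hH.lipschitzWith_of_hasCompactSupport hc (by simp)
  -- `H` has Lipschitz constant `C`, hence `r • H` has Lipschitz constant at most `1 / 2`
  refine ⟨1 / (2 * (C + 1)), by positivity, fun r hr => ?_⟩
  have hCn : (0 : ℝ) ≤ C := C.2
  have hrC : |r| * C ≤ 1 / 2 := by
    have h1 : |r| < 1 / (2 * (C + 1)) := abs_lt.2 ⟨hr.1, hr.2⟩
    have h2 : |r| * (2 * (C + 1)) < 1 := by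
      rwa [lt_div_iff₀ (by positivity)] at h1
    nlinarith [abs_nonneg r]
  let f : E → E := fun y => y + r • H y
  have hf : ContDiff ℝ ∞ f := contDiff_id.add (contDiff_const.smul hH)
  have happ : ApproximatesLinearOn f
      ((ContinuousLinearEquiv.refl ℝ E : E ≃L[ℝ] E) : E →L[ℝ] E) univ (1 / 2) := by
    intro x _ y _
    have h1 : f x - f y - ((ContinuousLinearEquiv.refl ℝ E : E ≃L[ℝ] E) : E →L[ℝ] E) (x - y) =
        r • (H x - H y) := by
      simp only [f, ContinuousLinearEquiv.coe_coe, ContinuousLinearEquiv.refl_apply, smul_sub]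
      abel
    rw [h1, norm_smul, Real.norm_eq_abs]
    have h2 := hC.dist_le_mul x y
    rw [dist_eq_norm, dist_eq_norm] at h2
    calc |r| * ‖H x - H y‖ ≤ |r| * (C * ‖x - y‖) := by gcongr
      _ = (|r| * C) * ‖x - y‖ := by ring
      _ ≤ (1 / 2) * ‖x - y‖ := by gcongr
      _ = _ := by simp
  have hN : Subsingleton E ∨ (1 / 2 : NNReal) <
      ‖((ContinuousLinearEquiv.refl ℝ E : E ≃L[ℝ] E).symm : E →L[ℝ] E)‖₊⁻¹ := by
    rcases subsingleton_or_nontrivial E with h | h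
    · exact Or.inl h
    · right
      have h1 : ‖((ContinuousLinearEquiv.refl ℝ E : E ≃L[ℝ] E).symm : E →L[ℝ] E)‖₊ = 1 := by
        have : ((ContinuousLinearEquiv.refl ℝ E : E ≃L[ℝ] E).symm : E →L[ℝ] E) =
            ContinuousLinearMap.id ℝ E := rfl
        rw [this]
        exact nnnorm_one (G := E →L[ℝ] E)
      rw [h1, inv_one]
      exact NNReal.half_lt_self one_ne_zero
  let h := happ.toHomeomorph f hN
  have hh : ∀ y, h y = y + r • H y := fun y => rfl
  refine ⟨h, hh, ?_⟩
  -- the derivative is invertible, since `‖r • DH‖ ≤ 1 / 2`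
  have hinj : ∀ a, Function.Injective (fderiv ℝ f a) := by
    intro a
    have h1 : fderiv ℝ f a = ContinuousLinearMap.id ℝ E + r • fderiv ℝ H a :=
      ((hasFDerivAt_id a).add
        (((hH.differentiable (by simp)) a).hasFDerivAt.const_smul r)).fderiv
    refine (injective_iff_map_eq_zero (fderiv ℝ f a)).2 fun w hw => ?_
    rw [h1] at hw
    have h2 : w = -(r • fderiv ℝ H a w) := eq_neg_of_add_eq_zero_left hw
    have h3 : ‖fderiv ℝ H a w‖ ≤ C * ‖w‖ :=
      ((fderiv ℝ H a).le_opNorm w).trans (by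
        gcongr
        exact norm_fderiv_le_of_lipschitz ℝ hC)
    have h4 : ‖w‖ ≤ (1 / 2) * ‖w‖ := by
      calc ‖w‖ = |r| * ‖fderiv ℝ H a w‖ := by
            conv_lhs => rw [h2, norm_neg, norm_smul, Real.norm_eq_abs]
        _ ≤ |r| * (C * ‖w‖) := by gcongr
        _ = (|r| * C) * ‖w‖ := by ring
        _ ≤ (1 / 2) * ‖w‖ := by gcongr
    have h5 := norm_nonneg w
    exact norm_eq_zero.1 (by linarith)
  refine h.contDiff_symm (f₀' := fun a =>
    (LinearEquiv.ofInjectiveEndo (fderiv ℝ f a : E →ₗ[ℝ] E) (hinj a)).toContinuousLinearEquiv)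
    (fun a => ?_) hf
  exact (hf.differentiable (by simp) a).hasFDerivAt

end Shear

section ChartLift

variable {n : ℕ} {M : Type*} [TopologicalSpace M] [ChartedSpace (EuclideanSpace ℝ (Fin n)) M]

open Classical in
/-- The map of `M` which is `k` in the preferred chart at `c`, and the identity off the chart. -/
def chartLift (c : M) (k : EuclideanSpace ℝ (Fin n) → EuclideanSpace ℝ (Fin n)) (x : M) : M :=
  if x ∈ (chartAt (EuclideanSpace ℝ (Fin n)) c).source then
    (chartAt (EuclideanSpace ℝ (Fin n)) c).symm (k (chartAt (EuclideanSpace ℝ (Fin n)) c x))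
  else x

theorem chartLift_of_mem {c x : M} (hx : x ∈ (chartAt (EuclideanSpace ℝ (Fin n)) c).source)
    (k : EuclideanSpace ℝ (Fin n) → EuclideanSpace ℝ (Fin n)) : chartLift c k x =
    (chartAt (EuclideanSpace ℝ (Fin n)) c).symm (k (chartAt (EuclideanSpace ℝ (Fin n)) c x)) :=
  if_pos hx

theorem chartLift_of_notMem {c x : M}
    (hx : x ∉ (chartAt (EuclideanSpace ℝ (Fin n)) c).source)
    (k : EuclideanSpace ℝ (Fin n) → EuclideanSpace ℝ (Fin n)) : chartLift c k x = x :=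
  if_neg hx

theorem chartLift_chartLift {c : M} {k k' : EuclideanSpace ℝ (Fin n) → EuclideanSpace ℝ (Fin n)}
    (hk' : MapsTo k' (chartAt (EuclideanSpace ℝ (Fin n)) c).target
      (chartAt (EuclideanSpace ℝ (Fin n)) c).target) (h : Function.LeftInverse k k') :
    Function.LeftInverse (chartLift c k) (chartLift c k') := by
  intro x
  set e := chartAt (EuclideanSpace ℝ (Fin n)) c with he
  by_cases hx : x ∈ e.source
  · have h1 : k' (e x) ∈ e.target := hk' (e.map_source hx)
    rw [chartLift_of_mem hx k', chartLift_of_mem (e.map_target h1) k, e.right_inv h1, h,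
      e.left_inv hx]
  · rw [chartLift_of_notMem hx k', chartLift_of_notMem hx k]

/-- A smooth family of maps of the model space that are the identity off a compact subset `K` of the
target of the chart lifts to a smooth family of maps of `M`. -/
theorem contMDiffOn_chartLift [IsManifold (𝓡 n) ∞ M] [T2Space M] {P : Type*}
    [NormedAddCommGroup P] [NormedSpace ℝ P] {O : Set P} (hO : IsOpen O) (c : M)
    {k : P → EuclideanSpace ℝ (Fin n) → EuclideanSpace ℝ (Fin n)}
    (hk : ContDiffOn ℝ ∞ (fun q : P × EuclideanSpace ℝ (Fin n) => k q.1 q.2) (O ×ˢ univ))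
    (hT : ∀ p ∈ O, MapsTo (k p) (chartAt (EuclideanSpace ℝ (Fin n)) c).target
      (chartAt (EuclideanSpace ℝ (Fin n)) c).target)
    {K : Set (EuclideanSpace ℝ (Fin n))} (hK : IsCompact K)
    (hKT : K ⊆ (chartAt (EuclideanSpace ℝ (Fin n)) c).target)
    (hkK : ∀ p ∈ O, ∀ y ∉ K, k p y = y) :
    ContMDiffOn (𝓘(ℝ, P).prod (𝓡 n)) (𝓡 n) ∞ (fun q : P × M => chartLift c (k q.1) q.2)
      (O ×ˢ univ) := by
  set e := chartAt (EuclideanSpace ℝ (Fin n)) c with he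
  rintro ⟨p, x⟩ ⟨hp, -⟩
  refine ContMDiffAt.contMDiffWithinAt ?_
  by_cases hx : x ∈ e.source
  · have h1 : ContMDiffAt (𝓡 n) 𝓘(ℝ, EuclideanSpace ℝ (Fin n)) ∞ e x :=
      contMDiffAt_extChartAt' (I := 𝓡 n) hx
    have h2 : ContMDiffAt (𝓘(ℝ, P).prod (𝓡 n)) 𝓘(ℝ, P × EuclideanSpace ℝ (Fin n)) ∞
        (fun q : P × M => (q.1, e q.2)) (p, x) :=
      ContMDiffAt.prodMk_space contMDiffAt_fst
        (ContMDiffAt.comp (g := e) (f := fun q : P × M => q.2) (p, x) h1 contMDiffAt_snd)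
    have h3 : ContDiffAt ℝ ∞ (fun q : P × EuclideanSpace ℝ (Fin n) => k q.1 q.2) (p, e x) :=
      hk.contDiffAt ((hO.prod isOpen_univ).mem_nhds ⟨hp, mem_univ _⟩)
    have h4 : ContMDiffAt (𝓘(ℝ, P).prod (𝓡 n)) 𝓘(ℝ, EuclideanSpace ℝ (Fin n)) ∞
        (fun q : P × M => k q.1 (e q.2)) (p, x) :=
      ContMDiffAt.comp (g := fun q : P × EuclideanSpace ℝ (Fin n) => k q.1 q.2)
        (f := fun q : P × M => (q.1, e q.2)) (p, x) h3.contMDiffAt h2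
    have h5 : ContMDiffAt 𝓘(ℝ, EuclideanSpace ℝ (Fin n)) (𝓡 n) ∞ e.symm (k p (e x)) := by
      have h := contMDiffOn_extChartAt_symm (I := 𝓡 n) (n := ∞) c
      have h2 : (extChartAt (𝓡 n) c).target = e.target := by simp [he]
      rw [h2] at h
      exact h.contMDiffAt (e.open_target.mem_nhds (hT p hp (e.map_source hx)))
    have h6 : ContMDiffAt (𝓘(ℝ, P).prod (𝓡 n)) (𝓡 n) ∞
        (fun q : P × M => e.symm (k q.1 (e q.2))) (p, x) :=
      ContMDiffAt.comp (g := e.symm) (f := fun q : P × M => k q.1 (e q.2)) (p, x) h5 h4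
    refine h6.congr_of_eventuallyEq ?_
    filter_upwards [continuousAt_snd (e.open_source.mem_nhds hx)] with q hq
    exact chartLift_of_mem hq _
  · have hcl : IsClosed (e.symm '' K) :=
      (hK.image_of_continuousOn (e.continuousOn_symm.mono hKT)).isClosed
    have hxK : x ∉ e.symm '' K := by
      rintro ⟨y, hy, rfl⟩
      exact hx (e.map_target (hKT hy))
    have h1 : ContMDiffAt (𝓘(ℝ, P).prod (𝓡 n)) (𝓡 n) ∞ (fun q : P × M => q.2) (p, x) :=
      contMDiffAt_snd
    refine h1.congr_of_eventuallyEq ?_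
    filter_upwards [continuousAt_snd (hcl.isOpen_compl.mem_nhds hxK),
      continuousAt_fst (hO.mem_nhds hp)] with q hq hqO
    by_cases hqs : q.2 ∈ e.source
    · rw [chartLift_of_mem hqs, hkK q.1 hqO _ fun h => hq ⟨_, h, e.left_inv hqs⟩]
      exact e.left_inv hqs
    · exact chartLift_of_notMem hqs _

end ChartLift

section LocalFlow

variable {n : ℕ} {M : Type*} [TopologicalSpace M] [ChartedSpace (EuclideanSpace ℝ (Fin n)) M]
  [IsManifold (𝓡 n) ∞ M] [CompactSpace M] [T2Space M] [MeasurableSpace M] [BorelSpace M]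

theorem contMDiff_chartLift (c : M)
    {k : EuclideanSpace ℝ (Fin n) → EuclideanSpace ℝ (Fin n)} (hk : ContDiff ℝ ∞ k)
    (hT : MapsTo k (chartAt (EuclideanSpace ℝ (Fin n)) c).target
      (chartAt (EuclideanSpace ℝ (Fin n)) c).target)
    {K : Set (EuclideanSpace ℝ (Fin n))} (hK : IsCompact K)
    (hKT : K ⊆ (chartAt (EuclideanSpace ℝ (Fin n)) c).target) (hkK : ∀ y ∉ K, k y = y) :
    ContMDiff (𝓡 n) (𝓡 n) ∞ (chartLift c k) := by
  have h1 := contMDiffOn_chartLift (P := ℝ) isOpen_univ c (k := fun _ => k)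
    (hk.comp contDiff_snd).contDiffOn (fun _ _ => hT) hK hKT fun _ _ => hkK
  have h : ContMDiff (𝓡 n) (𝓘(ℝ, ℝ).prod (𝓡 n)) ∞ (fun x : M => ((0 : ℝ), x)) :=
    contMDiff_const.prodMk contMDiff_id
  exact contMDiffOn_univ.1 (h1.comp h.contMDiffOn fun x _ => ⟨mem_univ _, mem_univ x⟩)

/-- A coordinate field of a chart, multiplied by a function with support in the chart, is the
initial velocity of a smooth family of diffeomorphisms. Perturbations of the identity in the chart
serve instead of the flow of the field. -/
theorem exists_diffFamily_velocity {h : M → ℝ} {c : M} (hh : SmoothFun (n := n) h)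
    (hs : tsupport h ⊆ (chartAt (EuclideanSpace ℝ (Fin n)) c).source) (b : TangentSpace (𝓡 n) c)
    (w : VectorFields n M) (hw : ∀ x, w x = h x • coordField c b x) :
    ∃ δ > (0 : ℝ), ∃ ψ : ℝ → Diff n M, DiffFamily (Ioo (-δ) δ) ψ ∧ (∀ x, ψ 0 x = x) ∧
      familyVelocity (1 : ℝ) ψ 0 = w := by
  set e := chartAt (EuclideanSpace ℝ (Fin n)) c with he
  let b' : EuclideanSpace ℝ (Fin n) := b
  let H : EuclideanSpace ℝ (Fin n) → EuclideanSpace ℝ (Fin n) := fun y => chartExtend c h y • b'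
  have hH : ContDiff ℝ ∞ H := (contDiff_chartExtend hs fun x _ => hh x).smul contDiff_const
  have hHc : HasCompactSupport H := (hasCompactSupport_chartExtend hs).smul_right
  set K := e '' tsupport h with hKdef
  have hK : IsCompact K := isCompact_chart_tsupport hs
  have hKT : K ⊆ e.target := by
    rintro _ ⟨x, hx, rfl⟩
    exact e.map_source (hs hx)
  have hH0 : ∀ y ∉ K, H y = 0 := fun y hy => by
    simp only [H, chartExtend_eq_zero hy, zero_smul]
  obtain ⟨δ, hδ, hex⟩ := exists_perturbation_homeomorph hH hHc
  choose! k hk hksymm using hex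
  have hkK : ∀ r ∈ Ioo (-δ) δ, ∀ y ∉ K, k r y = y := fun r hr y hy => by
    rw [hk r hr, hH0 y hy, smul_zero, add_zero]
  have hkK' : ∀ r ∈ Ioo (-δ) δ, ∀ y ∉ K, (k r).symm y = y := fun r hr y hy => by
    rw [Homeomorph.symm_apply_eq, hkK r hr y hy]
  -- both maps preserve the target: a point with image outside `K` is fixed, by injectivity
  have hT : ∀ r ∈ Ioo (-δ) δ, MapsTo (k r) e.target e.target := by
    intro r hr y hy
    by_cases h1 : k r y ∈ K
    · exact hKT h1
    · rwa [(k r).injective (hkK r hr _ h1)]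
  have hT' : ∀ r ∈ Ioo (-δ) δ, MapsTo (k r).symm e.target e.target := by
    intro r hr y hy
    by_cases h1 : (k r).symm y ∈ K
    · exact hKT h1
    · rwa [(k r).symm.injective (hkK' r hr _ h1)]
  have hkC : ∀ r ∈ Ioo (-δ) δ, ContDiff ℝ ∞ (k r) := fun r hr => by
    have h1 : (k r : EuclideanSpace ℝ (Fin n) → EuclideanSpace ℝ (Fin n)) =
      fun y => y + r • H y := funext (hk r hr)
    rw [h1]
    fun_prop
  classical
  let ψ : ℝ → Diff n M := fun r =>
    if hr : r ∈ Ioo (-δ) δ then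
      { toFun := chartLift c (k r)
        invFun := chartLift c (k r).symm
        left_inv := chartLift_chartLift (hT r hr) (k r).symm_apply_apply
        right_inv := chartLift_chartLift (hT' r hr) (k r).apply_symm_apply
        contMDiff_toFun := contMDiff_chartLift c (hkC r hr) (hT r hr) hK hKT (hkK r hr)
        contMDiff_invFun := contMDiff_chartLift c (hksymm r hr) (hT' r hr) hK hKT (hkK' r hr) }
    else Diffeomorph.refl (𝓡 n) M ∞
  have hψ : ∀ r ∈ Ioo (-δ) δ, ∀ x, ψ r x = chartLift c (k r) x := by
    intro r hr x
    simp only [ψ, dif_pos hr]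
    rfl
  have h0 : (0 : ℝ) ∈ Ioo (-δ) δ := ⟨by linarith, hδ⟩
  have hψ0 : ∀ x, ψ 0 x = x := by
    intro x
    rw [hψ 0 h0]
    by_cases hx : x ∈ e.source
    · rw [chartLift_of_mem hx, hk 0 h0, zero_smul, add_zero]
      exact e.left_inv hx
    · exact chartLift_of_notMem hx _
  have hfam : DiffFamily (Ioo (-δ) δ) ψ := by
    have h1 : ContDiff ℝ ∞ (fun q : ℝ × EuclideanSpace ℝ (Fin n) => q.2 + q.1 • H q.2) :=
      contDiff_snd.add (contDiff_fst.smul (hH.comp contDiff_snd))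
    have h2 := contMDiffOn_chartLift isOpen_Ioo c (k := fun r => k r) (O := Ioo (-δ) δ)
      (h1.contDiffOn.congr fun q hq => hk q.1 hq.1 q.2) hT hK hKT hkK
    exact ContMDiffOn.congr h2 fun q hq => hψ q.1 hq.1 q.2
  -- compare the initial velocity with `w` through the action on functions
  refine ⟨δ, hδ, ψ, hfam, hψ0, ?_⟩
  ext1 x
  refine tangent_ext fun f hf => ?_
  have h1 := hasLineDerivAt_comp_family isOpen_Ioo hfam (FunFamily.const (W := Ioo (-δ) δ) hf) h0
    (1 : ℝ) x
  have h2 : paramDeriv (1 : ℝ) (fun (_ : ℝ) x => f x) 0 (ψ 0 x) = 0 := by simp [paramDeriv]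
  rw [h2, zero_add, hψ0 x] at h1
  have h3 := hasDerivAt_of_hasLineDerivAt_one h1
  refine h3.unique ?_
  rw [hw x, map_smul, smul_eq_mul]
  by_cases hx : x ∈ e.source
  · have hd : DifferentiableAt ℝ (f ∘ e.symm) (e x) := by
      have h := contMDiffOn_extChartAt_symm (I := 𝓡 n) (n := ∞) c
      have h2 : (extChartAt (𝓡 n) c).target = e.target := by simp [he]
      rw [h2] at h
      have h3 := h.contMDiffAt (e.open_target.mem_nhds (e.map_source hx))
      exact (ContMDiffAt.comp (g := f) (e x) hf.contMDiffAt h3).contDiffAt.differentiableAt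
        (by simp)
    have hHx : H (e x) = h x • b' := by
      have h4 := (chartExtend_eventuallyEq h (e.map_source hx)).self_of_nhds
      simp only [H]
      rw [h4]
      change h (e.symm (e x)) • b' = _
      rw [e.left_inv hx]
    have hl : HasDerivAt (fun r : ℝ => e x + r • H (e x)) (H (e x)) 0 := by
      simpa using ((hasDerivAt_id (0 : ℝ)).smul_const (H (e x))).const_add (e x)
    have h5 : HasDerivAt (fun r : ℝ => (f ∘ e.symm) (e x + r • H (e x)))
        (fderiv ℝ (f ∘ e.symm) (e x) (H (e x))) 0 := by
      refine HasFDerivAt.comp_hasDerivAt (l := f ∘ e.symm) 0 ?_ hl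
      simpa using hd.hasFDerivAt
    rw [hHx, map_smul, smul_eq_mul] at h5
    rw [dFun_coordField hx (FunSmoothAt.diffAt (hf x))]
    refine h5.congr_of_eventuallyEq ?_
    filter_upwards [isOpen_Ioo.mem_nhds h0] with r hr
    rw [hψ r hr, chartLift_of_mem hx, hk r hr, hHx]
    rfl
  · have hx0 : h x = 0 := image_eq_zero_of_notMem_tsupport fun h6 => hx (hs h6)
    rw [hx0, zero_mul]
    refine (hasDerivAt_const (0 : ℝ) (f x)).congr_of_eventuallyEq ?_
    filter_upwards [isOpen_Ioo.mem_nhds h0] with r hr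
    rw [hψ r hr, chartLift_of_notMem hx]

end LocalFlow

/-! ### Geodesics -/

section Linearity

variable {n : ℕ} {M : Type*} [TopologicalSpace M] [ChartedSpace (EuclideanSpace ℝ (Fin n)) M]
  [IsManifold (𝓡 n) ∞ M] [CompactSpace M] [T2Space M] [MeasurableSpace M] [BorelSpace M]
  (g : Metric n M) (α β κ : ℝ)

theorem innerABK_smul_left (r : ℝ) (v w : VectorFields n M) :
    innerABK g α β κ (r • v) w = r * innerABK g α β κ v w := by
  simp only [innerABK_eq]
  have h1 : ∀ x, twoFormInner g (dForm (flat g (r • v : VectorFields n M))) (dForm (flat g w)) x =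
      r * twoFormInner g (dForm (flat g v)) (dForm (flat g w)) x := by
    intro x
    have hi : ∀ Y : VectorFields n M, ∀ y, g.inner y (Y y) ((r • v : VectorFields n M) y) =
        r * g.inner y (Y y) (v y) := fun Y y => map_smul (g.inner y (Y y)) r (v y)
    have hd : ∀ X Y : VectorFields n M,
        dFun (n := n) (fun y => g.inner y (Y y) ((r • v : VectorFields n M) y)) x (X x) =
          r * dFun (n := n) (fun y => g.inner y (Y y) (v y)) x (X x) := by
      intro X Y
      simp only [hi]
      have hm := dFun_mul (n := n) (f := fun _ : M => r) (h := fun y => g.inner y (Y y) (v y))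
        (x := x) (FunSmoothAt.diffAt (contMDiff_const x))
        (FunSmoothAt.diffAt (smoothFun_inner g Y v x))
      rw [hm, dFun_const]
      simp
    have h3 : ∀ X Y : VectorFields n M,
        dForm (flat g (r • v : VectorFields n M)) x (X x) (Y x) =
          r * dForm (flat g v) x (X x) (Y x) := by
      intro X Y
      rw [dForm_flat_eq, dForm_flat_eq, hd, hd, hi]
      ring
    simp only [twoFormInner_flat_frame, h3, mul_assoc, ← Finset.mul_sum]
    ring
  have h2 : ∀ x, divergence g (r • v : VectorFields n M) x = r * divergence g v x := by
    intro x
    have h := divergence_smul g (f := fun _ : M => r) (u := v) (x := x)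
      (FunSmoothAt.diffAt (contMDiff_const x)) (v.diffAt x)
    rw [dFun_const] at h
    refine h.trans ?_
    simp
  simp only [h1, h2, mul_assoc]
  rw [integral_const_mul, integral_const_mul, toL2_smul, map_smul, inner_smul_left]
  simp only [conj_trivial]
  ring

theorem innerABK_smul_right (r : ℝ) (v w : VectorFields n M) :
    innerABK g α β κ v (r • w) = r * innerABK g α β κ v w := by
  rw [innerABK_comm, innerABK_smul_left, innerABK_comm]

theorem bracket_add_right (u v w : VectorFields n M) :
    bracket u (v + w) = bracket u v + bracket u w := by
  ext1 x
  exact mlieBracket_add_right (V := u) (W := v) (W₁ := w) (v.diffAt x) (w.diffAt x)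

theorem bracket_smul_right (r : ℝ) (u v : VectorFields n M) :
    bracket u (r • v) = r • bracket u v := by
  ext1 x
  exact mlieBracket_const_smul_right (V := u) (W := v) (v.diffAt x)

theorem eulerArnoldTerm_add (u : ℝ → VectorFields n M) (t : ℝ) (v w : VectorFields n M) :
    eulerArnoldTerm g α β κ u t (v + w) =
      eulerArnoldTerm g α β κ u t v + eulerArnoldTerm g α β κ u t w := by
  simp only [eulerArnoldTerm_eq, bracket_add_right, innerABK_add_right]
  ring

theorem eulerArnoldTerm_smul (u : ℝ → VectorFields n M) (t r : ℝ) (v : VectorFields n M) :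
    eulerArnoldTerm g α β κ u t (r • v) = r * eulerArnoldTerm g α β κ u t v := by
  simp only [eulerArnoldTerm_eq, bracket_smul_right, innerABK_smul_right]
  ring

theorem eulerArnoldTerm_sum_eq_zero (u : ℝ → VectorFields n M) (t : ℝ) {ι : Type*}
    (s : Finset ι) {w : ι → VectorFields n M}
    (h : ∀ i ∈ s, eulerArnoldTerm g α β κ u t (w i) = 0) :
    eulerArnoldTerm g α β κ u t (∑ i ∈ s, w i) = 0 := by
  classical
  refine Finset.sum_induction w (fun v => eulerArnoldTerm g α β κ u t v = 0) ?_ ?_ h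
  · intro v w hv hw
    rw [eulerArnoldTerm_add, hv, hw, add_zero]
  · have h1 := eulerArnoldTerm_smul g α β κ u t 0 0
    rwa [zero_smul, zero_mul] at h1

theorem sum_field_apply {ι : Type*} (s : Finset ι) (w : ι → VectorFields n M) (x : M) :
    (∑ i ∈ s, w i) x = ∑ i ∈ s, w i x := by
  classical
  induction s using Finset.induction_on with
  | empty => rfl
  | insert a s ha ih => rw [Finset.sum_insert ha, Finset.sum_insert ha, ← ih]; rfl

/-- The bracket with a fixed field as an additive map. -/
def bracketLeftHom (v : VectorFields n M) : VectorFields n M →+ VectorFields n M :=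
  AddMonoidHom.mk' (fun u => bracket u v) fun u w => by
    ext1 x
    exact mlieBracket_add_left (V := u) (V₁ := w) (W := v) (u.diffAt x) (w.diffAt x)

/-- A field is the combination of the global frame with its components as coefficients. -/
theorem sum_funSmul_frame {g : Metric n M} {u : VectorFields n M} {f : (frame g).ι → M → ℝ}
    (hf : ∀ a, SmoothFun (n := n) (f a)) (h : ∀ a x, f a x = g.inner x ((frame g).Y a x) (u x)) :
    ∑ a, funSmul (f a) (hf a) ((frame g).X a) = u := by
  ext1 x
  rw [sum_field_apply]
  refine Eq.trans ?_ (frame_sum_inner (frame g) (u x))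
  refine Finset.sum_congr rfl fun a _ => ?_
  rw [← h a x]
  rfl

variable {g} {P : Type*} [NormedAddCommGroup P] [NormedSpace ℝ P] {W : Set P}

/-- The brackets of a smooth family of fields with a fixed field form a smooth family. -/
theorem FieldFamily.bracket_const (hW : IsOpen W) {u : P → VectorFields n M}
    (hu : FieldFamily g W u) (v : VectorFields n M) :
    FieldFamily g W (fun p => bracket (u p) v) := by
  intro w
  have h : ∀ p ∈ W, ∀ x, g.inner x (w x) (bracket (u p) v x) = ∑ a,
      (g.inner x ((frame g).Y a x) (u p x) * g.inner x (w x) (bracket ((frame g).X a) v x) -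
        EulerArnold.dFun (n := n) (fun y => g.inner y ((frame g).Y a y) (u p y)) x (v x) *
          g.inner x (w x) ((frame g).X a x)) := by
    intro p hp x
    have hs := fun a => (hu ((frame g).Y a)).smoothFun hp
    have h1 := sum_funSmul_frame hs fun a x => rfl
    have h2 := map_sum (bracketLeftHom v) (fun a => funSmul _ (hs a) ((frame g).X a)) Finset.univ
    rw [h1] at h2
    have h3 : bracket (u p) v x =
        ∑ a, bracket (funSmul _ (hs a) ((frame g).X a)) v x :=
      (congrArg (fun z : VectorFields n M => z x) h2).trans (sum_field_apply _ _ x)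
    rw [h3, map_sum]
    refine Finset.sum_congr rfl fun a _ => ?_
    have h4 : bracket (funSmul _ (hs a) ((frame g).X a)) v x = _ :=
      mlieBracket_fun_smul_left (W := v) (FunSmoothAt.diffAt (hs a x)) (((frame g).X a).diffAt x)
    rw [h4, map_add, map_smul, map_smul, smul_eq_mul, smul_eq_mul, bracket_apply]
    ring
  refine ContMDiffOn.congr (FunFamily.sum (W := W) Finset.univ fun a _ => FunFamily.sub
    (FunFamily.mul (hu ((frame g).Y a)) (FunFamily.const (smoothFun_inner g w
      (bracket ((frame g).X a) v)))) (FunFamily.mul ((hu ((frame g).Y a)).dFun hW v)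
      (FunFamily.const (smoothFun_inner g w ((frame g).X a))))) fun q hq => ?_
  exact h q.1 hq.1 q.2

theorem continuousOn_eulerArnoldTerm (α β κ : ℝ) {J : Set ℝ} (hJ : IsOpen J)
    {u : ℝ → VectorFields n M} (hu : FieldFamily g J u) (v : VectorFields n M) :
    ContinuousOn (fun t => eulerArnoldTerm g α β κ u t v) J := by
  simp only [eulerArnoldTerm_eq, timeDeriv_eq]
  exact (continuousOn_innerABK hJ (hu.deriv hJ _) (FieldFamily.const v) α β κ).sub
    (continuousOn_innerABK hJ hu (hu.bracket_const hJ v) α β κ)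

end Linearity

section Geodesic

variable {n : ℕ} {M : Type*} [TopologicalSpace M] [ChartedSpace (EuclideanSpace ℝ (Fin n)) M]
  [IsManifold (𝓡 n) ∞ M] [CompactSpace M] [T2Space M] [MeasurableSpace M] [BorelSpace M]
  {g : Metric n M} {α β κ : ℝ} {J : Set ℝ} {φ : ℝ → Diff n M}

theorem IsSmoothCurve.fieldFamily (g : Metric n M) (hJ : IsOpen J) (hφ : IsSmoothCurve J φ) :
    FieldFamily g J (reducedVelocity φ) :=
  DiffFamily.fieldFamily (Φ := φ) g hJ hφ (1 : ℝ)

theorem isGeodesic_of_solvesEulerArnold (hJ : IsOpen J)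
    (h : SolvesEulerArnold g α β κ J (reducedVelocity φ)) : IsGeodesic g α β κ J φ := by
  intro a b hab hI ε hε Φ hΦ hΦ0 hend
  have h1 := hasDerivAt_energy (g := g) hJ α β κ hab hI hε hΦ hΦ0 hend
  refine h1.congr_deriv ?_
  rw [neg_eq_zero, intervalIntegral.integral_of_le hab.le]
  refine setIntegral_eq_zero_of_forall_eq_zero fun t ht => ?_
  exact (solvesEulerArnold_iff α β κ _).1 h t (hI (Ioc_subset_Icc_self ht)) _

/-- Along a geodesic, the Euler–Arnold functional vanishes on the initial velocities of families of
diffeomorphisms: the curve is varied by `ψ (s χ(t)) ∘ φ t` for bump functions `χ`. -/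
theorem IsGeodesic.eulerArnoldTerm_eq_zero (hJ : IsOpen J) (hφ : IsSmoothCurve J φ)
    (hgeo : IsGeodesic g α β κ J φ) {δ : ℝ} (hδ : 0 < δ) {ψ : ℝ → Diff n M}
    (hψ : DiffFamily (Ioo (-δ) δ) ψ) (hψ0 : ∀ x, ψ 0 x = x) {t₀ : ℝ} (ht₀ : t₀ ∈ J) :
    eulerArnoldTerm g α β κ (reducedVelocity φ) t₀ (familyVelocity (1 : ℝ) ψ 0) = 0 := by
  set v := familyVelocity (1 : ℝ) ψ 0 with hv
  set A : ℝ → ℝ := fun t => eulerArnoldTerm g α β κ (reducedVelocity φ) t v with hA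
  by_contra hne
  have hcont : ContinuousOn A J :=
    continuousOn_eulerArnoldTerm α β κ hJ (hφ.fieldFamily g hJ) v
  -- near `t₀` the functional does not change its sign
  have hpos : ∀ᶠ t in 𝓝 t₀, t ∈ J ∧ 0 < A t * A t₀ := by
    have h1 : ContinuousAt (fun t => A t * A t₀) t₀ :=
      (hcont.continuousAt (hJ.mem_nhds ht₀)).mul continuousAt_const
    exact Filter.Eventually.and (hJ.mem_nhds ht₀)
      (h1.eventually_const_lt (mul_self_pos.2 hne))
  obtain ⟨r, hr, hball⟩ := Metric.nhds_basis_closedBall.eventually_iff.1 hpos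
  have hIcc : ∀ t ∈ Icc (t₀ - r) (t₀ + r), t ∈ J ∧ 0 < A t * A t₀ := fun t ht => by
    refine hball ?_
    rwa [Real.closedBall_eq_Icc]
  let χ : ContDiffBump t₀ := ⟨r / 3, r / 2, by positivity, by linarith⟩
  have hab : t₀ - r < t₀ + r := by linarith
  have hχ0 : ∀ t, r / 2 ≤ dist t t₀ → χ t = 0 := fun t ht => χ.zero_of_le_dist ht
  have hmem : ∀ s ∈ Ioo (-δ) δ, ∀ t, s * χ t ∈ Ioo (-δ) δ := by
    intro s hs t
    have h1 : |s * χ t| < δ := by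
      rw [abs_mul, abs_of_nonneg (χ.nonneg (x := t))]
      have h2 : |s| < δ := abs_lt.2 ⟨hs.1, hs.2⟩
      have h3 := χ.le_one (x := t)
      have h4 := χ.nonneg (x := t)
      have h5 := abs_nonneg s
      nlinarith
    exact ⟨(abs_lt.1 h1).1, (abs_lt.1 h1).2⟩
  let Φ : ℝ → ℝ → Diff n M := fun s t => (φ t).trans (ψ (s * χ t))
  have hΦa : ∀ s t x, Φ s t x = ψ (s * χ t) (φ t x) := fun s t x => rfl
  have hΦ : IsSmoothFamily (Ioo (-δ) δ) J Φ := by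
    have h1 : ContMDiffOn (𝓘(ℝ, ℝ).prod (𝓘(ℝ, ℝ).prod (𝓡 n))) (𝓡 n) ∞
        (fun q : ℝ × ℝ × M => φ q.2.1 q.2.2) (Ioo (-δ) δ ×ˢ J ×ˢ univ) :=
      ContMDiffOn.comp (g := fun p : ℝ × M => φ p.1 p.2) hφ contMDiffOn_snd fun q hq => hq.2
    have h2 : ContMDiff (𝓘(ℝ, ℝ).prod (𝓘(ℝ, ℝ).prod (𝓡 n))) 𝓘(ℝ, ℝ) ∞
        (fun q : ℝ × ℝ × M => q.1 * χ q.2.1) :=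
      ContMDiff.mul contMDiff_fst (χ.contDiff.contMDiff.comp (contMDiff_fst.comp contMDiff_snd))
    exact ContMDiffOn.comp (g := fun q : ℝ × M => ψ q.1 q.2) hψ (h2.contMDiffOn.prodMk h1)
      fun q hq => ⟨hmem q.1 hq.1 q.2.1, mem_univ _⟩
  have hΦ0 : ∀ s t, s * χ t = 0 → Φ s t = φ t := by
    intro s t hst
    ext x
    rw [hΦa, hst, hψ0]
  have hW : IsOpen (Ioo (-δ) δ ×ˢ J) := isOpen_Ioo.prod hJ
  have h0 : (0 : ℝ) ∈ Ioo (-δ) δ := ⟨by linarith, hδ⟩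
  have hend : ∀ s, ∀ t, r / 2 ≤ dist t t₀ → Φ s t = φ t := fun s t ht => by
    refine hΦ0 s t ?_
    rw [hχ0 t ht, mul_zero]
  have hJI : Icc (t₀ - r) (t₀ + r) ⊆ J := fun t ht => (hIcc t ht).1
  have hend' : ∀ s ∈ Ioo (-δ) δ, Φ s (t₀ - r) = φ (t₀ - r) ∧ Φ s (t₀ + r) = φ (t₀ + r) := by
    intro s _
    refine ⟨hend s _ ?_, hend s _ ?_⟩ <;> rw [Real.dist_eq]
    · rw [show t₀ - r - t₀ = -r by ring, abs_neg, abs_of_pos hr]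
      linarith
    · rw [show t₀ + r - t₀ = r by ring, abs_of_pos hr]
      linarith
  have hzero : ∀ t, Φ 0 t = φ t := fun t => hΦ0 0 t (zero_mul _)
  have hd1 := hasDerivAt_energy (g := g) hJ α β κ hab hJI hδ hΦ (fun t _ => hzero t) hend'
  have hd2 := hgeo _ _ hab hJI δ hδ Φ hΦ (fun t _ => hzero t) hend'
  -- the variation field is `χ(t) v`
  have hvar : ∀ t ∈ J, familyVelocity ((1 : ℝ), (0 : ℝ)) (fun p : ℝ × ℝ => Φ p.1 p.2) (0, t) =
      χ t • v := by
    intro t ht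
    ext1 y
    have h1 : Φ 0 t ((φ t).symm y) = y := by
      rw [hzero]
      exact (φ t).apply_symm_apply y
    have hl : HasDerivAt (fun s : ℝ => (s, t)) ((1 : ℝ), (0 : ℝ)) 0 :=
      (hasDerivAt_id 0).prodMk (hasDerivAt_const 0 t)
    refine tangent_ext fun f hf => ?_
    have h2 := hasLineDerivAt_comp_family hW hΦ.diffFamily
      (FunFamily.const (W := Ioo (-δ) δ ×ˢ J) hf) (p := ((0 : ℝ), t)) ⟨h0, ht⟩ ((1 : ℝ), (0 : ℝ))
      ((φ t).symm y)
    have h3 : paramDeriv ((1 : ℝ), (0 : ℝ)) (fun (_ : ℝ × ℝ) x => f x) (0, t)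
        (Φ 0 t ((φ t).symm y)) = 0 := by simp [paramDeriv]
    rw [h3, zero_add, h1] at h2
    have h4 := hasLineDerivAt_comp_family isOpen_Ioo hψ (FunFamily.const (W := Ioo (-δ) δ) hf) h0
      (1 : ℝ) y
    have h5 : paramDeriv (1 : ℝ) (fun (_ : ℝ) x => f x) 0 (ψ 0 y) = 0 := by simp [paramDeriv]
    rw [h5, zero_add, hψ0] at h4
    have h6 : HasDerivAt (fun s : ℝ => f (ψ s y)) (dFun (n := n) f y (v y)) 0 :=
      hasDerivAt_of_hasLineDerivAt_one h4
    have h7 : HasDerivAt (fun s : ℝ => f (ψ (s * χ t) y))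
        (dFun (n := n) f y (v y) * χ t) 0 := by
      have h8 : HasDerivAt (fun s : ℝ => s * χ t) (χ t) 0 := by
        simpa using (hasDerivAt_id (0 : ℝ)).mul_const (χ t)
      refine HasDerivAt.comp (h₂ := fun s => f (ψ s y)) (0 : ℝ) ?_ h8
      rwa [zero_mul]
    have h9 : HasDerivAt (fun s : ℝ => f (ψ (s * χ t) y)) (dFun (n := n) f y (familyVelocity
        ((1 : ℝ), (0 : ℝ)) (fun p : ℝ × ℝ => Φ p.1 p.2) (0, t) y)) 0 := by
      have h10 : HasDerivAt (fun s : ℝ => f (Φ (((0 : ℝ), t) + s • ((1 : ℝ), (0 : ℝ))).1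
          (((0 : ℝ), t) + s • ((1 : ℝ), (0 : ℝ))).2 ((φ t).symm y))) (dFun (n := n) f y
          (familyVelocity ((1 : ℝ), (0 : ℝ)) (fun p : ℝ × ℝ => Φ p.1 p.2) (0, t) y)) 0 := h2
      refine h10.congr_of_eventuallyEq (Eventually.of_forall fun s => ?_)
      simp only [Prod.smul_mk, smul_eq_mul, mul_one, mul_zero, Prod.mk_add_mk, zero_add, add_zero]
      rw [hΦa, (φ t).apply_symm_apply]
    rw [h9.unique h7, smul_field_apply, map_smul, smul_eq_mul, mul_comm]
  have hint := hd1.unique hd2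
  rw [neg_eq_zero] at hint
  have hint2 : ∫ t in (t₀ - r)..(t₀ + r), χ t * (A t * A t₀) = 0 := by
    have h1 : ∫ t in (t₀ - r)..(t₀ + r), χ t * (A t * A t₀) =
        (∫ t in (t₀ - r)..(t₀ + r), eulerArnoldTerm g α β κ (reducedVelocity φ) t
          (familyVelocity ((1 : ℝ), (0 : ℝ)) (fun p : ℝ × ℝ => Φ p.1 p.2) (0, t))) * A t₀ := by
      rw [← intervalIntegral.integral_mul_const]
      refine intervalIntegral.integral_congr fun t ht => ?_
      rw [uIcc_of_le hab.le] at ht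
      simp only [hvar t (hJI ht), eulerArnoldTerm_smul, hA]
      ring
    rw [h1, hint, zero_mul]
  -- the derivative of the energy is zero, but the integrand is non-negative and positive at `t₀`
  have hgt : 0 < ∫ t in (t₀ - r)..(t₀ + r), χ t * (A t * A t₀) := by
    refine intervalIntegral.integral_pos hab ?_ ?_ ⟨t₀, ⟨by linarith, by linarith⟩, ?_⟩
    · exact χ.continuous.continuousOn.mul ((hcont.mono hJI).mul continuousOn_const)
    · intro t ht
      exact mul_nonneg χ.nonneg (hIcc t (Ioc_subset_Icc_self ht)).2.le
    · rw [χ.one_of_mem_closedBall (Metric.mem_closedBall_self (by positivity)), one_mul]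
      exact mul_self_pos.2 hne
  exact hgt.ne' hint2

/-- A geodesic solves the Euler–Arnold equation: a field `w` is a finite sum of fields `h ∂ᵢ` with
`h` supported in a chart, and the functional vanishes on each of them. -/
theorem solvesEulerArnold_of_isGeodesic (hJ : IsOpen J) (hφ : IsSmoothCurve J φ)
    (hgeo : IsGeodesic g α β κ J φ) : SolvesEulerArnold g α β κ J (reducedVelocity φ) := by
  refine (solvesEulerArnold_iff α β κ _).2 fun t ht w => ?_
  have hs := fun a => smoothFun_inner g ((frame g).Y a) w
  rw [← sum_funSmul_frame hs fun a x => rfl]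
  refine eulerArnoldTerm_sum_eq_zero g α β κ _ t _ fun a _ => ?_
  have hh : SmoothFun (n := n)
      (fun x => g.inner x ((frame g).Y a x) (w x) * partition n M a.1.1 x) :=
    (hs a).mul (partition n M a.1.1).contMDiff
  have hsupp : tsupport (fun x => g.inner x ((frame g).Y a x) (w x) * partition n M a.1.1 x) ⊆
      (chartAt (EuclideanSpace ℝ (Fin n)) a.1.1).source := by
    refine (closure_mono fun x hx => ?_).trans (partition_isSubordinate n M a.1.1)
    exact fun h0 => hx (by simp [h0])
  obtain ⟨δ, hδ, ψ, hψ, hψ0, hv⟩ := exists_diffFamily_velocity hh hsupp (basisVec a.1.1 a.2)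
    (funSmul _ (hs a) ((frame g).X a)) fun x => by
      rw [mul_smul]
      rfl
  rw [← hv]
  exact hgeo.eulerArnoldTerm_eq_zero hJ hφ hδ hψ hψ0 ht

theorem isGeodesic_iff_solvesEulerArnold (hJ : IsOpen J) (hφ : IsSmoothCurve J φ) :
    IsGeodesic g α β κ J φ ↔ SolvesEulerArnold g α β κ J (reducedVelocity φ) :=
  ⟨solvesEulerArnold_of_isGeodesic hJ hφ, isGeodesic_of_solvesEulerArnold hJ⟩

end Geodesic

end EulerArnold

end

theorem proposition2p1 {n : ℕ} {M : Type*} [TopologicalSpace M]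
    [ChartedSpace (EuclideanSpace ℝ (Fin n)) M] [IsManifold (𝓡 n) ∞ M]
    [CompactSpace M] [T2Space M] [MeasurableSpace M] [BorelSpace M]
    (g : Metric n M) (α β γ κ : ℝ) (hα : 0 < α) (hβ : 0 < β)
    (hκ₀ : 0 ≤ κ) (hκ₁ : κ ≤ 1) (hγ : 1 - γ = (1 - κ) ^ 2) :
    -- `𝒜` is the inertia operator of the inner product
    (∀ (u : VectorFields n M) (m : OneForms n M), IsInertia g α β γ u m →
      ∀ v : VectorFields n M, innerABK g α β κ u v = pairing g m v) ∧
    -- `ad*_u m = L_u m + div(u) m`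
    (∀ (u : VectorFields n M) (m : OneForms n M) (v : VectorFields n M),
      adStar u (pairing g m) v =
        ∫ x, (lieForm u m v x + divergence g u x * m x (v x)) ∂(vol g)) ∧
    -- the equation is the abstract Euler–Arnold equation
    (∀ (J : Set ℝ), IsOpen J → ∀ (u : ℝ → VectorFields n M) (m : ℝ → OneForms n M),
      IsSmoothFieldCurve J u → IsSmoothFormCurve J m →
      (∀ t ∈ J, IsInertia g α β γ (u t) (m t)) →
      (SolvesEquation g J u m ↔ SolvesEulerArnold g α β κ J u)) ∧
    -- the abstract Euler–Arnold equation is the right reduced geodesic equation on `Diff(M)`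
    (∀ (J : Set ℝ), IsOpen J → ∀ φ : ℝ → Diff n M, IsSmoothCurve J φ →
      (IsGeodesic g α β κ J φ ↔ SolvesEulerArnold g α β κ J (reducedVelocity φ))) ∧
    -- the equation is the right reduced geodesic equation on `Diff(M)`
    (∀ (J : Set ℝ), IsOpen J → ∀ (φ : ℝ → Diff n M) (m : ℝ → OneForms n M),
      IsSmoothCurve J φ → IsSmoothFormCurve J m →
      (∀ t ∈ J, IsInertia g α β γ (reducedVelocity φ t) (m t)) →
      (IsGeodesic g α β κ J φ ↔ SolvesEquation g J (reducedVelocity φ) m)) := by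
  refine ⟨fun u m hm v => innerABK_eq_pairing g hγ hm v, fun u m v => adStar_pairing g u m v,
    fun J hJ u m hu hm hum => ?_, fun J hJ φ hφ => isGeodesic_iff_solvesEulerArnold hJ hφ,
    fun J hJ φ m hφ hm hum => ?_⟩
  · exact solvesEquation_iff hJ (FieldFamily.of_isSmoothFieldCurve g hu) hm.funFamily
      fun t ht v => innerABK_eq_pairing g hγ (hum t ht) v
  · rw [isGeodesic_iff_solvesEulerArnold hJ hφ]
    exact (solvesEquation_iff hJ (hφ.fieldFamily g hJ) hm.funFamily
      fun t ht v => innerABK_eq_pairing g hγ (hum t ht) v).symm
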